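/- Let $n\ge 0$. There is a finite list of non-zero polynomials with integer coefficients ("resonances"), depending only on $n$, each in at most $2n+2$ vector variables $y_1,y_2,\dots$ with $y_a\in\mathbb C^n$, such that the following holds for every $m$ and every list $S=(v_1,\dots,v_m)$ of vectors of $\mathbb Z^n$ which is generic, i.e. such that no resonance vanishes at any choice of entries of the list with distinct indices. Notation. $S^c=\mathbb Z^n\setminus S$ and $\pi(\mu)=\sum_i\mu_iv_i$ for $\mu\in\mathbb Z^m$; $e_1,\dots,e_m$ is the standard basis of $\mathbb Z^m$. The geometric graph $\Gamma_S$ has vertex set $\mathbb R^n$. For $i\neq j$ there is a black edge from $a$ to $b$ marked $v_j-v_i$ if $b-a=v_j-v_i$ and $|b|^2-|a|^2=|v_j|^2-|v_i|^2$, and a red edge between $a$ and $b$ marked $v_i+v_j$ if $a+b=v_i+v_j$ and $|a|^2+|b|^2=|v_i|^2+|v_j|^2$ (we speak of an edge of type $(i,j)$). The combinatorial graph $\Lambda_S$ has vertex set $\mathbb Z^m\times\{\pm\}$. Write $k=-\pi(\mu)$ and $h=-\pi(\nu)$. For $i\ne j$ there is a black edge from $(\mu,\sigma)$ to $(\nu,\sigma)$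 marked $(i,j)$ if $\nu=\mu+e_i-e_j$ and $|h|^2-|k|^2=|v_j|^2-|v_i|^2$, and a red edge between $(\mu,\sigma)$ and $(\nu,-\sigma)$ marked $(i,j)$ if $\mu+\nu+e_i+e_j=0$ and $|h|^2+|k|^2=|v_i|^2+|v_j|^2$. For $\xi\in\mathbb R_{>0}^m$ let $N=\sum_i\omega_iy_i+\sum_{k\in S^c}\Omega_k|z_k|^2+Q$, where $\omega_i=|v_i|^2-2\xi_i+4\sum_j\xi_j$, $\Omega_k=|k|^2+4\sum_j\xi_j$ and $$Q=4\sum_{i\ne j}\sqrt{\xi_i\xi_j}\,e^{\mathrm i(x_i-x_j)}z_h\bar z_k+2\sum_{i<j}\sqrt{\xi_i\xi_j}\,e^{-\mathrm i(x_i+x_j)}z_hz_k+2\sum_{i<j}\sqrt{\xi_i\xi_j}\,e^{\mathrm i(x_i+x_j)}\bar z_h\bar z_k ;$$ here $h,k$ run over $S^c$, in the first sum with $h+v_i=k+v_j$, $|h|^2+|v_i|^2=|k|^2+|v_j|^2$, in the other two with $h+k=v_i+v_j$, $|h|^2+|k|^2=|v_i|^2+|v_j|^2$. Put $ad(F)=\{F,\cdot\}$,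 where $$\{F,G\}=\sum_j\big(\partial_{y_j}F\,\partial_{x_j}G-\partial_{y_j}G\,\partial_{x_j}F\big)+\mathrm i\sum_{k\in S^c}\big(\partial_{\bar z_k}F\,\partial_{z_k}G-\partial_{z_k}F\,\partial_{\bar z_k}G\big).$$ To each vertex $(\mu,\sigma)$ of $\Lambda_S$ with $k=-\pi(\mu)\in S^c$ we associate the element of the frequency basis $e_{(\mu,+)}=e^{\mathrm i\mu\cdot x}z_k$, $e_{(\mu,-)}=e^{-\mathrm i\mu\cdot x}\bar z_k$. Conclusions. (0) For vertices $p\neq q$ of $\Lambda_S$ with $-\pi(p),-\pi(q)\in S^c$ and every $\xi$, the coefficient of $e_q$ in $ad(N)e_p$ is non-zero if and only if $p,q$ are joined by an edge of $\Lambda_S$. For every $i$, the connected component of $v_i$ in $\Gamma_S$ has vertex set $\{v_1,\dots,v_m\}$ (the special component). Let $p=(\mu,\sigma)$ be any vertex of $\Lambda_S$ with $k=-\pi(\mu)\in S^c$, let $\mathcal A$ be its connected component in $\Lambda_S$ and $A$ the connected component of $k$ in $\Gamma_S$. (1) The map $(\nu,\tau)\mapsto-\pi(\nu)$ is a graph isomorphism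 from $\mathcal A$ onto $A$, compatible with colours and markings: for $q,q'\in\mathcal A$ and $i\ne j$ there is a black (red) edge marked $(i,j)$ from $q$ to $q'$ if and only if there is a black (red) edge of type $(i,j)$ from $-\pi(q)$ to $-\pi(q')$. (2) Let $W$ be the complex vector space spanned by all the transforms of $e_p$ obtained by repeatedly applying the operators $ad(N)$, with parameters $\xi\in\mathbb R_{>0}^m$. Then $W$ has a basis $(b_x)_{x\in A}$ indexed by the vertices of $A$, where $b_x=e_q$ for a vertex $q\in\mathcal A$ with $-\pi(q)=x$. The same space is obtained with $ad(Q)$ in place of $ad(N)$. For every fixed $\xi\in\mathbb R_{>0}^m$, $W$ is $ad(N)$-invariant, and it is contained in every $ad(N)$-invariant subspace that contains $e_p$ and is spanned by elements of the frequency basis. -/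

import Mathlib

namespace NLSGraph

open scoped Matrix

/-! ## Tangential sites and genericity -/

/-- A list `v` of `m` tangential sites in `ℤⁿ` is generic with respect to a finite list `R` of
resonance polynomials if no polynomial of the list vanishes at any choice of entries, with distinct indices, of
the list of sites. A resonance is a pair `⟨k, P⟩`, where `P` is an integer polynomial in the
`k * n` coordinates of `k` vector variables. -/
def IsGeneric {n m : ℕ} (R : Finset (Σ k : ℕ, MvPolynomial (Fin k × Fin n) ℤ))
    (v : Fin m → Fin n → ℤ) : Prop :=
  ∀ r ∈ R, ∀ f : Fin r.1 ↪ Fin m,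
    MvPolynomial.eval (fun a : Fin r.1 × Fin n => v (f a.1) a.2) r.2 ≠ 0

/-- The normal sites: the lattice points which are not tangential. -/
abbrev NormalSite {n m : ℕ} (v : Fin m → Fin n → ℤ) : Type :=
  {k : Fin n → ℤ // k ∉ Set.range v}

/-- The inclusion of `ℤⁿ` in Euclidean space. -/
noncomputable def toEuclid {n : ℕ} (k : Fin n → ℤ) : EuclideanSpace ℝ (Fin n) :=
  WithLp.toLp 2 (fun l => (k l : ℝ))

/-! ## The geometric graph -/

/-- Points `a`, `b` are joined by a black edge, oriented from `a` to `b`, with marking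
`v j - v i`. -/
def GeoBlack {n m : ℕ} (v : Fin m → Fin n → ℤ) (i j : Fin m)
    (a b : EuclideanSpace ℝ (Fin n)) : Prop :=
  b - a = toEuclid (v j) - toEuclid (v i) ∧
    ‖b‖ ^ 2 - ‖a‖ ^ 2 = ‖toEuclid (v j)‖ ^ 2 - ‖toEuclid (v i)‖ ^ 2

/-- Points `a`, `b` are joined by a red edge with marking `v i + v j`. -/
def GeoRed {n m : ℕ} (v : Fin m → Fin n → ℤ) (i j : Fin m)
    (a b : EuclideanSpace ℝ (Fin n)) : Prop :=
  a + b = toEuclid (v i) + toEuclid (v j) ∧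
    ‖a‖ ^ 2 + ‖b‖ ^ 2 = ‖toEuclid (v i)‖ ^ 2 + ‖toEuclid (v j)‖ ^ 2

/-- The geometric graph `Γ_S`, whose vertices are all the points of `ℝⁿ`. -/
def geometricGraph {n m : ℕ} (v : Fin m → Fin n → ℤ) :
    SimpleGraph (EuclideanSpace ℝ (Fin n)) :=
  SimpleGraph.fromRel fun a b => ∃ i j : Fin m, i ≠ j ∧ (GeoBlack v i j a b ∨ GeoRed v i j a b)

/-! ## The combinatorial graph -/

/-- A frequency with a sign: `(μ, 1)` stands for `e^{iμ·x} z_k` and `(μ, -1)` for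
`e^{-iμ·x} z̄_k`, with `k = -π(μ)`. -/
abbrev Frequency (m : ℕ) : Type := (Fin m → ℤ) × ℤˣ

/-- The map `π : ℤᵐ → ℤⁿ`, `π(μ) = ∑ μᵢ vᵢ`. -/
def momentum {n m : ℕ} (v : Fin m → Fin n → ℤ) (μ : Fin m → ℤ) : Fin n → ℤ :=
  ∑ i, μ i • v i

/-- The site `-π(μ)` of the frequency `(μ, σ)`. -/
def site {n m : ℕ} (v : Fin m → Fin n → ℤ) (p : Frequency m) : Fin n → ℤ :=
  -momentum v p.1

/-- The basis vector `e_i` of `ℤᵐ`. -/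
def unitVec {m : ℕ} (i : Fin m) : Fin m → ℤ := Pi.single i 1

/-- Black edge of the combinatorial graph, oriented from `p` to `q`, with marking `(i, j)`. -/
def CombBlack {n m : ℕ} (v : Fin m → Fin n → ℤ) (i j : Fin m) (p q : Frequency m) : Prop :=
  p.2 = q.2 ∧ q.1 = p.1 + unitVec i - unitVec j ∧
    site v q ⬝ᵥ site v q - site v p ⬝ᵥ site v p = v j ⬝ᵥ v j - v i ⬝ᵥ v i

/-- Red edge of the combinatorial graph, with marking `(i, j)`. -/
def CombRed {n m : ℕ} (v : Fin m → Fin n → ℤ) (i j : Fin m) (p q : Frequency m) : Prop :=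
  p.2 = -q.2 ∧ p.1 + q.1 + unitVec i + unitVec j = 0 ∧
    site v p ⬝ᵥ site v p + site v q ⬝ᵥ site v q = v i ⬝ᵥ v i + v j ⬝ᵥ v j

/-- The combinatorial graph `Λ_S`, with vertices `ℤᵐ × ℤ/(2)`. -/
def combinatorialGraph {n m : ℕ} (v : Fin m → Fin n → ℤ) : SimpleGraph (Frequency m) :=
  SimpleGraph.fromRel fun p q => ∃ i j : Fin m, i ≠ j ∧ (CombBlack v i j p q ∨ CombRed v i j p q)

/-! ## The Poisson algebra of finite sums of monomials `e^{iν·x} y^c z^α z̄^β` -/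

/-- Exponents `(ν, c, γ)` of the monomial `e^{iν·x} y^c ∏ z_k^{γ(k, 1)} z̄_k^{γ(k, -1)}`. -/
abbrev Exponent {n m : ℕ} (v : Fin m → Fin n → ℤ) : Type :=
  (Fin m → ℤ) × (Fin m →₀ ℕ) × (NormalSite v × ℤˣ →₀ ℕ)

/-- Finite complex combinations of monomials, with the product of functions. -/
abbrev PoissonAlg {n m : ℕ} (v : Fin m → Fin n → ℤ) : Type := AddMonoidAlgebra ℂ (Exponent v)

/-- The function `c e^{iν·x}`. -/
noncomputable def expX {n m : ℕ} (v : Fin m → Fin n → ℤ) (c : ℂ) (ν : Fin m → ℤ) :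
    PoissonAlg v :=
  AddMonoidAlgebra.single (ν, 0, 0) c

/-- The coordinate `y_j`. -/
noncomputable def varY {n m : ℕ} (v : Fin m → Fin n → ℤ) (j : Fin m) : PoissonAlg v :=
  AddMonoidAlgebra.single (0, Finsupp.single j 1, 0) 1

/-- The coordinate `z_k` (for `σ = 1`) or `z̄_k` (for `σ = -1`). -/
noncomputable def varW {n m : ℕ} {v : Fin m → Fin n → ℤ} (k : NormalSite v) (σ : ℤˣ) :
    PoissonAlg v :=
  AddMonoidAlgebra.single (0, 0, Finsupp.single (k, σ) 1) 1

/-- The derivative `∂/∂x_j`. -/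
noncomputable def derivX {n m : ℕ} {v : Fin m → Fin n → ℤ} (j : Fin m) (F : PoissonAlg v) :
    PoissonAlg v :=
  F.coeff.sum fun a c => AddMonoidAlgebra.single a (Complex.I * (a.1 j : ℂ) * c)

/-- The derivative `∂/∂y_j`. -/
noncomputable def derivY {n m : ℕ} {v : Fin m → Fin n → ℤ} (j : Fin m) (F : PoissonAlg v) :
    PoissonAlg v :=
  F.coeff.sum fun a c =>
    AddMonoidAlgebra.single (a.1, a.2.1 - Finsupp.single j 1, a.2.2) ((a.2.1 j : ℂ) * c)

/-- The derivative `∂/∂z_k` (for `σ = 1`) or `∂/∂z̄_k` (for `σ = -1`). -/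
noncomputable def derivW {n m : ℕ} {v : Fin m → Fin n → ℤ} (k : NormalSite v) (σ : ℤˣ)
    (F : PoissonAlg v) : PoissonAlg v :=
  F.coeff.sum fun a c =>
    AddMonoidAlgebra.single (a.1, a.2.1, a.2.2 - Finsupp.single (k, σ) 1) ((a.2.2 (k, σ) : ℂ) * c)

/-- The Poisson bracket of the symplectic form `dy ∧ dx + i dz ∧ dz̄`. The sum over the sites has
finite support, since only finitely many sites occur in `F`. -/
noncomputable def poisson {n m : ℕ} {v : Fin m → Fin n → ℤ} (F G : PoissonAlg v) :
    PoissonAlg v :=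
  (∑ j, (derivY j F * derivX j G - derivY j G * derivX j F)) +
    Complex.I • ∑ᶠ k : NormalSite v,
      (derivW k (-1) F * derivW k 1 G - derivW k 1 F * derivW k (-1) G)

/-! ## The quadratic normal form -/

/-- The frequency `ω_i(ξ) = |v_i|² - 2 ξ_i + 4 ∑ ξ_j`. -/
noncomputable def omega {n m : ℕ} (v : Fin m → Fin n → ℤ) (ξ : Fin m → ℝ) (i : Fin m) : ℝ :=
  ((v i ⬝ᵥ v i : ℤ) : ℝ) - 2 * ξ i + 4 * ∑ j, ξ j

/-- The normal frequency `Ω_k(ξ) = |k|² + 4 ∑ ξ_j`. -/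
noncomputable def Omega {n m : ℕ} {v : Fin m → Fin n → ℤ} (ξ : Fin m → ℝ) (k : NormalSite v) : ℝ :=
  ((k.1 ⬝ᵥ k.1 : ℤ) : ℝ) + 4 * ∑ j, ξ j

/-- Index set of the terms `z_h z̄_k`: quadruples `(i, j, h, k)` with `i ≠ j`,
`h + v_i = k + v_j` and `|h|² + |v_i|² = |k|² + |v_j|²`. -/
def BlackTerm {n m : ℕ} (v : Fin m → Fin n → ℤ) : Type :=
  {t : Fin m × Fin m × NormalSite v × NormalSite v //
    t.1 ≠ t.2.1 ∧ t.2.2.1.1 + v t.1 = t.2.2.2.1 + v t.2.1 ∧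
      t.2.2.1.1 ⬝ᵥ t.2.2.1.1 + v t.1 ⬝ᵥ v t.1 = t.2.2.2.1 ⬝ᵥ t.2.2.2.1 + v t.2.1 ⬝ᵥ v t.2.1}

/-- Index set of the terms `z_h z_k` and `z̄_h z̄_k`: quadruples `(i, j, h, k)` with `i < j`,
`h + k = v_i + v_j` and `|h|² + |k|² = |v_i|² + |v_j|²`. -/
def RedTerm {n m : ℕ} (v : Fin m → Fin n → ℤ) : Type :=
  {t : Fin m × Fin m × NormalSite v × NormalSite v //
    t.1 < t.2.1 ∧ t.2.2.1.1 + t.2.2.2.1 = v t.1 + v t.2.1 ∧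
      t.2.2.1.1 ⬝ᵥ t.2.2.1.1 + t.2.2.2.1 ⬝ᵥ t.2.2.2.1 = v t.1 ⬝ᵥ v t.1 + v t.2.1 ⬝ᵥ v t.2.1}

/-- The operator `ad(Q) : f ↦ {Q, f}` of the quadratic form
`Q = 4 ∑ √(ξᵢξⱼ) e^{i(xᵢ-xⱼ)} z_h z̄_k + 2 ∑ √(ξᵢξⱼ) e^{-i(xᵢ+xⱼ)} z_h z_k
  + 2 ∑ √(ξᵢξⱼ) e^{i(xᵢ+xⱼ)} z̄_h z̄_k`.
`Q` is a formal infinite sum, so the bracket is taken term by term. It is used only on elements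
which do not depend on `y`; for these only finitely many of the terms are non-zero. -/
noncomputable def adQ {n m : ℕ} (v : Fin m → Fin n → ℤ) (ξ : Fin m → ℝ) (f : PoissonAlg v) :
    PoissonAlg v :=
  (∑ᶠ t : BlackTerm v,
    poisson (expX v ((4 * √(ξ t.1.1 * ξ t.1.2.1) : ℝ) : ℂ) (unitVec t.1.1 - unitVec t.1.2.1) *
      varW t.1.2.2.1 1 * varW t.1.2.2.2 (-1)) f) +
  (∑ᶠ t : RedTerm v,
    poisson (expX v ((2 * √(ξ t.1.1 * ξ t.1.2.1) : ℝ) : ℂ) (-(unitVec t.1.1 + unitVec t.1.2.1)) *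
      varW t.1.2.2.1 1 * varW t.1.2.2.2 1) f) +
  (∑ᶠ t : RedTerm v,
    poisson (expX v ((2 * √(ξ t.1.1 * ξ t.1.2.1) : ℝ) : ℂ) (unitVec t.1.1 + unitVec t.1.2.1) *
      varW t.1.2.2.1 (-1) * varW t.1.2.2.2 (-1)) f)

/-- The operator `ad(N) : f ↦ {N, f}` of the normal form `N = (ω, y) + ∑ Ω_k |z_k|² + Q`, taken
term by term as for `ad(Q)`. -/
noncomputable def adN {n m : ℕ} (v : Fin m → Fin n → ℤ) (ξ : Fin m → ℝ) (f : PoissonAlg v) :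
    PoissonAlg v :=
  (∑ i, poisson ((omega v ξ i : ℂ) • varY v i) f) +
    (∑ᶠ k : NormalSite v, poisson ((Omega ξ k : ℂ) • (varW k 1 * varW k (-1))) f) + adQ v ξ f

/-! ## The frequency basis and its blocks -/

/-- The frequencies whose site is normal. -/
abbrev NormalFrequency {n m : ℕ} (v : Fin m → Fin n → ℤ) : Type :=
  {p : Frequency m // site v p ∉ Set.range v}

/-- The exponent of the basis element of a frequency. -/
noncomputable def freqExponent {n m : ℕ} {v : Fin m → Fin n → ℤ} (p : NormalFrequency v) :
    Exponent v :=
  ((p.1.2 : ℤ) • p.1.1, 0, Finsupp.single (⟨site v p.1, p.2⟩, p.1.2) 1)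

/-- The element of the frequency basis: `e^{iμ·x} z_k` for `(μ, 1)` and `e^{-iμ·x} z̄_k` for
`(μ, -1)`, where `k = -π(μ)`. -/
noncomputable def freqElem {n m : ℕ} {v : Fin m → Fin n → ℤ} (p : NormalFrequency v) :
    PoissonAlg v :=
  AddMonoidAlgebra.single (freqExponent p) 1

/-- The transforms of `f` under an operator `T ξ` which depends on the positive parameters `ξ`. -/
inductive IsTransform {n m : ℕ} {v : Fin m → Fin n → ℤ}
    (T : (Fin m → ℝ) → PoissonAlg v → PoissonAlg v) (f : PoissonAlg v) : PoissonAlg v → Prop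
  | base : IsTransform T f f
  | step (ξ : Fin m → ℝ) (g : PoissonAlg v) (hξ : ∀ i, 0 < ξ i) (hg : IsTransform T f g) :
      IsTransform T f (T ξ g)

/-- The space spanned by all the transforms of `f` under the operators `T ξ`. -/
noncomputable def block {n m : ℕ} {v : Fin m → Fin n → ℤ}
    (T : (Fin m → ℝ) → PoissonAlg v → PoissonAlg v) (f : PoissonAlg v) :
    Submodule ℂ (PoissonAlg v) :=
  Submodule.span ℂ {g | IsTransform T f g}

end NLSGraph

/-!
Along a path of `Λ_S` from `p`, a vertex `q` is determined by its colour and its position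
`a ∈ ℤ^m` relative to `p`, and mass and energy conservation turn into one equation for
`k = -π(p)`: linear, `2 ∑ aᵢ k · vᵢ = Q_a(v)`, if `q` has the colour of `p`, and the equation of a
sphere otherwise; here `Q_a(u) = ∑ aᵢ uᵢ² - (∑ aᵢ uᵢ)²`, summed over the coordinates.
Differences of sphere equations are linear, so `n + 1` linearly independent positions overdetermine
`k`, and the compatibility condition is a polynomial in the `vᵢ`. If it is a non-zero polynomial,
it is a resonance. If it vanishes identically, the quadratic forms of the system have a common
linear factor `uₓ` for some `x`; then `vₓ` solves the system, whence `k = vₓ`, which is excluded.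
So the positions span a space of dimension at most `n`.

Positions of one colour satisfy the same law `∑ (∑ aᵢ vᵢ)² = ∑ aᵢ yᵢ`. A linear relation between
them therefore also holds for the squared lengths, which is again a resonance unless the relation
is trivial. Hence there are at most `n` further vertices of each colour; components have at most
`2n + 1` vertices, with small positions supported on few indices. As this bound holds along any
growing connected set of vertices, finitely many resonances suffice. They also prevent two vertices
of a component from having the same site, which gives the isomorphism with the component of `Γ_S`.

Off the diagonal, `ad(N)` maps `e_p` to a combination of its neighbours with the coefficients
`±4i √(ξᵢ ξⱼ)`, up to positive integer factors. These have the same argument, so they do not cancel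
for any fixed `ξ`. A second difference in `√ξᵢ` and `√ξⱼ` isolates a single neighbour.
-/

namespace NLSGraph

open scoped Matrix

section LinearForms

/-- The square matrix obtained from the array `L` by adding the column `b` on the right. -/
def borderedMatrix {A : Type*} {r : ℕ} (L : Fin (r + 1) → Fin r → A) (b : Fin (r + 1) → A) :
    Matrix (Fin (r + 1)) (Fin (r + 1)) A :=
  Matrix.of fun s => Fin.snoc (L s) (b s)

theorem borderedMatrix_map {A B : Type*} {r : ℕ} (φ : A → B) (L : Fin (r + 1) → Fin r → A)
    (b : Fin (r + 1) → A) :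
    (borderedMatrix L b).map φ = borderedMatrix (fun s j => φ (L s j)) fun s => φ (b s) := by
  ext s j
  refine Fin.lastCases ?_ (fun j => ?_) j <;> simp [borderedMatrix]

variable {K V σ : Type*} [Field K] [AddCommGroup V] [Module K V]

theorem exists_forall_dual_apply_eq [Finite σ] {d : σ → Module.Dual K V}
    (hd : LinearIndependent K d) (f : σ → K) : ∃ u, ∀ s, d s u = f s := by
  have hfun : LinearIndependent K fun s => (d s : V → K) :=
    hd.map' (LinearMap.ltoFun K V K K) (LinearMap.ker_eq_bot.2 DFunLike.coe_injective)
  have hspan : Submodule.span K (Set.range (LinearMap.pi d)) = ⊤ :=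
    span_flip_eq_top_iff_linearIndependent.2 hfun
  have hf : f ∈ Submodule.span K (Set.range (LinearMap.pi d)) := hspan ▸ Submodule.mem_top
  rw [← LinearMap.coe_range, Submodule.span_eq] at hf
  exact hf.imp fun u hu => congrFun hu

theorem sum_quadraticForm_update [Fintype σ] [DecidableEq σ] (r : QuadraticForm K V) (z : σ → V)
    (s : σ) (u : V) :
    ∑ j, r (Function.update z s u j) = r u + ∑ j, r (Function.update z s 0 j) := by
  rw [← sub_eq_iff_eq_add, ← Finset.sum_sub_distrib, Fintype.sum_eq_single s]
  · simp
  · intro j hj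
    simp [hj]

theorem vecMul_apply_eq_zero_of_det_eq_zero [Fintype σ] [DecidableEq σ] {M : Matrix σ σ K}
    (hM : M.det = 0) {c : σ → K} {s : σ}
    (hc : ∀ y, (∀ j ≠ s, (y ᵥ* M) j = 0) → ∃ a : K, y = a • c) : (c ᵥ* M) s = 0 := by
  obtain ⟨y, hy, hyM⟩ := Matrix.exists_vecMul_eq_zero_iff.2 hM
  obtain ⟨a, rfl⟩ := hc y fun j _ => congrFun hyM j
  have hs := congrFun hyM s
  rw [Matrix.smul_vecMul, Pi.smul_apply, smul_eq_mul, Pi.zero_apply] at hs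
  exact (mul_eq_zero.1 hs).resolve_left fun ha => hy (by rw [ha, zero_smul])

theorem eq_smul_of_forall_mul_eq_mul {c y : σ → K} {s : σ} (hs : c s ≠ 0)
    (h : ∀ j ≠ s, c s * y j = c j * y s) : y = (y s / c s) • c := by
  funext j
  rw [Pi.smul_apply, smul_eq_mul]
  field_simp
  rcases eq_or_ne j s with rfl | hj
  · ring
  · linear_combination h j hj

theorem exists_eq_mul_of_mul_add_mul_eq_zero {a b x y : K} (hab : ¬ (a = 0 ∧ b = 0))
    (h : x * a + y * b = 0) : ∃ c, x = -(c * b) ∧ y = c * a := by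
  by_cases ha : a = 0
  · have hb : b ≠ 0 := fun hb => hab ⟨ha, hb⟩
    rw [ha, mul_zero, zero_add] at h
    refine ⟨-x / b, by field_simp, ?_⟩
    rw [ha, mul_zero, (mul_eq_zero.1 h).resolve_right hb]
  · refine ⟨y / a, ?_, by field_simp⟩
    field_simp
    linear_combination h

theorem sum_mul_eq_zero_of_cramer_eq_zero [Fintype σ] [DecidableEq σ]
    {d : σ → Module.Dual K V} (hd : LinearIndependent K d) {r : σ → QuadraticForm K V}
    (h : ∀ w : σ → V, (Matrix.of fun s j => d s (w j)).det = 0 →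
      (Matrix.of fun s j => d s (w j)).cramer (fun s => ∑ j, r s (w j)) = 0)
    {c : σ → K} {u : V} (hcu : ∑ s, c s * d s u = 0) : ∑ s, c s * r s u = 0 := by
  by_cases hc : c = 0
  · simp [hc]
  obtain ⟨s₀, hs₀⟩ := Function.ne_iff.1 hc
  rw [Pi.zero_apply] at hs₀
  -- `y` is a multiple of `c` as soon as `∑ s, y s * d s (z j) = 0` for all `j ≠ s₀`
  choose z hz using fun j => exists_forall_dual_apply_eq hd
    (c s₀ • Pi.single j 1 - c j • Pi.single s₀ 1)
  have hyz : ∀ (y : σ → K) (j), ∑ s, y s * d s (z j) = c s₀ * y j - c j * y s₀ := fun y j => by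
    simp [hz, mul_sub, Finset.sum_sub_distrib, Pi.single_apply, mul_comm]
  have hzero : ∀ x, ∑ s, c s * d s x = 0 →
      ∑ s, c s * ∑ j, r s (Function.update z s₀ x j) = 0 := by
    intro x hcx
    set M : Matrix σ σ K := Matrix.of fun s j => d s (Function.update z s₀ x j)
    have hM : ∀ (y : σ → K) (j), j ≠ s₀ → (y ᵥ* M) j = c s₀ * y j - c j * y s₀ := fun y j hj => by
      simp [M, Matrix.vecMul, dotProduct, hj, hyz]
    have hdet : M.det = 0 := by
      refine Matrix.exists_vecMul_eq_zero_iff.1 ⟨c, hc, funext fun j => ?_⟩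
      rcases eq_or_ne j s₀ with rfl | hj
      · simpa [M, Matrix.vecMul, dotProduct] using hcx
      · rw [hM c j hj, mul_comm, sub_self, Pi.zero_apply]
    have hK : (M.updateCol s₀ fun s => ∑ j, r s (Function.update z s₀ x j)).det = 0 := by
      rw [← Matrix.cramer_apply, h _ hdet, Pi.zero_apply]
    have hcM := vecMul_apply_eq_zero_of_det_eq_zero (c := c) (s := s₀) hK fun y hy => by
      refine ⟨y s₀ / c s₀, eq_smul_of_forall_mul_eq_mul hs₀ fun j hj => ?_⟩
      rw [← sub_eq_zero, ← hM y j hj]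
      simpa only [Matrix.vecMul, dotProduct, Matrix.updateCol_ne hj] using hy j hj
    simpa [Matrix.vecMul, dotProduct] using hcM
  have hu := hzero u hcu
  have h0 := hzero 0 (by simp)
  have hsplit : ∀ s, ∑ j, r s (Function.update z s₀ u j) =
      r s u + ∑ j, r s (Function.update z s₀ 0 j) := fun s => sum_quadraticForm_update (r s) z s₀ u
  simp only [hsplit, mul_add, Finset.sum_add_distrib] at hu
  rwa [h0, add_zero] at hu

theorem sum_mul_eq_zero_of_borderedMatrix_det_eq_zero {r : ℕ} {L : Fin (r + 1) → Fin r → K}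
    {b c : Fin (r + 1) → K} (hbordered : (borderedMatrix L b).det = 0)
    (hL : (Matrix.of fun s : Fin r => L s.succ).det ≠ 0) (hc : c 0 ≠ 0)
    (hcL : ∀ j, ∑ s, c s * L s j = 0) : ∑ s, c s * b s = 0 := by
  have hcol := vecMul_apply_eq_zero_of_det_eq_zero (c := c) (s := Fin.last r) hbordered
    fun y hy => by
      have hyL : ∀ j, ∑ s, y s * L s j = 0 := fun j => by
        simpa [borderedMatrix, Matrix.vecMul, dotProduct] using
          hy j.castSucc (Fin.castSucc_lt_last j).ne
      have hzero : (fun s : Fin r => y s.succ - y 0 / c 0 * c s.succ) = 0 := by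
        refine Matrix.eq_zero_of_vecMul_eq_zero hL (funext fun j => ?_)
        have hyj := hyL j
        have hcj := hcL j
        rw [Fin.sum_univ_succ] at hyj hcj
        simp only [Matrix.vecMul, dotProduct, Matrix.of_apply, sub_mul, Finset.sum_sub_distrib,
          mul_assoc, ← Finset.mul_sum, Pi.zero_apply]
        rw [eq_neg_of_add_eq_zero_right hyj, eq_neg_of_add_eq_zero_right hcj]
        field_simp
        ring
      refine ⟨y 0 / c 0, funext fun s => ?_⟩
      refine Fin.cases ?_ (fun s => sub_eq_zero.1 (congrFun hzero s)) s
      rw [Pi.smul_apply, smul_eq_mul, div_mul_cancel₀ _ hc]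
  simpa [borderedMatrix, Matrix.vecMul, dotProduct] using hcol

theorem cramer_mulVec {R : Type*} [CommRing R] [Fintype σ] [DecidableEq σ] (M : Matrix σ σ R)
    (x : σ → R) : M.cramer (M *ᵥ x) = M.det • x := by
  rw [Matrix.cramer_eq_adjugate_mulVec, Matrix.mulVec_mulVec, Matrix.adjugate_mul,
    Matrix.smul_mulVec, Matrix.one_mulVec]

theorem exists_quadraticForm_apply_eq (α κ : Module.Dual K V) (q : QuadraticForm K V) :
    ∃ G : QuadraticForm K V, ∀ u, G u = 2 * κ u * κ u - 2 * κ u * α u - q u := by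
  refine ⟨2 • QuadraticMap.sq.comp κ - 2 • QuadraticMap.linMulLin κ α - q, fun u => ?_⟩
  simp only [sub_apply, smul_apply, QuadraticMap.comp_apply, QuadraticMap.sq_apply,
    QuadraticMap.linMulLin_apply]
  ring

variable [CharZero K]

theorem quadraticForm_eq_zero_of_forall_dual_ne_zero {d : Module.Dual K V} (hd : d ≠ 0)
    {r : QuadraticForm K V} (h : ∀ u, d u ≠ 0 → r u = 0) : r = 0 := by
  ext u
  by_cases hu : d u = 0
  · obtain ⟨z, hz⟩ := DFunLike.ne_iff.1 hd
    have hadd : r (u + z) = 0 := h _ (by simpa [hu] using hz)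
    have hsub : r (u - z) = 0 := h _ (by simpa [hu] using hz)
    have hpolar := QuadraticMap.polar_neg_right r u z
    rw [QuadraticMap.polar, QuadraticMap.polar, ← sub_eq_add_neg, hadd, hsub,
      QuadraticMap.map_neg, h z hz] at hpolar
    rw [zero_apply]
    linear_combination -hpolar / 2
  · exact h u hu

theorem exists_dual_of_forall_ker {d : Module.Dual K V} (hd : d ≠ 0) (r : QuadraticForm K V)
    (h : ∀ u, d u = 0 → r u = 0) : ∃ κ : Module.Dual K V, ∀ u, r u = 2 * d u * κ u := by
  obtain ⟨u₀, hu₀⟩ := LinearMap.surjective hd 1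
  refine ⟨(2⁻¹ : K) • (QuadraticMap.polarBilin r u₀ - r u₀ • d), fun u => ?_⟩
  have hker : r (u - d u • u₀) = 0 := h _ (by simp [hu₀])
  have hu := QuadraticMap.map_add r (u - d u • u₀) (d u • u₀)
  rw [sub_add_cancel, hker, QuadraticMap.map_smul, QuadraticMap.polar_smul_right,
    QuadraticMap.polar_sub_left, QuadraticMap.polar_smul_left, QuadraticMap.polar_self,
    QuadraticMap.polar_comm] at hu
  rw [hu]
  simp only [smul_eq_mul, LinearMap.smul_apply, LinearMap.sub_apply,
    QuadraticMap.polarBilin_apply_apply]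
  ring

theorem exists_common_dual {d : σ → Module.Dual K V} (hd : ∀ s, d s ≠ 0)
    (r : σ → QuadraticForm K V) (hker : ∀ s u, d s u = 0 → r s u = 0)
    (hprop : ∀ s t u, d t u * r s u = d s u * r t u) :
    ∃ κ : Module.Dual K V, ∀ s u, r s u = 2 * d s u * κ u := by
  choose κ hκ using fun s => exists_dual_of_forall_ker (hd s) (r s) (hker s)
  have hκκ : ∀ s t, κ s = κ t := fun s t => by
    by_contra hne
    have hexists : ∀ i, ∃ u, (![d s, d t, κ s - κ t] i) u ≠ 0 := fun i => by
      refine DFunLike.ne_iff.1 (?_ : _ ≠ (0 : Module.Dual K V))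
      fin_cases i
      exacts [hd s, hd t, sub_ne_zero.2 hne]
    obtain ⟨u, hu⟩ := Module.Dual.exists_forall_ne_zero_of_forall_exists _ hexists
    have hzero : d s u * d t u * (κ s - κ t) u = 0 := by
      have := hprop s t u
      rw [hκ, hκ] at this
      rw [LinearMap.sub_apply]
      linear_combination this / 2
    exact mul_ne_zero (mul_ne_zero (hu 0) (hu 1)) (hu 2) hzero
  rcases isEmpty_or_nonempty σ with hσ | ⟨⟨t⟩⟩
  · exact ⟨0, fun s => hσ.elim s⟩
  · exact ⟨κ t, fun s u => by rw [hκ, hκκ s t]⟩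

theorem dual_mul_quadraticForm_comm_of_det_eq_zero {n : ℕ} {d : Fin (n + 1) → Module.Dual K V}
    (hd : LinearIndependent K d) {r : Fin (n + 1) → QuadraticForm K V}
    (h : ∀ w : Fin n → V,
      (borderedMatrix (fun s j => d s (w j)) fun s => ∑ j, r s (w j)).det = 0)
    (t : Fin (n + 1)) (j₀ : Fin n) (u : V) :
    d t u * r (t.succAbove j₀) u = d (t.succAbove j₀) u * r t u := by
  choose z hz using fun j : Fin n => exists_forall_dual_apply_eq hd (Pi.single (t.succAbove j) 1)
  let R : Fin (n + 1) → K := fun s => ∑ j, r s (Function.update z j₀ 0 j)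
  have key : ∀ x, d t x * (r (t.succAbove j₀) x + R (t.succAbove j₀)) =
      d (t.succAbove j₀) x * (r t x + R t) := by
    intro x
    by_cases hx : d t x = 0 ∧ d (t.succAbove j₀) x = 0
    · rw [hx.1, hx.2, zero_mul, zero_mul]
    let c : Fin (n + 1) → K :=
      d t x • Pi.single (t.succAbove j₀) 1 - d (t.succAbove j₀) x • Pi.single t 1
    have hc := vecMul_apply_eq_zero_of_det_eq_zero (c := c) (s := Fin.last n)
      (h (Function.update z j₀ x)) fun y hy => by
        have hyj : ∀ j ≠ j₀, y (t.succAbove j) = 0 := fun j hj => by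
          simpa [borderedMatrix, Matrix.vecMul, dotProduct, hj, hz, Pi.single_apply] using
            hy j.castSucc (Fin.castSucc_lt_last j).ne
        have hyx : y t * d t x + y (t.succAbove j₀) * d (t.succAbove j₀) x = 0 := by
          have := hy j₀.castSucc (Fin.castSucc_lt_last j₀).ne
          simp only [borderedMatrix, Matrix.vecMul, dotProduct, Matrix.of_apply, Fin.snoc_castSucc,
            Function.update_self, Fin.sum_univ_succAbove _ t] at this
          rwa [Fintype.sum_eq_single j₀ fun j hj => by rw [hyj j hj, zero_mul]] at this
        obtain ⟨a, hat, has⟩ := exists_eq_mul_of_mul_add_mul_eq_zero hx hyx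
        refine ⟨a, funext fun p => ?_⟩
        rcases Fin.eq_self_or_eq_succAbove t p with rfl | ⟨j, rfl⟩
        · simp [c, hat]
        · rcases eq_or_ne j j₀ with rfl | hj
          · simp [c, has]
          · simp [c, hyj j hj, hj]
    have hsplit : ∀ s, ∑ j, r s (Function.update z j₀ x j) = r s x + R s := fun s =>
      sum_quadraticForm_update (r s) z j₀ x
    simpa [borderedMatrix, Matrix.vecMul, dotProduct, hsplit, c, sub_mul,
      Finset.sum_sub_distrib, sub_eq_zero, Pi.single_apply] using hc
  have h₁ := key u
  have h₂ := key ((2 : K) • u)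
  simp only [map_smul, QuadraticMap.map_smul, smul_eq_mul] at h₂
  linear_combination (h₂ - 2 * h₁) / 6

theorem exists_common_dual_of_det {n : ℕ} (hn : n ≠ 0)
    {d : Fin (n + 1) → Module.Dual K V} (hd : LinearIndependent K d)
    (r : Fin (n + 1) → QuadraticForm K V)
    (h : ∀ w : Fin n → V,
      (borderedMatrix (fun s j => d s (w j)) fun s => ∑ j, r s (w j)).det = 0) :
    ∃ κ : Module.Dual K V, ∀ s u, r s u = 2 * d s u * κ u := by
  have hprop : ∀ s t u, d t u * r s u = d s u * r t u := by
    intro s t u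
    rcases eq_or_ne s t with rfl | hst
    · rfl
    · obtain ⟨j, rfl⟩ := Fin.exists_succAbove_eq hst
      exact dual_mul_quadraticForm_comm_of_det_eq_zero hd h t j u
  refine exists_common_dual (fun s => hd.ne_zero s) r (fun s u hu => ?_) hprop
  have : Nontrivial (Fin (n + 1)) := Fin.nontrivial_iff_two_le.2 (by omega)
  obtain ⟨t, hts⟩ := exists_ne s
  obtain ⟨z, hz⟩ := exists_forall_dual_apply_eq hd (Pi.single t 1)
  have hrestrict : (r s).comp (LinearMap.ker (d s)).subtype = 0 := by
    refine quadraticForm_eq_zero_of_forall_dual_ne_zero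
      (d := d t ∘ₗ (LinearMap.ker (d s)).subtype) ?_ ?_
    · exact DFunLike.ne_iff.2 ⟨⟨z, by simp [hz, hts.symm]⟩, by simp [hz]⟩
    · rintro ⟨x, hx⟩ hxt
      have hprod : d t x * r s x = 0 := by rw [hprop, LinearMap.mem_ker.1 hx, zero_mul]
      exact (mul_eq_zero.1 hprod).resolve_left hxt
  exact DFunLike.congr_fun hrestrict ⟨u, hu⟩

theorem quadraticForm_eq_zero_of_sum_eq_zero [Fintype σ] [DecidableEq σ] [Nonempty σ]
    {d : σ → Module.Dual K V} (hd : LinearIndependent K d) {r : QuadraticForm K V}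
    (h : ∀ w : σ → V, (Matrix.of fun s j => d s (w j)).det ≠ 0 → ∑ j, r (w j) = 0) : r = 0 := by
  obtain ⟨s⟩ := ‹Nonempty σ›
  refine quadraticForm_eq_zero_of_forall_dual_ne_zero (hd.ne_zero s) fun u hu => ?_
  choose z hz using fun j => exists_forall_dual_apply_eq hd (Pi.single j 1)
  have hdet : ∀ x, (Matrix.of fun i j => d i (Function.update z s x j)).det = d s x := by
    intro x
    have : (Matrix.of fun i j => d i (Function.update z s x j)) =
        (1 : Matrix σ σ K).updateCol s fun i => d i x := by
      ext i j
      rcases eq_or_ne j s with rfl | hj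
      · simp
      · simp [hj, hz, Matrix.one_apply, Pi.single_apply]
    rw [this, ← Matrix.cramer_apply, Matrix.cramer_one, Module.End.one_apply]
  have h₁ := h (Function.update z s u) (by rwa [hdet])
  have h₂ := h (Function.update z s ((2 : K) • u)) (by simpa [hdet] using hu)
  rw [sum_quadraticForm_update] at h₁ h₂
  rw [QuadraticMap.map_smul, smul_eq_mul] at h₂
  linear_combination (h₂ - h₁) / 3

theorem exists_common_dual_of_cramer {K : Type*} [Field K] [LinearOrder K] [IsStrictOrderedRing K]
    [Module K V] [Fintype σ] [DecidableEq σ] [Nonempty σ] {d : σ → Module.Dual K V}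
    (hd : LinearIndependent K d) (r : σ → QuadraticForm K V) (α : Module.Dual K V)
    (q : QuadraticForm K V)
    (h : ∀ (w : σ → V) (M : Matrix σ σ K) (k : σ → K), (M = Matrix.of fun s j => d s (w j)) →
      k = M.cramer (fun s => ∑ j, r s (w j)) →
        k ⬝ᵥ k - 2 * M.det * (k ⬝ᵥ fun j => α (w j)) - 2 * M.det ^ 2 * ∑ j, q (w j) = 0) :
    ∃ κ : Module.Dual K V, (∀ s u, r s u = 2 * d s u * κ u) ∧
      ∀ u, 2 * κ u * κ u - 2 * κ u * α u - q u = 0 := by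
  have hker : ∀ (c : σ → K) (u : V), ∑ s, c s * d s u = 0 → ∑ s, c s * r s u = 0 := fun c u hcu =>
    sum_mul_eq_zero_of_cramer_eq_zero hd (fun w hw => by
      have hk := h w _ _ rfl rfl
      rw [hw] at hk
      exact dotProduct_self_eq_zero.1 (by simpa using hk)) hcu
  obtain ⟨κ, hκ⟩ := exists_common_dual (fun s => hd.ne_zero s) r
    (fun s u hu => by
      simpa [Pi.single_apply] using hker (Pi.single s 1) u (by simp [Pi.single_apply, hu]))
    (fun s t u => by
      have := hker (d t u • Pi.single s 1 - d s u • Pi.single t 1) u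
        (by simp [Pi.single_apply, sub_mul, Finset.sum_sub_distrib, mul_comm (d t u)])
      simpa [Pi.single_apply, sub_mul, Finset.sum_sub_distrib, sub_eq_zero] using this)
  obtain ⟨G, hG⟩ := exists_quadraticForm_apply_eq α κ q
  have hG0 : G = 0 := by
    refine quadraticForm_eq_zero_of_sum_eq_zero hd fun w hdet => ?_
    set M := Matrix.of fun s j => d s (w j) with hM
    have hmulVec : (fun s => ∑ j, r s (w j)) = M *ᵥ ((2 : K) • fun j => κ (w j)) := by
      ext s
      simp only [Matrix.mulVec, dotProduct, hM, Matrix.of_apply, hκ, Pi.smul_apply, smul_eq_mul]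
      exact Finset.sum_congr rfl fun j _ => by ring
    have hcramer : M.cramer (fun s => ∑ j, r s (w j)) = (2 * M.det) • fun j => κ (w j) := by
      rw [hmulVec, cramer_mulVec, smul_smul, mul_comm]
    have hk := h w M _ hM hcramer.symm
    have hsum : 2 * M.det ^ 2 * ∑ j, G (w j) = 0 := by
      rw [← hk]
      simp only [hG, Finset.sum_sub_distrib, mul_sub, dotProduct, Finset.mul_sum, Pi.smul_apply,
        smul_eq_mul]
      congr! 3 <;> ring
    exact (mul_eq_zero.1 hsum).resolve_left (by positivity)
  exact ⟨κ, hκ, fun u => by rw [← hG, hG0, zero_apply]⟩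

end LinearForms

section Forms

variable {ι : Type*}

theorem eq_zero_or_eq_single_of_sq_eq_self [DecidableEq ι] {A : Type*} [Ring A] [NoZeroDivisors A]
    {x : ι → A} (hsq : ∀ i, x i ^ 2 = x i) (hmul : ∀ i j, i ≠ j → x i * x j = 0) :
    x = 0 ∨ ∃ i, x = Pi.single i 1 := by
  by_cases hx : x = 0
  · exact Or.inl hx
  obtain ⟨i, hi⟩ := Function.ne_iff.1 hx
  refine Or.inr ⟨i, funext fun j => ?_⟩
  rcases eq_or_ne j i with rfl | hji
  · rw [Pi.single_eq_same]
    exact mul_left_cancel₀ hi (by rw [← sq, hsq, mul_one])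
  · rw [Pi.single_eq_of_ne hji]
    exact (mul_eq_zero.1 (hmul j i hji)).resolve_right hi

theorem single_add_single_sq [DecidableEq ι] {A : Type*} [CommRing A] {i j : ι} (hij : i ≠ j)
    (l : ι) : (Pi.single i 1 + Pi.single j 1 : ι → A) l ^ 2 =
      (Pi.single i 1 + Pi.single j 1 : ι → A) l := by
  by_cases hi : l = i <;> by_cases hj : l = j <;> simp_all

theorem eq_proj_of_single [Finite ι] [DecidableEq ι] {κ : Module.Dual ℚ (ι → ℚ)} {x : ι}
    (hκ : (fun i => κ (Pi.single i 1)) = Pi.single x 1) : κ = LinearMap.proj x :=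
  LinearMap.pi_ext' fun i => LinearMap.ext_ring <| by
    simpa [Pi.single_apply, eq_comm] using congrFun hκ i

variable [Fintype ι]

theorem eq_zero_or_eq_single_of_sum_sq [DecidableEq ι] {K : Type*} [Field K] [CharZero K]
    {x : ι → K} (h : ∀ y : ι → K, (∑ i, x i * y i) ^ 2 = ∑ i, x i * y i ^ 2) :
    x = 0 ∨ ∃ i, x = Pi.single i 1 := by
  have hsq : ∀ i, x i ^ 2 = x i := fun i => by simpa [Pi.single_apply] using h (Pi.single i 1)
  refine eq_zero_or_eq_single_of_sq_eq_self hsq fun i j hij => ?_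
  have hadd := h (Pi.single i 1 + Pi.single j 1)
  simp only [single_add_single_sq hij] at hadd
  simp only [Pi.add_apply, mul_add, Finset.sum_add_distrib, Pi.single_apply, mul_ite, mul_one,
    mul_zero, Finset.sum_ite_eq', Finset.mem_univ, if_true] at hadd
  linear_combination hadd / 2 - hsq i / 2 - hsq j / 2

variable {A B : Type*} [CommRing A] [CommRing B]

/-- The linear form with integer coefficients `g`. -/
def linForm (g : ι → ℤ) (u : ι → A) : A := ∑ i, (g i : A) * u i

/-- The quadratic form `∑ gᵢ uᵢ² - (∑ gᵢ uᵢ)²`. If `g` is the relative frequency of two vertices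
joined by a path of `Λ_S`, the equation which the path imposes on its origin is linear or quadratic,
with right-hand side the sum of the values of this form at the coordinates of the sites. -/
def quadForm (g : ι → ℤ) (u : ι → A) : A := ∑ i, (g i : A) * u i ^ 2 - linForm g u ^ 2

theorem map_linForm (φ : A →+* B) (g : ι → ℤ) (u : ι → A) :
    linForm g (fun i => φ (u i)) = φ (linForm g u) := by simp [linForm]

theorem map_quadForm (φ : A →+* B) (g : ι → ℤ) (u : ι → A) :
    quadForm g (fun i => φ (u i)) = φ (quadForm g u) := by
  simp [quadForm, map_linForm]

theorem linForm_sum_smul {σ : Type*} [Fintype σ] (c : σ → ℤ) (g : σ → ι → ℤ) (u : ι → A) :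
    linForm (∑ s, c s • g s) u = ∑ s, (c s : A) * linForm (g s) u := by
  simp only [linForm, Finset.sum_apply, Pi.smul_apply, smul_eq_mul, Int.cast_sum, Int.cast_mul,
    Finset.sum_mul, Finset.mul_sum, mul_assoc]
  exact Finset.sum_comm

theorem linForm_sub (g h : ι → ℤ) (u : ι → A) :
    linForm (g - h) u = linForm g u - linForm h u := by
  simp [linForm, sub_mul]

theorem linForm_comp {κ : Type*} [Fintype κ] {f : κ → ι} (hf : Function.Injective f) {g : ι → ℤ}
    (hg : Function.support g ⊆ Set.range f) (u : ι → A) : linForm (g ∘ f) (u ∘ f) = linForm g u :=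
  Fintype.sum_of_injective f hf _ _
    (fun i hi => by simp [Function.notMem_support.1 (mt (@hg i) hi)])
    fun _ => rfl

theorem quadForm_comp {κ : Type*} [Fintype κ] {f : κ → ι} (hf : Function.Injective f) {g : ι → ℤ}
    (hg : Function.support g ⊆ Set.range f) (u : ι → A) :
    quadForm (g ∘ f) (u ∘ f) = quadForm g u := by
  rw [quadForm, linForm_comp hf hg]
  exact congrArg (· - linForm g u ^ 2) (linForm_comp hf hg fun i => u i ^ 2)

/-- `linForm g` as an element of the dual space. -/
def linDual (g : ι → ℤ) : Module.Dual ℚ (ι → ℚ) := ∑ i, (g i : ℚ) • LinearMap.proj i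

theorem linDual_apply (g : ι → ℤ) (u : ι → ℚ) : linDual g u = linForm g u := by
  simp [linDual, linForm]

/-- `quadForm g` as a quadratic form in the sense of Mathlib. -/
def quadDual (g : ι → ℤ) : QuadraticForm ℚ (ι → ℚ) :=
  ∑ i, (g i : ℚ) • QuadraticMap.sq.comp (LinearMap.proj i) - QuadraticMap.sq.comp (linDual g)

theorem quadDual_apply (g : ι → ℤ) (u : ι → ℚ) : quadDual g u = quadForm g u := by
  simp [quadDual, quadForm, linDual_apply, sq]

theorem linDual_injective : Function.Injective (linDual : (ι → ℤ) → _) := by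
  classical
  intro g h hgh
  ext i
  have hi := LinearMap.congr_fun hgh (Pi.single i 1)
  simpa [linDual_apply, linForm, Pi.single_apply] using hi

theorem linearIndependent_linDual {σ : Type*} {g : σ → ι → ℤ}
    (h : LinearIndependent ℚ fun s i => (g s i : ℚ)) :
    LinearIndependent ℚ fun s => linDual (g s) := by
  classical
  refine LinearIndependent.of_comp
    (LinearMap.pi fun i => LinearMap.applyₗ (Pi.single i (1 : ℚ))) ?_
  have hcoord : (fun s i => (g s i : ℚ)) = fun s i => linDual (g s) (Pi.single i 1) := by
    ext s i
    simp [linDual_apply, linForm, Pi.single_apply]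
  rwa [hcoord] at h

theorem linForm_single [DecidableEq ι] (g : ι → ℤ) (i : ι) (c : A) :
    linForm g (Pi.single i c) = g i * c := by
  simp [linForm, Pi.single_apply]

theorem quadForm_single [DecidableEq ι] (g : ι → ℤ) (i : ι) :
    quadForm g (Pi.single i (1 : A)) = g i - (g i : A) ^ 2 := by
  simp [quadForm, linForm_single, Pi.single_apply]

theorem linForm_single_add [DecidableEq ι] (g : ι → ℤ) (i j : ι) :
    linForm g (Pi.single i 1 + Pi.single j 1 : ι → A) = g i + g j := by
  simp [linForm, mul_add, Finset.sum_add_distrib, Pi.single_apply]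

theorem quadForm_single_add [DecidableEq ι] (g : ι → ℤ) {i j : ι} (hij : i ≠ j) :
    quadForm g (Pi.single i (1 : A) + Pi.single j 1) = g i + g j - ((g i : A) + g j) ^ 2 := by
  rw [quadForm, linForm_single_add]
  simp only [single_add_single_sq hij]
  exact congrArg (· - _) (linForm_single_add g i j)

theorem sq_eq_self_of_sq_add_sq_eq {x y : ℚ} {a : ℤ} (hadd : x + y = a)
    (hsq : x ^ 2 + y ^ 2 = a) : x ^ 2 = x ∧ y ^ 2 = y := by
  have hlower : 0 ≤ a := by
    have : (0 : ℚ) ≤ a := by rw [← hsq]; positivity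
    exact_mod_cast this
  have hupper : a ≤ 2 := by
    have : (a : ℚ) ≤ 2 := by nlinarith [sq_nonneg (x - 1), sq_nonneg (y - 1)]
    exact_mod_cast this
  obtain rfl : y = a - x := eq_sub_of_add_eq' hadd
  interval_cases a <;> push_cast at hsq ⊢
  · constructor <;> nlinarith
  · constructor <;> nlinarith
  · have : x = 1 := by
      have : (x - 1) ^ 2 = 0 := by linear_combination hsq / 2
      exact sub_eq_zero.1 (pow_eq_zero_iff two_ne_zero |>.1 this)
    constructor <;> nlinarith

theorem exists_eq_proj_of_red {a : ι → ℤ} (ha : ∑ i, a i = 2) {κ : Module.Dual ℚ (ι → ℚ)}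
    (h : ∀ u, 2 * κ u * κ u - 2 * κ u * linDual a u - quadDual a u = 0) :
    ∃ x, κ = LinearMap.proj x := by
  classical
  let k : ι → ℚ := fun i => κ (Pi.single i 1)
  let b : ι → ℚ := fun i => a i - k i
  have hsum : ∀ i, k i ^ 2 + b i ^ 2 = a i := fun i => by
    have := h (Pi.single i 1)
    rw [linDual_apply, quadDual_apply, linForm_single, quadForm_single] at this
    linear_combination this
  have hcross : ∀ i j, i ≠ j → k i * k j + b i * b j = 0 := fun i j hij => by
    have := h (Pi.single i 1 + Pi.single j 1)
    rw [linDual_apply, quadDual_apply, quadForm_single_add a hij, linForm_single_add,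
      map_add] at this
    linear_combination this / 2 - hsum i / 2 - hsum j / 2
  have hbit : ∀ i, k i ^ 2 = k i ∧ b i ^ 2 = b i := fun i =>
    sq_eq_self_of_sq_add_sq_eq (add_sub_cancel (k i) (a i)) (hsum i)
  have hnonneg : ∀ i, 0 ≤ k i ∧ 0 ≤ b i := fun i =>
    ⟨(hbit i).1 ▸ sq_nonneg _, (hbit i).2 ▸ sq_nonneg _⟩
  have hmul : ∀ i j, i ≠ j → k i * k j = 0 ∧ b i * b j = 0 := fun i j hij =>
    (add_eq_zero_iff_of_nonneg (mul_nonneg (hnonneg i).1 (hnonneg j).1)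
      (mul_nonneg (hnonneg i).2 (hnonneg j).2)).1 (hcross i j hij)
  have hkb : ∑ i, k i + ∑ i, b i = 2 := by
    rw [← Finset.sum_add_distrib]
    simp only [b, add_sub_cancel]
    exact_mod_cast ha
  rcases eq_zero_or_eq_single_of_sq_eq_self (fun i => (hbit i).1) (fun i j hij => (hmul i j hij).1)
    with hk | ⟨x, hk⟩
  · rcases eq_zero_or_eq_single_of_sq_eq_self (fun i => (hbit i).2)
      (fun i j hij => (hmul i j hij).2) with hb | ⟨y, hb⟩ <;> simp [hk, hb] at hkb
  · exact ⟨x, eq_proj_of_single hk⟩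

section Black

variable [DecidableEq ι] {b : ι → ℤ} {κ : Module.Dual ℚ (ι → ℚ)}

theorem sub_sq_eq_of_black (h : ∀ u, quadDual b u = 2 * linDual b u * κ u) (i : ι) :
    (b i : ℚ) - b i ^ 2 = 2 * b i * κ (Pi.single i 1) := by
  have := h (Pi.single i 1)
  rw [linDual_apply, quadDual_apply, linForm_single, quadForm_single] at this
  linear_combination this

theorem two_mul_apply_single_of_black (h : ∀ u, quadDual b u = 2 * linDual b u * κ u)
    {i : ι} (hi : b i ≠ 0) : 2 * κ (Pi.single i 1) = 1 - b i :=
  mul_left_cancel₀ (Int.cast_ne_zero.2 hi : (b i : ℚ) ≠ 0)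
    (by linear_combination -sub_sq_eq_of_black h i)

theorem mul_add_mul_apply_single_of_black (h : ∀ u, quadDual b u = 2 * linDual b u * κ u)
    {i j : ι} (hij : i ≠ j) :
    (b i : ℚ) * b j + b i * κ (Pi.single j 1) + b j * κ (Pi.single i 1) = 0 := by
  have := h (Pi.single i 1 + Pi.single j 1)
  rw [linDual_apply, quadDual_apply, quadForm_single_add b hij, linForm_single_add,
    map_add] at this
  linear_combination -this / 2 + sub_sq_eq_of_black h i / 2 + sub_sq_eq_of_black h j / 2

theorem eq_proj_or_eq_ite_of_black (h : ∀ u, quadDual b u = 2 * linDual b u * κ u)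
    (hb : ∑ i, b i = 0) (hne : b ≠ 0) :
    (∃ x, κ = LinearMap.proj x) ∨ ∀ i, (b i : ℚ) =
      if κ (Pi.single i 1) = 0 then 0 else 1 - 2 * κ (Pi.single i 1) := by
  set k : ι → ℚ := fun i => κ (Pi.single i 1)
  have hk : ∀ i, b i ≠ 0 → 2 * k i = 1 - b i := fun i => two_mul_apply_single_of_black h
  have hcross : ∀ i j, i ≠ j → (b i : ℚ) * b j + b i * k j + b j * k i = 0 := fun i j =>
    mul_add_mul_apply_single_of_black h
  have hopp : ∀ i j, i ≠ j → b i ≠ 0 → b j ≠ 0 → b j = -b i := fun i j hij hi hj => by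
    have : (b j : ℚ) = -b i := by
      linear_combination 2 * hcross i j hij - b i * hk j hj - b j * hk i hi
    exact_mod_cast this
  obtain ⟨x, hx⟩ := Function.ne_iff.1 hne
  have hoff : ∀ i, b i = 0 → k i = 0 := fun i hi => by
    have hxi : x ≠ i := fun hxi => hx (hxi ▸ hi)
    simpa [hi, show b x ≠ 0 from hx] using hcross x i hxi
  by_cases hsupp : ∀ i, b i ≠ 0 → k i ≠ 0
  · refine Or.inr fun i => ?_
    by_cases hi : b i = 0
    · rw [if_pos (hoff i hi), hi, Int.cast_zero]
    · rw [if_neg (hsupp i hi)]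
      linear_combination hk i hi
  · push Not at hsupp
    obtain ⟨x, hx, hkx⟩ := hsupp
    obtain ⟨y, hyx, hy⟩ : ∃ y ≠ x, b y ≠ 0 := by
      by_contra! hall
      exact hx (by rwa [Fintype.sum_eq_single x hall] at hb)
    have hbx : (b x : ℚ) = 1 := by linear_combination hk x hx - 2 * hkx
    have hby : (b y : ℚ) = -1 := by
      rw [hopp x y hyx.symm hx hy, Int.cast_neg, hbx]
    refine Or.inl ⟨y, eq_proj_of_single (funext fun l => ?_)⟩
    rcases eq_or_ne l y with rfl | hly
    · rw [Pi.single_eq_same]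
      linear_combination hk l hy / 2 - hby / 2
    rw [Pi.single_eq_of_ne hly]
    rcases eq_or_ne l x with rfl | hlx
    · exact hkx
    refine hoff l (by_contra fun hl => hx ?_)
    have := hopp x l hlx.symm hx hl
    have := hopp y l hly.symm hy hl
    have := hopp x y hyx.symm hx hy
    omega

end Black

theorem exists_eq_proj_of_black {b b' : ι → ℤ} (hb : ∑ i, b i = 0) (hb' : ∑ i, b' i = 0)
    (hne : b ≠ 0) (hne' : b' ≠ 0) (hbb' : b ≠ b') {κ : Module.Dual ℚ (ι → ℚ)}
    (h : ∀ u, quadDual b u = 2 * linDual b u * κ u)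
    (h' : ∀ u, quadDual b' u = 2 * linDual b' u * κ u) : ∃ x, κ = LinearMap.proj x := by
  classical
  rcases eq_proj_or_eq_ite_of_black h hb hne with hκ | hκ
  · exact hκ
  refine (eq_proj_or_eq_ite_of_black h' hb' hne').resolve_right fun hκ' => hbb' (funext fun i => ?_)
  exact Int.cast_injective ((hκ i).trans (hκ' i).symm)

end Forms

section Templates

variable {R A B : Type*} [CommRing R] [CommRing A] [CommRing B] {n r : ℕ}

/-- The matrix of the linear system obtained from the array `L` of values of linear forms by
subtracting the row `0` from the rows marked by `red`. -/
def reducedMatrix (red : Fin n → Bool) (L : Fin (n + 1) → Fin n → R) :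
    Matrix (Fin n) (Fin n) R :=
  Matrix.of fun s j => if red s then L s.succ j - L 0 j else L s.succ j

/-- The right-hand side of the linear system with matrix `reducedMatrix red L`, computed from the
array `Q` of values of quadratic forms. -/
def reducedRhs (red : Fin n → Bool) (Q : Fin (n + 1) → Fin n → R) (s : Fin n) : R :=
  ∑ j, if red s then Q 0 j - Q s.succ j else Q s.succ j

/-- The obstruction for half the solution of the linear system `reducedMatrix red L`,
`reducedRhs red Q` to lie on the sphere `|k|² - k ⬝ᵥ L 0 = ∑ j, Q 0 j / 2`, with denominators
cleared by Cramer's rule. -/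
def sphereDefect (red : Fin n → Bool) (L Q : Fin (n + 1) → Fin n → R) : R :=
  let M := reducedMatrix red L
  let k := M.cramer (reducedRhs red Q)
  k ⬝ᵥ k - 2 * M.det * (k ⬝ᵥ L 0) - 2 * M.det ^ 2 * ∑ j, Q 0 j

theorem map_reducedMatrix (φ : A →+* B) (red : Fin n → Bool) (L : Fin (n + 1) → Fin n → A) :
    φ.mapMatrix (reducedMatrix red L) = reducedMatrix red fun s j => φ (L s j) := by
  ext s j
  simp [reducedMatrix, apply_ite φ]

theorem map_reducedRhs (φ : A →+* B) (red : Fin n → Bool) (Q : Fin (n + 1) → Fin n → A) :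
    φ ∘ reducedRhs red Q = reducedRhs red fun s j => φ (Q s j) := by
  ext s
  simp [reducedRhs, apply_ite φ]

theorem map_sphereDefect (φ : A →+* B) (red : Fin n → Bool) (L Q : Fin (n + 1) → Fin n → A) :
    φ (sphereDefect red L Q) =
      sphereDefect red (fun s j => φ (L s j)) fun s j => φ (Q s j) := by
  simp only [sphereDefect, ← map_reducedMatrix, ← map_reducedRhs, Matrix.cramer_eq_adjugate_mulVec,
    ← RingHom.map_det, ← RingHom.map_adjugate]
  have hmulVec : φ.mapMatrix (reducedMatrix red L).adjugate *ᵥ (φ ∘ reducedRhs red Q) =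
      φ ∘ ((reducedMatrix red L).adjugate *ᵥ reducedRhs red Q) :=
    funext fun i => (RingHom.map_mulVec φ _ _ i).symm
  rw [hmulVec]
  simp only [map_sub, map_mul, map_pow, map_sum, RingHom.map_dotProduct, map_ofNat φ 2]
  rfl

/-- The polynomial expressions in the values of `r` linear forms (the variables `Sum.inl (s, j)`)
and of the corresponding quadratic forms (the variables `Sum.inr (s, j)`) at `n` points. -/
abbrev Template (n r : ℕ) := MvPolynomial (Fin r × Fin n ⊕ Fin r × Fin n) ℤ

namespace Template

/-- The variable for the value of the linear form `s` at the point `j`. -/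
noncomputable def lin (s : Fin r) (j : Fin n) : Template n r := MvPolynomial.X (Sum.inl (s, j))

/-- The variable for the value of the quadratic form `s` at the point `j`. -/
noncomputable def quad (s : Fin r) (j : Fin n) : Template n r := MvPolynomial.X (Sum.inr (s, j))

/-- The squared length of `∑ gᵢ vᵢ`. -/
noncomputable def norm (n : ℕ) : Template n 1 := ∑ j, lin 0 j ^ 2

/-- `2 ∑ gᵢ |vᵢ|² - |∑ gᵢ vᵢ|²`. -/
noncomputable def double (n : ℕ) : Template n 1 := ∑ j, (lin 0 j ^ 2 + 2 * quad 0 j)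

/-- The scalar product of two integral combinations of the sites. -/
noncomputable def angle (n : ℕ) : Template n 2 := ∑ j, lin 0 j * lin 1 j

/-- Vanishes if a linear relation of length `r + 1 ≤ n + 1` also holds for the squared lengths. -/
noncomputable def relation (hr : r ≤ n) : Template n (r + 1) :=
  (borderedMatrix (fun s j => lin s (j.castLE hr)) fun s => ∑ j, lin s j ^ 2).det

/-- The determinant of the linear system with matrix `reducedMatrix red`. -/
noncomputable def det (red : Fin n → Bool) : Template n (n + 1) := (reducedMatrix red lin).det

/-- The condition for the solution of the linear system to lie on the sphere of the row `0`. -/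
noncomputable def sphere (red : Fin n → Bool) : Template n (n + 1) := sphereDefect red lin quad

/-- The solvability condition of a system of `n + 1` linear equations in `n` unknowns. -/
noncomputable def extended (n : ℕ) : Template n (n + 1) :=
  (borderedMatrix lin fun s => ∑ j, quad s j).det

variable {ι κ : Type*} [Fintype ι] [Fintype κ]

/-- The value of a template at the forms with coefficients `g s` and the points `w j`. -/
noncomputable def eval (g : Fin r → ι → ℤ) (w : Fin n → ι → A) : Template n r →+* A :=
  MvPolynomial.eval₂Hom (Int.castRingHom A)
    (Sum.elim (fun p => linForm (g p.1) (w p.2)) fun p => quadForm (g p.1) (w p.2))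

variable (g : Fin r → ι → ℤ) (w : Fin n → ι → A)

theorem eval_lin (s : Fin r) (j : Fin n) : eval g w (lin s j) = linForm (g s) (w j) := by
  simp [eval, lin]

theorem eval_quad (s : Fin r) (j : Fin n) : eval g w (quad s j) = quadForm (g s) (w j) := by
  simp [eval, quad]

theorem map_eval (φ : A →+* B) (T : Template n r) :
    φ (eval g w T) = eval g (fun j i => φ (w j i)) T := by
  refine RingHom.congr_fun (f := φ.comp (eval g w)) ?_ T
  ext p
  · simp
  · rcases p with ⟨s, j⟩ | ⟨s, j⟩ <;> simp [eval, map_linForm, map_quadForm]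

theorem eval_comp {f : κ → ι} (hf : Function.Injective f)
    (hg : ∀ s, Function.support (g s) ⊆ Set.range f) :
    eval (fun s => g s ∘ f) (fun j => w j ∘ f) = (eval g w : Template n r →+* A) := by
  simp only [eval, linForm_comp hf (hg _), quadForm_comp hf (hg _)]

theorem eval_norm (g : Fin 1 → ι → ℤ) : eval g w (norm n) = ∑ j, linForm (g 0) (w j) ^ 2 := by
  simp [norm, eval_lin]

theorem eval_double (g : Fin 1 → ι → ℤ) :
    eval g w (double n) = ∑ j, (linForm (g 0) (w j) ^ 2 + 2 * quadForm (g 0) (w j)) := by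
  simp [double, eval_lin, eval_quad, map_ofNat (eval g w) 2]

theorem eval_angle (g : Fin 2 → ι → ℤ) :
    eval g w (angle n) = ∑ j, linForm (g 0) (w j) * linForm (g 1) (w j) := by
  simp [angle, eval_lin]

theorem eval_relation (hr : r ≤ n) (g : Fin (r + 1) → ι → ℤ) :
    eval g w (relation hr) =
      (borderedMatrix (fun s (j : Fin r) => linForm (g s) (w (j.castLE hr)))
        fun s => ∑ j, linForm (g s) (w j) ^ 2).det := by
  simp [relation, RingHom.map_det, RingHom.mapMatrix_apply, borderedMatrix_map, eval_lin]

theorem eval_det (red : Fin n → Bool) (g : Fin (n + 1) → ι → ℤ) :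
    eval g w (det red) = (reducedMatrix red fun s j => linForm (g s) (w j)).det := by
  rw [det, RingHom.map_det, map_reducedMatrix]
  simp only [eval_lin]

theorem eval_sphere (red : Fin n → Bool) (g : Fin (n + 1) → ι → ℤ) :
    eval g w (sphere red) =
      sphereDefect red (fun s j => linForm (g s) (w j)) fun s j => quadForm (g s) (w j) := by
  simp [sphere, map_sphereDefect, eval_lin, eval_quad]

theorem eval_extended (g : Fin (n + 1) → ι → ℤ) :
    eval g w (extended n) = (borderedMatrix (fun s j => linForm (g s) (w j))
      fun s => ∑ j, quadForm (g s) (w j)).det := by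
  simp [extended, RingHom.map_det, RingHom.mapMatrix_apply, borderedMatrix_map, eval_lin, eval_quad]

end Template

end Templates

section Resonances

/-- The templates from which the resonances are obtained. -/
def templates (n : ℕ) : Set (Σ r, Template n r) :=
  {⟨1, Template.norm n⟩, ⟨1, Template.double n⟩, ⟨2, Template.angle n⟩,
    ⟨n + 1, Template.extended n⟩} ∪
  Set.range (fun r : Fin (n + 1) => ⟨r + 1, Template.relation r.is_le⟩) ∪
  Set.range (fun red : Fin n → Bool => ⟨n + 1, Template.det red⟩) ∪
  Set.range fun red : Fin n → Bool => ⟨n + 1, Template.sphere red⟩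

theorem finite_templates (n : ℕ) : (templates n).Finite :=
  (((Set.toFinite _).union (Set.finite_range _)).union (Set.finite_range _)).union
    (Set.finite_range _)

/-- No resonance vanishes on the list `v`. The resonances are the non-zero polynomials obtained by
evaluating a template at integral combinations of at most `2n + 2` generic sites, with coefficients
of size at most `2n + 2`. -/
def AvoidsResonances {n m : ℕ} (v : Fin m → Fin n → ℤ) : Prop :=
  ∀ T ∈ templates n, ∀ k ≤ 2 * n + 2, ∀ g : Fin T.1 → Fin k → ℤ, (∀ s i, |g s i| ≤ 2 * n + 2) →
    Template.eval g (fun j i => (MvPolynomial.X (i, j) : MvPolynomial (Fin k × Fin n) ℤ)) T.2 ≠ 0 →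
      ∀ f : Fin k ↪ Fin m, Template.eval g (fun j i => v (f i) j) T.2 ≠ 0

theorem exists_resonances (n : ℕ) : ∃ R : Finset (Σ k : ℕ, MvPolynomial (Fin k × Fin n) ℤ),
    (∀ r ∈ R, r.1 ≤ 2 * n + 2 ∧ r.2 ≠ 0) ∧
    ∀ (m : ℕ) (v : Fin m → Fin n → ℤ), IsGeneric R v → AvoidsResonances v := by
  let generic (k : ℕ) (j : Fin n) (i : Fin k) : MvPolynomial (Fin k × Fin n) ℤ :=
    MvPolynomial.X (i, j)
  let resonances : Set (Σ k : ℕ, MvPolynomial (Fin k × Fin n) ℤ) :=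
    {P | P.2 ≠ 0} ∩ ⋃ T ∈ templates n, ⋃ k ∈ Set.Iic (2 * n + 2),
      (fun g : Fin T.1 → Fin k → ℤ => ⟨k, Template.eval g (generic k) T.2⟩) ''
        {g | ∀ s i, |g s i| ≤ 2 * n + 2}
  have hfinite : resonances.Finite := by
    refine Set.Finite.inter_of_right ((finite_templates n).biUnion fun T _ =>
      (Set.finite_Iic _).biUnion fun k _ => Set.Finite.image _ ?_) _
    exact (Set.finite_Icc (fun _ _ => -(2 * n + 2 : ℤ)) fun _ _ => (2 * n + 2 : ℤ)).subset
      fun g hg => ⟨fun s i => (abs_le.1 (hg s i)).1, fun s i => (abs_le.1 (hg s i)).2⟩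
  refine ⟨hfinite.toFinset, fun P hP => ?_, fun m v hv T hT k hk g hg hne f hzero => ?_⟩
  · obtain ⟨hne, hP⟩ := hfinite.mem_toFinset.1 hP
    simp only [Set.mem_iUnion] at hP
    obtain ⟨T, -, k, hk, g, -, rfl⟩ := hP
    exact ⟨hk, hne⟩
  · have hmem : ⟨k, Template.eval g (generic k) T.2⟩ ∈ resonances :=
      ⟨hne, Set.mem_biUnion hT (Set.mem_biUnion hk ⟨g, hg, rfl⟩)⟩
    refine hv _ (hfinite.mem_toFinset.2 hmem) f ?_
    rw [Template.map_eval, ← hzero]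
    simp [generic]

variable {n m : ℕ} {v : Fin m → Fin n → ℤ}

/-- The `j`-th coordinates of the sites. -/
def coords (v : Fin m → Fin n → ℤ) (j : Fin n) : Fin m → ℤ := fun i => v i j

/-- The integer vectors with coefficients of size at most `2n + 2` and support in `I`. -/
def Small (n : ℕ) (I : Finset (Fin m)) (g : Fin m → ℤ) : Prop :=
  (∀ i, |g i| ≤ 2 * n + 2) ∧ Function.support g ⊆ I

theorem AvoidsResonances.eval_eq_zero (hv : AvoidsResonances v) {I : Finset (Fin m)}
    (hI : I.card ≤ 2 * n + 2) {r : ℕ} {T : Template n r} (hT : ⟨r, T⟩ ∈ templates n)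
    {g : Fin r → Fin m → ℤ} (hg : ∀ s, Small n I (g s)) (hzero : T.eval g (coords v) = 0)
    {A : Type*} [CommRing A] (w : Fin n → Fin m → A) : T.eval g w = 0 := by
  let f := I.orderEmbOfFin rfl
  have hsupp : ∀ s, Function.support (g s) ⊆ Set.range f := fun s => by
    rw [Finset.range_orderEmbOfFin]
    exact (hg s).2
  have hgeneric : Template.eval (fun s => g s ∘ f)
      (fun j i => (MvPolynomial.X (i, j) : MvPolynomial (Fin I.card × Fin n) ℤ)) T = 0 := by
    by_contra hne
    refine hv _ hT _ hI _ (fun s i => (hg s).1 _) hne f.toEmbedding ?_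
    exact (RingHom.congr_fun (Template.eval_comp g (coords v) f.injective hsupp) T).trans hzero
  have hw := congrArg (MvPolynomial.eval₂Hom (Int.castRingHom A) fun p => w p.2 (f p.1)) hgeneric
  rw [Template.map_eval, map_zero] at hw
  rw [← Template.eval_comp g w f.injective hsupp, ← hw]
  simp [Function.comp_def]

end Resonances

section Generic

theorem sum_smul_dual_eq_zero_or_eq_of_sq_eq {K V σ : Type*} [Field K] [CharZero K]
    [AddCommGroup V] [Module K V] [Fintype σ] {d : σ → Module.Dual K V}
    (hd : LinearIndependent K d) {x : σ → K}
    (hsq : ∀ u, (∑ s, x s * d s u) ^ 2 = ∑ s, x s * d s u ^ 2) :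
    ∑ s, x s • d s = 0 ∨ ∃ s, ∑ t, x t • d t = d s := by
  classical
  have hx : ∀ y : σ → K, (∑ s, x s * y s) ^ 2 = ∑ s, x s * y s ^ 2 := fun y => by
    obtain ⟨u, hu⟩ := exists_forall_dual_apply_eq hd y
    simpa only [hu] using hsq u
  rcases eq_zero_or_eq_single_of_sum_sq hx with rfl | ⟨s, rfl⟩
  · exact Or.inl (by simp)
  · exact Or.inr ⟨s, by simp [Pi.single_apply]⟩

variable {n m : ℕ} {v : Fin m → Fin n → ℤ} {I : Finset (Fin m)}

theorem AvoidsResonances.norm_ne_zero (hn : n ≠ 0) (hv : AvoidsResonances v)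
    (hI : I.card ≤ 2 * n + 2) {g : Fin m → ℤ} (hg : Small n I g) (hne : g ≠ 0) :
    ∑ j, linForm g (coords v j) ^ 2 ≠ 0 := by
  intro hzero
  obtain ⟨i, hi⟩ := Function.ne_iff.1 hne
  have hgeneric := hv.eval_eq_zero hI (T := Template.norm n) (by simp [templates])
    (fun _ => hg) (by rwa [Template.eval_norm]) (A := ℚ) fun _ => Pi.single i 1
  simp only [Template.eval_norm, linForm_single] at hgeneric
  simp_all

theorem AvoidsResonances.angle_ne_zero (hn : n ≠ 0) (hv : AvoidsResonances v) {x y z : Fin m}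
    (hxy : x ≠ y) (hxz : x ≠ z) : (v y - v x) ⬝ᵥ (v z - v x) ≠ 0 := by
  intro hzero
  let g : Fin 2 → Fin m → ℤ := fun s => Pi.single (![y, z] s) 1 - Pi.single x 1
  have hform : ∀ {A : Type} [CommRing A] (s) (u : Fin m → A),
      linForm (g s) u = u (![y, z] s) - u x := fun s u => by
    simp [g, linForm, sub_mul, Finset.sum_sub_distrib, Pi.single_apply]
  have hsmall : ∀ s, Small n {x, y, z} (g s) := fun s => by
    refine ⟨fun i => ?_, fun i hi => ?_⟩
    · have habs : |g s i| ≤ 1 := by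
        simp only [g, Pi.sub_apply, Pi.single_apply]
        split_ifs <;> simp
      omega
    · by_contra hxyz
      refine hi ?_
      fin_cases s <;> simp_all [g]
  have hgeneric := hv.eval_eq_zero (Finset.card_le_three.trans (by omega))
    (T := Template.angle n) (by simp [templates]) hsmall
    (by simpa [Template.eval_angle, hform, coords, dotProduct] using hzero) (A := ℚ)
    fun _ => Pi.single x 1
  simp [Template.eval_angle, hform, hxy.symm, hxz.symm, hn] at hgeneric

theorem AvoidsResonances.exists_eq_single_two (hn : n ≠ 0) (hv : AvoidsResonances v)
    (hI : I.card ≤ 2 * n + 2) {a : Fin m → ℤ} (ha : Small n I a) (hne : a ≠ 0)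
    (hzero : ∑ j, (linForm a (coords v j) ^ 2 + 2 * quadForm a (coords v j)) = 0) :
    ∃ x, a = Pi.single x 2 := by
  have hhalf : ∀ y : Fin m → ℚ, (∑ i, (a i / 2 : ℚ) * y i) ^ 2 = ∑ i, (a i / 2 : ℚ) * y i ^ 2 := by
    intro y
    have hgeneric := hv.eval_eq_zero hI (T := Template.double n) (by simp [templates])
      (fun _ => ha) (by rwa [Template.eval_double]) (A := ℚ) fun _ => y
    have hy : linForm a y ^ 2 + 2 * quadForm a y = 0 := by
      simpa [Template.eval_double, ← mul_add, hn] using hgeneric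
    rw [quadForm, linForm] at hy
    simp only [div_mul_eq_mul_div, ← Finset.sum_div]
    linear_combination -hy / 4
  have hcast : ∀ i, (a i : ℚ) = 2 * (a i / 2) := fun i => by ring
  rcases eq_zero_or_eq_single_of_sum_sq hhalf with h | ⟨x, h⟩
  · refine absurd (funext fun i => ?_) hne
    have hi := hcast i
    rw [congrFun h i] at hi
    simpa using hi
  · refine ⟨x, funext fun i => ?_⟩
    have hi := hcast i
    rw [congrFun h i, Pi.single_apply] at hi
    rw [Pi.single_apply]
    split_ifs at hi ⊢ <;> norm_num at hi <;> exact_mod_cast hi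

theorem AvoidsResonances.det_borderedMatrix_eq_zero (hv : AvoidsResonances v)
    (hI : I.card ≤ 2 * n + 2) {r : ℕ} (hr : r ≤ n) {g : Fin (r + 1) → Fin m → ℤ}
    (hg : ∀ s, Small n I (g s)) {c : Fin (r + 1) → ℤ} (hc : c ≠ 0) (hlin : ∑ s, c s • g s = 0)
    (hsq : ∑ s, c s * ∑ j, linForm (g s) (coords v j) ^ 2 = 0) (w : Fin n → Fin m → ℚ) :
    (borderedMatrix (fun s (j : Fin r) => linForm (g s) (w (j.castLE hr)))
      fun s => ∑ j, linForm (g s) (w j) ^ 2).det = 0 := by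
  have hmem : ⟨r + 1, Template.relation hr⟩ ∈ templates n :=
    Or.inl (Or.inl (Or.inr ⟨⟨r, Nat.lt_succ_of_le hr⟩, rfl⟩))
  rw [← Template.eval_relation]
  refine hv.eval_eq_zero hI hmem hg ?_ w
  rw [Template.eval_relation]
  refine Matrix.exists_vecMul_eq_zero_iff.1 ⟨c, hc, funext fun j => ?_⟩
  refine Fin.lastCases ?_ (fun j => ?_) j
  · simpa [borderedMatrix, Matrix.vecMul, dotProduct] using hsq
  · have hzero := linForm_sum_smul c g (coords v (j.castLE hr))
    rw [hlin] at hzero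
    simpa [borderedMatrix, Matrix.vecMul, dotProduct, linForm] using hzero.symm

theorem AvoidsResonances.sum_mul_linForm_sq_eq_zero (hn : n ≠ 0) (hv : AvoidsResonances v)
    (hI : I.card ≤ 2 * n + 2) {r : ℕ} (hr : r ≤ n) {g : Fin (r + 1) → Fin m → ℤ}
    (hg : ∀ s, Small n I (g s)) (hind : LinearIndependent ℚ fun (s : Fin r) i => (g s.succ i : ℚ))
    {c : Fin (r + 1) → ℤ} (hc : c 0 ≠ 0) (hlin : ∑ s, c s • g s = 0)
    (hsq : ∑ s, c s * ∑ j, linForm (g s) (coords v j) ^ 2 = 0) (u : Fin m → ℚ) :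
    ∑ s, (c s : ℚ) * linForm (g s) u ^ 2 = 0 := by
  have hsum : ∀ w : Fin n → Fin m → ℚ,
      (Matrix.of fun (s : Fin r) j => linForm (g s.succ) (w (Fin.castLE hr j))).det ≠ 0 →
      ∑ s, (c s : ℚ) * ∑ j, linForm (g s) (w j) ^ 2 = 0 := fun w hdet =>
    sum_mul_eq_zero_of_borderedMatrix_det_eq_zero
      (hv.det_borderedMatrix_eq_zero hI hr hg (fun h => hc (congrFun h 0)) hlin hsq w) hdet
      (Int.cast_ne_zero.2 hc) fun j => by
        rw [← linForm_sum_smul, hlin]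
        simp [linForm]
  rcases Nat.eq_zero_or_pos r with rfl | hpos
  · simpa [hn] using hsum (fun _ => u) (by simp)
  have : Nonempty (Fin r) := ⟨⟨0, hpos⟩⟩
  let q : QuadraticForm ℚ (Fin m → ℚ) :=
    ∑ s, (c s : ℚ) • QuadraticMap.sq.comp (linDual (g s))
  have hq : ∀ u, q u = ∑ s, (c s : ℚ) * linForm (g s) u ^ 2 := fun u => by
    simp [q, linDual_apply, sq]
  rw [← hq, quadraticForm_eq_zero_of_sum_eq_zero (r := q) (linearIndependent_linDual hind) ?_,
    zero_apply]
  intro w hdet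
  -- the template involves `n ≥ r` points: take the remaining ones equal to `0`
  let w' : Fin n → Fin m → ℚ := Function.extend (Fin.castLE hr) w 0
  have hw' : ∀ j, w' (Fin.castLE hr j) = w j :=
    (Fin.castLE_injective hr).extend_apply w 0
  have hzero := hsum w' (by simpa only [hw', ← linDual_apply] using hdet)
  simp only [Finset.mul_sum] at hzero
  rw [Finset.sum_comm] at hzero
  rw [← hzero]
  refine Fintype.sum_of_injective _ (Fin.castLE_injective hr) _ _ (fun j hj => ?_) fun j => ?_
  · simp [w', Function.extend_apply' _ _ _ hj, linForm]
  · rw [hw', hq]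

theorem AvoidsResonances.eq_zero_or_eq_of_relation (hn : n ≠ 0) (hv : AvoidsResonances v)
    (hI : I.card ≤ 2 * n + 2) {r : ℕ} (hr : r ≤ n) {g : Fin (r + 1) → Fin m → ℤ}
    (hg : ∀ s, Small n I (g s)) (hind : LinearIndependent ℚ fun (s : Fin r) i => (g s.succ i : ℚ))
    {c : Fin (r + 1) → ℤ} (hc : c 0 ≠ 0) (hlin : ∑ s, c s • g s = 0)
    (hsq : ∑ s, c s * ∑ j, linForm (g s) (coords v j) ^ 2 = 0) :
    g 0 = 0 ∨ ∃ s : Fin r, g 0 = g s.succ := by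
  have hc' : (c 0 : ℚ) ≠ 0 := Int.cast_ne_zero.2 hc
  let x : Fin r → ℚ := fun s => -c s.succ / c 0
  have hsolve : ∀ y : Fin (r + 1) → ℚ, ∑ s, (c s : ℚ) * y s = 0 →
      ∑ s, x s * y s.succ = y 0 := fun y hy => by
    rw [Fin.sum_univ_succ] at hy
    simp only [x, div_mul_eq_mul_div, ← Finset.sum_div, neg_mul, Finset.sum_neg_distrib]
    rw [div_eq_iff hc']
    linear_combination -hy
  have hx : ∀ u, ∑ s, x s * linDual (g s.succ) u = linDual (g 0) u := fun u =>
    hsolve (fun s => linDual (g s) u) (by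
      simp only [linDual_apply]
      rw [← linForm_sum_smul, hlin]
      simp [linForm])
  have hdual : ∑ s, x s • linDual (g s.succ) = linDual (g 0) :=
    LinearMap.ext fun u => by simpa using hx u
  have hx_sq : ∀ u, (∑ s, x s * linDual (g s.succ) u) ^ 2 = ∑ s, x s * linDual (g s.succ) u ^ 2 :=
    fun u => by
      rw [hx u]
      refine (hsolve (fun s => linDual (g s) u ^ 2) ?_).symm
      simpa only [linDual_apply] using hv.sum_mul_linForm_sq_eq_zero hn hI hr hg hind hc hlin hsq u
  rcases sum_smul_dual_eq_zero_or_eq_of_sq_eq (linearIndependent_linDual hind) hx_sq with h | ⟨s, h⟩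
  · exact Or.inl (linDual_injective (by rw [← hdual, h]; simp [linDual]))
  · exact Or.inr ⟨s, linDual_injective (by rw [← hdual, h])⟩

end Generic

section Graph

variable {n m : ℕ} {v : Fin m → Fin n → ℤ}

theorem CombBlack.symm {i j : Fin m} {p q : Frequency m} (h : CombBlack v i j p q) :
    CombBlack v j i q p := by
  obtain ⟨hcolor, hfreq, henergy⟩ := h
  exact ⟨hcolor.symm, by rw [hfreq]; abel, by linarith⟩

theorem CombRed.symm {i j : Fin m} {p q : Frequency m} (h : CombRed v i j p q) :
    CombRed v i j q p := by
  obtain ⟨hcolor, hfreq, henergy⟩ := h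
  exact ⟨by rw [hcolor, neg_neg], by rw [← hfreq]; abel, by linarith⟩

theorem CombRed.swap {i j : Fin m} {p q : Frequency m} (h : CombRed v i j p q) :
    CombRed v j i p q := by
  obtain ⟨hcolor, hfreq, henergy⟩ := h
  exact ⟨hcolor, by rw [← hfreq]; abel, by linarith⟩

theorem GeoBlack.symm {i j : Fin m} {a b : EuclideanSpace ℝ (Fin n)} (h : GeoBlack v i j a b) :
    GeoBlack v j i b a :=
  ⟨by rw [← neg_sub, h.1, neg_sub], by linarith [h.2]⟩

theorem GeoRed.symm {i j : Fin m} {a b : EuclideanSpace ℝ (Fin n)} (h : GeoRed v i j a b) :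
    GeoRed v i j b a :=
  ⟨by rw [add_comm, h.1], by linarith [h.2]⟩

theorem unitVec_injective : Function.Injective (unitVec : Fin m → Fin m → ℤ) :=
  fun i j h => by simpa [unitVec, Pi.single_apply, eq_comm] using congrFun h i

theorem combinatorialGraph_adj {p q : Frequency m} : (combinatorialGraph v).Adj p q ↔
    ∃ i j : Fin m, i ≠ j ∧ (CombBlack v i j p q ∨ CombRed v i j p q) := by
  rw [combinatorialGraph, SimpleGraph.fromRel_adj]
  constructor
  · rintro ⟨-, h | ⟨i, j, hij, h | h⟩⟩
    · exact h
    · exact ⟨j, i, hij.symm, Or.inl h.symm⟩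
    · exact ⟨i, j, hij, Or.inr h.symm⟩
  · rintro ⟨i, j, hij, h⟩
    refine ⟨?_, Or.inl ⟨i, j, hij, h⟩⟩
    rintro rfl
    rcases h with ⟨-, hfreq, -⟩ | ⟨hcolor, -, -⟩
    · rw [add_sub_assoc, left_eq_add, sub_eq_zero] at hfreq
      exact hij (unitVec_injective hfreq)
    · exact units_ne_neg_self _ hcolor

theorem momentum_add (a b : Fin m → ℤ) : momentum v (a + b) = momentum v a + momentum v b := by
  simp only [momentum, Pi.add_apply, add_smul, Finset.sum_add_distrib]

theorem momentum_neg (a : Fin m → ℤ) : momentum v (-a) = -momentum v a := by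
  simp only [momentum, Pi.neg_apply, neg_smul, Finset.sum_neg_distrib]

theorem momentum_sub (a b : Fin m → ℤ) : momentum v (a - b) = momentum v a - momentum v b := by
  rw [sub_eq_add_neg, momentum_add, momentum_neg, sub_eq_add_neg]

theorem momentum_unitVec (i : Fin m) : momentum v (unitVec i) = v i := by
  simp [momentum, unitVec, Pi.single_apply]

/-- The end of the black edge of `Λ_S` marked `(i, j)` which starts at `q`. -/
def blackEnd (q : Frequency m) (i j : Fin m) : Frequency m :=
  (q.1 + unitVec i - unitVec j, q.2)

/-- The end of the red edge of `Λ_S` marked `(i, j)` which starts at `q`. -/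
def redEnd (q : Frequency m) (i j : Fin m) : Frequency m :=
  (-q.1 - unitVec i - unitVec j, -q.2)

theorem site_blackEnd (q : Frequency m) (i j : Fin m) :
    site v (blackEnd q i j) = site v q + v j - v i := by
  rw [site, site, blackEnd, momentum_sub, momentum_add, momentum_unitVec, momentum_unitVec]
  abel

theorem site_redEnd (q : Frequency m) (i j : Fin m) :
    site v (redEnd q i j) = v i + v j - site v q := by
  rw [site, site, redEnd, momentum_sub, momentum_sub, momentum_neg, momentum_unitVec,
    momentum_unitVec]
  abel

theorem energy_sub_eq_iff_of_black {R : Type*} [CommRing R] [NoZeroDivisors R] [CharZero R]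
    (a u w : Fin n → R) :
    (a + w - u) ⬝ᵥ (a + w - u) - a ⬝ᵥ a = w ⬝ᵥ w - u ⬝ᵥ u ↔ (a - u) ⬝ᵥ (w - u) = 0 := by
  have expand : (a + w - u) ⬝ᵥ (a + w - u) - a ⬝ᵥ a - (w ⬝ᵥ w - u ⬝ᵥ u) =
      2 * ((a - u) ⬝ᵥ (w - u)) := by
    simp only [add_dotProduct, dotProduct_add, sub_dotProduct, dotProduct_sub,
      dotProduct_comm w a, dotProduct_comm u a, dotProduct_comm w u]
    ring
  rw [← sub_eq_zero, expand, mul_eq_zero, or_iff_right two_ne_zero]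

theorem energy_add_eq_iff_of_red {R : Type*} [CommRing R] [NoZeroDivisors R] [CharZero R]
    (a u w : Fin n → R) :
    a ⬝ᵥ a + (u + w - a) ⬝ᵥ (u + w - a) = u ⬝ᵥ u + w ⬝ᵥ w ↔ (a - u) ⬝ᵥ (a - w) = 0 := by
  have expand : a ⬝ᵥ a + (u + w - a) ⬝ᵥ (u + w - a) - (u ⬝ᵥ u + w ⬝ᵥ w) =
      2 * ((a - u) ⬝ᵥ (a - w)) := by
    simp only [add_dotProduct, dotProduct_add, sub_dotProduct, dotProduct_sub,
      dotProduct_comm w a, dotProduct_comm u a, dotProduct_comm w u]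
    ring
  rw [← sub_eq_zero, expand, mul_eq_zero, or_iff_right two_ne_zero]

theorem combBlack_iff {i j : Fin m} {p q : Frequency m} :
    CombBlack v i j p q ↔ q = blackEnd p i j ∧ (site v p - v i) ⬝ᵥ (v j - v i) = 0 := by
  rw [← energy_sub_eq_iff_of_black, ← site_blackEnd p i j]
  constructor
  · rintro ⟨hcolor, hfreq, henergy⟩
    obtain rfl : q = blackEnd p i j := Prod.ext hfreq hcolor.symm
    exact ⟨rfl, henergy⟩
  · rintro ⟨rfl, henergy⟩
    exact ⟨rfl, rfl, henergy⟩

theorem combRed_iff {i j : Fin m} {p q : Frequency m} :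
    CombRed v i j p q ↔ q = redEnd p i j ∧ (site v p - v i) ⬝ᵥ (site v p - v j) = 0 := by
  rw [← energy_add_eq_iff_of_red, ← site_redEnd p i j]
  constructor
  · rintro ⟨hcolor, hfreq, henergy⟩
    have hq : q.1 = -p.1 - unitVec i - unitVec j := by
      rw [← sub_eq_zero, ← hfreq]
      abel
    obtain rfl : q = redEnd p i j := Prod.ext hq (by rw [redEnd, hcolor, neg_neg])
    exact ⟨rfl, henergy⟩
  · rintro ⟨rfl, henergy⟩
    exact ⟨(neg_neg _).symm, by simp only [redEnd]; abel, henergy⟩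

theorem toEuclid_injective : Function.Injective (toEuclid : (Fin n → ℤ) → _) := by
  intro a b h
  ext l
  simpa [toEuclid] using congrArg (fun x : EuclideanSpace ℝ (Fin n) => x l) h

theorem toEuclid_add (a b : Fin n → ℤ) : toEuclid (a + b) = toEuclid a + toEuclid b := by
  ext l
  simp [toEuclid]

theorem toEuclid_sub (a b : Fin n → ℤ) : toEuclid (a - b) = toEuclid a - toEuclid b := by
  ext l
  simp [toEuclid]

theorem norm_toEuclid_sq (a : Fin n → ℤ) : ‖toEuclid a‖ ^ 2 = ((a ⬝ᵥ a : ℤ) : ℝ) := by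
  rw [EuclideanSpace.norm_sq_eq]
  simp [toEuclid, dotProduct, sq]

theorem geoBlack_toEuclid_iff {i j : Fin m} {a : Fin n → ℤ} {b : EuclideanSpace ℝ (Fin n)} :
    GeoBlack v i j (toEuclid a) b ↔
      b = toEuclid (a + v j - v i) ∧ (a - v i) ⬝ᵥ (v j - v i) = 0 := by
  have hb : b - toEuclid a = toEuclid (v j) - toEuclid (v i) ↔ b = toEuclid (a + v j - v i) := by
    rw [sub_eq_iff_eq_add, add_sub_assoc, toEuclid_add, toEuclid_sub, add_comm]
  rw [GeoBlack, hb]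
  refine and_congr_right fun hb => ?_
  rw [hb, ← energy_sub_eq_iff_of_black]
  simp only [norm_toEuclid_sq]
  norm_cast

theorem geoRed_toEuclid_iff {i j : Fin m} {a : Fin n → ℤ} {b : EuclideanSpace ℝ (Fin n)} :
    GeoRed v i j (toEuclid a) b ↔
      b = toEuclid (v i + v j - a) ∧ (a - v i) ⬝ᵥ (a - v j) = 0 := by
  have hb : toEuclid a + b = toEuclid (v i) + toEuclid (v j) ↔ b = toEuclid (v i + v j - a) := by
    rw [← eq_sub_iff_add_eq', toEuclid_sub, toEuclid_add]
  rw [GeoRed, hb]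
  refine and_congr_right fun hb => ?_
  rw [hb, ← energy_add_eq_iff_of_red]
  simp only [norm_toEuclid_sq]
  norm_cast

theorem geoBlack_site_iff {i j : Fin m} {p : Frequency m} {b : EuclideanSpace ℝ (Fin n)} :
    GeoBlack v i j (toEuclid (site v p)) b ↔
      ∃ q, CombBlack v i j p q ∧ toEuclid (site v q) = b := by
  rw [geoBlack_toEuclid_iff, ← site_blackEnd]
  simp only [combBlack_iff, and_assoc, exists_eq_left]
  rw [and_comm, eq_comm (a := b)]

theorem geoRed_site_iff {i j : Fin m} {p : Frequency m} {b : EuclideanSpace ℝ (Fin n)} :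
    GeoRed v i j (toEuclid (site v p)) b ↔
      ∃ q, CombRed v i j p q ∧ toEuclid (site v q) = b := by
  rw [geoRed_toEuclid_iff, ← site_redEnd]
  simp only [combRed_iff, and_assoc, exists_eq_left]
  rw [and_comm, eq_comm (a := b)]

theorem geometricGraph_adj (hv : Function.Injective v) {a b : EuclideanSpace ℝ (Fin n)} :
    (geometricGraph v).Adj a b ↔
      ∃ i j : Fin m, i ≠ j ∧ (GeoBlack v i j a b ∨ GeoRed v i j a b) := by
  have hinj : ∀ {i j}, toEuclid (v i) = toEuclid (v j) → i = j := fun h =>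
    hv (toEuclid_injective h)
  rw [geometricGraph, SimpleGraph.fromRel_adj]
  constructor
  · rintro ⟨-, h | ⟨i, j, hij, h | h⟩⟩
    · exact h
    · exact ⟨j, i, hij.symm, Or.inl h.symm⟩
    · exact ⟨i, j, hij, Or.inr h.symm⟩
  · rintro ⟨i, j, hij, h⟩
    refine ⟨?_, Or.inl ⟨i, j, hij, h⟩⟩
    rintro rfl
    rcases h with ⟨hab, -⟩ | ⟨hab, henergy⟩
    · rw [sub_self, eq_comm, sub_eq_zero] at hab
      exact hij (hinj hab.symm)
    · have hdist : ‖toEuclid (v i) - toEuclid (v j)‖ ^ 2 = 0 := by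
        have hpar := parallelogram_law_with_norm ℝ (toEuclid (v i)) (toEuclid (v j))
        rw [← hab, ← two_smul ℝ a, norm_smul, Real.norm_ofNat] at hpar
        linarith
      exact hij (hinj (sub_eq_zero.1 (norm_eq_zero.1 (pow_eq_zero_iff two_ne_zero |>.1 hdist))))

theorem geometricGraph_adj_of_combinatorialGraph_adj (hv : Function.Injective v) {p q : Frequency m}
    (h : (combinatorialGraph v).Adj p q) :
    (geometricGraph v).Adj (toEuclid (site v p)) (toEuclid (site v q)) := by
  obtain ⟨i, j, hij, h | h⟩ := combinatorialGraph_adj.1 h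
  · exact (geometricGraph_adj hv).2 ⟨i, j, hij, Or.inl (geoBlack_site_iff.2 ⟨q, h, rfl⟩)⟩
  · exact (geometricGraph_adj hv).2 ⟨i, j, hij, Or.inr (geoRed_site_iff.2 ⟨q, h, rfl⟩)⟩

theorem exists_combinatorialGraph_adj (hv : Function.Injective v) {p : Frequency m}
    {b : EuclideanSpace ℝ (Fin n)} (h : (geometricGraph v).Adj (toEuclid (site v p)) b) :
    ∃ q, (combinatorialGraph v).Adj p q ∧ toEuclid (site v q) = b := by
  obtain ⟨i, j, hij, h | h⟩ := (geometricGraph_adj hv).1 h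
  · obtain ⟨q, hpq, hq⟩ := geoBlack_site_iff.1 h
    exact ⟨q, combinatorialGraph_adj.2 ⟨i, j, hij, Or.inl hpq⟩, hq⟩
  · obtain ⟨q, hpq, hq⟩ := geoRed_site_iff.1 h
    exact ⟨q, combinatorialGraph_adj.2 ⟨i, j, hij, Or.inr hpq⟩, hq⟩

theorem geometricGraph_reachable (hv : Function.Injective v) {p q : Frequency m}
    (h : (combinatorialGraph v).Reachable p q) :
    (geometricGraph v).Reachable (toEuclid (site v p)) (toEuclid (site v q)) := by
  obtain ⟨w⟩ := h
  induction w with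
  | nil => rfl
  | cons h _ ih => exact (geometricGraph_adj_of_combinatorialGraph_adj hv h).reachable.trans ih

theorem exists_combinatorialGraph_reachable (hv : Function.Injective v) {p : Frequency m}
    {b : EuclideanSpace ℝ (Fin n)} (h : (geometricGraph v).Reachable (toEuclid (site v p)) b) :
    ∃ q, (combinatorialGraph v).Reachable p q ∧ toEuclid (site v q) = b := by
  obtain ⟨w⟩ := h
  generalize ha : toEuclid (site v p) = a at w
  induction w generalizing p with
  | nil => exact ⟨p, SimpleGraph.Reachable.refl _, ha⟩
  | cons h _ ih =>
    subst ha
    obtain ⟨q, hpq, hq⟩ := exists_combinatorialGraph_adj hv h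
    obtain ⟨q', hqq', hq'⟩ := ih hq
    exact ⟨q', hpq.reachable.trans hqq', hq'⟩

end Graph

section Conservation

variable {n m : ℕ} {v : Fin m → Fin n → ℤ}

/-- The energy `∑ aᵢ |vᵢ|²` of an integer vector `a`. -/
def energy (v : Fin m → Fin n → ℤ) : (Fin m → ℤ) →ₗ[ℤ] ℤ :=
  Fintype.linearCombination ℤ fun i => v i ⬝ᵥ v i

theorem energy_unitVec (i : Fin m) : energy v (unitVec i) = v i ⬝ᵥ v i := by
  simp [energy, unitVec]

theorem momentum_apply (a : Fin m → ℤ) (j : Fin n) : momentum v a j = linForm a (coords v j) := by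
  simp [momentum, linForm, coords]

theorem momentum_smul (c : ℤ) (a : Fin m → ℤ) : momentum v (c • a) = c • momentum v a := by
  simp [momentum, mul_smul, Finset.smul_sum]

theorem sum_linForm_sq (a : Fin m → ℤ) :
    ∑ j, linForm a (coords v j) ^ 2 = momentum v a ⬝ᵥ momentum v a := by
  simp only [dotProduct, momentum_apply, sq]

theorem sum_quadForm (a : Fin m → ℤ) :
    ∑ j, quadForm a (coords v j) = energy v a - momentum v a ⬝ᵥ momentum v a := by
  simp only [quadForm, Finset.sum_sub_distrib, sum_linForm_sq]
  congr 1
  rw [Finset.sum_comm]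
  simp [energy, Fintype.linearCombination_apply, dotProduct, coords, Finset.mul_sum, sq]

/-- The position of `q` relative to `p`: the frequency of `q` is that of `p`, with the sign changed
if `q` and `p` have different colours, minus `relative p q`. -/
def relative (p q : Frequency m) : Fin m → ℤ := ((p.2 * q.2 : ℤˣ) : ℤ) • p.1 - q.1

theorem relative_self (p : Frequency m) : relative p p = 0 := by
  simp [relative]

theorem eq_of_relative_eq {p q q' : Frequency m} (hcolor : q.2 = q'.2)
    (h : relative p q = relative p q') : q = q' := by
  rw [relative, relative, hcolor, sub_right_inj] at h
  exact Prod.ext h hcolor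

theorem eq_of_relative_eq_zero {p q : Frequency m} (hcolor : p.2 * q.2 = 1)
    (h : relative p q = 0) : q = p := by
  refine eq_of_relative_eq (p := p) ?_ (h.trans (relative_self p).symm)
  rw [← mul_eq_one_iff_inv_eq.1 hcolor, Int.units_inv_eq_self]

theorem site_eq_add_momentum_relative (p q : Frequency m) :
    site v q = ((p.2 * q.2 : ℤˣ) : ℤ) • site v p + momentum v (relative p q) := by
  rw [relative, momentum_sub, momentum_smul, site, site, smul_neg]
  abel

theorem relative_blackEnd (p q : Frequency m) (i j : Fin m) :
    relative p (blackEnd q i j) = relative p q - unitVec i + unitVec j := by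
  simp only [relative, blackEnd]
  abel

theorem relative_redEnd (p q : Frequency m) (i j : Fin m) :
    relative p (redEnd q i j) = -relative p q + unitVec i + unitVec j := by
  simp only [relative, redEnd, mul_neg, Units.val_neg, neg_smul]
  abel

/-- The conservation laws of mass and energy for a frequency at the position `a` relative to a
frequency with site `k`, whose site is therefore `ε • k + π(a)`. Here `ε` is the product of the two
signs. -/
structure Conserved (v : Fin m → Fin n → ℤ) (k : Fin n → ℤ) (ε : ℤˣ) (a : Fin m → ℤ) : Prop where
  sum_eq : ∑ i, a i = 1 - ε
  energy_eq : ((ε : ℤ) • k + momentum v a) ⬝ᵥ ((ε : ℤ) • k + momentum v a) - ε * (k ⬝ᵥ k) =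
    energy v a

theorem conserved_relative_iff {p q : Frequency m} :
    Conserved v (site v p) (p.2 * q.2) (relative p q) ↔
      ∑ i, relative p q i = 1 - ((p.2 * q.2 : ℤˣ) : ℤ) ∧
        site v q ⬝ᵥ site v q - ((p.2 * q.2 : ℤˣ) : ℤ) * (site v p ⬝ᵥ site v p) =
          energy v (relative p q) := by
  rw [site_eq_add_momentum_relative p q]
  exact ⟨fun h => ⟨h.1, h.2⟩, fun h => ⟨h.1, h.2⟩⟩

theorem conserved_relative_self (p : Frequency m) :
    Conserved v (site v p) (p.2 * p.2) (relative p p) :=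
  conserved_relative_iff.2 (by simp [relative_self])

theorem Conserved.of_adj {p q q' : Frequency m}
    (h : Conserved v (site v p) (p.2 * q.2) (relative p q))
    (hadj : (combinatorialGraph v).Adj q q') :
    Conserved v (site v p) (p.2 * q'.2) (relative p q') := by
  rw [conserved_relative_iff] at h ⊢
  obtain ⟨hsum, henergy⟩ := h
  have sum_unitVec : ∀ l : Fin m, ∑ i, unitVec l i = 1 := fun l => by simp [unitVec]
  obtain ⟨i, j, -, hb | hr⟩ := combinatorialGraph_adj.1 hadj
  · have hsite := hb.2.2
    obtain ⟨rfl, -⟩ := combBlack_iff.1 hb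
    have hcolor : (blackEnd q i j).2 = q.2 := rfl
    rw [relative_blackEnd, hcolor, map_add, map_sub, energy_unitVec, energy_unitVec]
    simp only [Pi.add_apply, Pi.sub_apply, Finset.sum_add_distrib, Finset.sum_sub_distrib,
      sum_unitVec]
    exact ⟨by linarith, by linarith⟩
  · have hsite := hr.2.2
    obtain ⟨rfl, -⟩ := combRed_iff.1 hr
    have hcolor : (redEnd q i j).2 = -q.2 := rfl
    rw [relative_redEnd, hcolor, map_add, map_add, map_neg, energy_unitVec, energy_unitVec,
      mul_neg, Units.val_neg]
    simp only [Pi.add_apply, Pi.neg_apply, Finset.sum_add_distrib, Finset.sum_neg_distrib,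
      sum_unitVec]
    exact ⟨by linarith, by linarith⟩

theorem Conserved.sum_quadForm_eq {k : Fin n → ℤ} {ε : ℤˣ} {a : Fin m → ℤ}
    (h : Conserved v k ε a) :
    ∑ j, quadForm a (coords v j) = (1 - ε) * (k ⬝ᵥ k) + 2 * ε * (k ⬝ᵥ momentum v a) := by
  have hε : (ε : ℤ) * ε = 1 := by rw [← Units.val_mul, Int.units_mul_self, Units.val_one]
  have henergy := h.energy_eq
  simp only [add_dotProduct, dotProduct_add, smul_dotProduct, dotProduct_smul, smul_eq_mul,
    dotProduct_comm (momentum v a) k] at henergy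
  rw [sum_quadForm]
  linear_combination -henergy + (k ⬝ᵥ k) * hε

theorem abs_relative_le_of_adj {p q q' : Frequency m} (hadj : (combinatorialGraph v).Adj q q')
    (l : Fin m) : |relative p q' l| ≤ |relative p q l| + 1 := by
  have habs : ∀ i j : Fin m, i ≠ j → |unitVec j l - unitVec i l| ≤ 1 ∧
      |unitVec i l + unitVec j l| ≤ 1 := fun i j hij => by
    simp only [unitVec, Pi.single_apply]
    split_ifs <;> simp_all
  obtain ⟨i, j, hij, hb | hr⟩ := combinatorialGraph_adj.1 hadj
  · rw [(combBlack_iff.1 hb).1, relative_blackEnd, sub_add_eq_add_sub, add_sub_assoc]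
    exact (abs_add_le _ _).trans (by gcongr; exact (habs i j hij).1)
  · rw [(combRed_iff.1 hr).1, relative_redEnd, add_assoc]
    exact (abs_add_le _ _).trans (by rw [Pi.neg_apply, abs_neg]; gcongr; exact (habs i j hij).2)

theorem exists_support_relative_subset_of_adj (p : Frequency m) {q q' : Frequency m}
    (hadj : (combinatorialGraph v).Adj q q') :
    ∃ i j, Function.support (relative p q') ⊆
      insert i (insert j (Function.support (relative p q))) := by
  obtain ⟨i, j, -, hb | hr⟩ := combinatorialGraph_adj.1 hadj
  · refine ⟨i, j, fun l hl => ?_⟩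
    rw [(combBlack_iff.1 hb).1, relative_blackEnd] at hl
    contrapose! hl
    simp_all [unitVec]
  · refine ⟨i, j, fun l hl => ?_⟩
    rw [(combRed_iff.1 hr).1, relative_redEnd] at hl
    contrapose! hl
    simp_all [unitVec]

end Conservation

section LinearSystem

variable {n m : ℕ} {v : Fin m → Fin n → ℤ} {I : Finset (Fin m)} {g : Fin (n + 1) → Fin m → ℤ}

/-- The linear forms of the linear system with matrix `reducedMatrix red`. -/
def reducedForm (red : Fin n → Bool) (g : Fin (n + 1) → Fin m → ℤ) (s : Fin n) : Fin m → ℤ :=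
  if red s then g s.succ - g 0 else g s.succ

/-- The quadratic forms of the right-hand side `reducedRhs red`. -/
noncomputable def reducedQuad (red : Fin n → Bool) (g : Fin (n + 1) → Fin m → ℤ) (s : Fin n) :
    QuadraticForm ℚ (Fin m → ℚ) :=
  if red s then quadDual (g 0) - quadDual (g s.succ) else quadDual (g s.succ)

theorem reducedMatrix_linForm {A : Type*} [CommRing A] (red : Fin n → Bool)
    (w : Fin n → Fin m → A) :
    (reducedMatrix red fun s j => linForm (g s) (w j)) =
      Matrix.of fun s j => linForm (reducedForm red g s) (w j) := by
  ext s j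
  rw [reducedMatrix, Matrix.of_apply, Matrix.of_apply, reducedForm]
  split_ifs
  · rw [linForm_sub]
  · rfl

theorem reducedRhs_quadForm (red : Fin n → Bool) (w : Fin n → Fin m → ℚ) :
    (reducedRhs red fun s j => quadForm (g s) (w j)) =
      fun s => ∑ j, reducedQuad red g s (w j) := by
  ext s
  rw [reducedRhs, reducedQuad]
  split_ifs <;> simp [quadDual_apply]

theorem linearIndependent_reducedForm (red : Fin n → Bool)
    (hind : LinearIndependent ℚ fun s i => (g s i : ℚ)) :
    LinearIndependent ℚ fun s i => (reducedForm red g s i : ℚ) := by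
  rw [Fintype.linearIndependent_iff] at hind ⊢
  intro c hc s
  refine hind (Fin.cons (-∑ s, if red s then c s else 0) c) ?_ s.succ
  rw [← hc, Fin.sum_univ_succ, Fin.cons_zero, neg_smul, Finset.sum_smul, ← sub_eq_neg_add,
    ← Finset.sum_sub_distrib]
  refine Finset.sum_congr rfl fun s _ => ?_
  ext i
  simp only [reducedForm]
  split_ifs <;> simp [mul_sub]

theorem AvoidsResonances.det_reducedMatrix_ne_zero (hv : AvoidsResonances v)
    (hI : I.card ≤ 2 * n + 2) (hg : ∀ s, Small n I (g s))
    (hind : LinearIndependent ℚ fun s i => (g s i : ℚ)) (red : Fin n → Bool) :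
    (reducedMatrix red fun s j => linForm (g s) (coords v j)).det ≠ 0 := by
  intro hzero
  choose w hw using fun j : Fin n => exists_forall_dual_apply_eq
    (linearIndependent_linDual (linearIndependent_reducedForm red hind)) (Pi.single j 1)
  have hdet := hv.eval_eq_zero hI (T := Template.det red) (Or.inl (Or.inr ⟨red, rfl⟩)) hg
    (by rw [Template.eval_det, hzero]) w
  have hone : (reducedMatrix red fun s j => linForm (g s) (w j)) = 1 := by
    rw [reducedMatrix_linForm]
    ext s j
    rw [Matrix.of_apply, ← linDual_apply, hw, Matrix.one_apply, Pi.single_apply]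
  rw [Template.eval_det, hone, Matrix.det_one] at hdet
  exact one_ne_zero hdet

theorem mulVec_two_smul_site_eq_reducedRhs {red : Fin n → Bool} {x : Fin m}
    (hx : ∀ s u, reducedQuad red g s u = 2 * linDual (reducedForm red g s) u * u x) :
    (reducedMatrix red fun s j => linForm (g s) (coords v j)) *ᵥ (2 • v x) =
      reducedRhs red fun s j => quadForm (g s) (coords v j) := by
  let φ := Int.castRingHom ℚ
  have hφ : ∀ (M : Matrix (Fin n) (Fin n) ℤ) (y : Fin n → ℤ),
      φ ∘ (M *ᵥ y) = φ.mapMatrix M *ᵥ (φ ∘ y) :=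
    fun M y => funext (RingHom.map_mulVec φ M y)
  refine (Int.cast_injective (α := ℚ)).comp_left (?_ : φ ∘ _ = φ ∘ _)
  rw [hφ, map_reducedMatrix, map_reducedRhs]
  simp only [← map_linForm, ← map_quadForm]
  rw [reducedMatrix_linForm, reducedRhs_quadForm]
  ext s
  simp only [Matrix.mulVec, dotProduct, Matrix.of_apply, hx, linDual_apply]
  refine Finset.sum_congr rfl fun j _ => ?_
  simp [φ, coords]
  ring

theorem AvoidsResonances.eq_site_of_mulVec_eq (hv : AvoidsResonances v)
    (hI : I.card ≤ 2 * n + 2) (hg : ∀ s, Small n I (g s))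
    (hind : LinearIndependent ℚ fun s i => (g s i : ℚ)) {red : Fin n → Bool} {k : Fin n → ℤ}
    (hk : (reducedMatrix red fun s j => linForm (g s) (coords v j)) *ᵥ (2 • k) =
      reducedRhs red fun s j => quadForm (g s) (coords v j))
    {x : Fin m} (hx : ∀ s u, reducedQuad red g s u = 2 * linDual (reducedForm red g s) u * u x) :
    k = v x := by
  have hdet := hv.det_reducedMatrix_ne_zero hI hg hind red
  exact smul_right_injective _ two_ne_zero (Matrix.mulVec_injective_of_det_ne_zero hdet
    (hk.trans (mulVec_two_smul_site_eq_reducedRhs hx).symm))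

end LinearSystem

section Rank

variable {n m : ℕ} {v : Fin m → Fin n → ℤ} {I : Finset (Fin m)} {g : Fin (n + 1) → Fin m → ℤ}
  {k : Fin n → ℤ} {ε : Fin (n + 1) → ℤˣ}

theorem sphereDefect_of_mulVec_eq {R : Type*} [CommRing R] {red : Fin n → Bool}
    {L Q : Fin (n + 1) → Fin n → R} {y : Fin n → R}
    (hy : reducedMatrix red L *ᵥ y = reducedRhs red Q) :
    sphereDefect red L Q =
      (reducedMatrix red L).det ^ 2 * (y ⬝ᵥ y - 2 * (y ⬝ᵥ L 0) - 2 * ∑ j, Q 0 j) := by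
  have hcramer : (reducedMatrix red L).cramer (reducedRhs red Q) =
      (reducedMatrix red L).det • y := by
    rw [← hy, cramer_mulVec]
  simp only [sphereDefect, hcramer, smul_dotProduct, dotProduct_smul, smul_eq_mul]
  ring

theorem sum_linForm_mul_two_smul (a : Fin m → ℤ) (k : Fin n → ℤ) :
    ∑ j, linForm a (coords v j) * (2 • k) j = 2 * (k ⬝ᵥ momentum v a) := by
  simp only [dotProduct, Finset.mul_sum, momentum_apply, Pi.smul_apply, nsmul_eq_mul,
    Nat.cast_ofNat]
  exact Finset.sum_congr rfl fun j _ => by ring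

theorem reducedMatrix_mulVec_eq_reducedRhs (hc : ∀ s, Conserved v k (ε s) (g s)) (h0 : ε 0 = -1) :
    (reducedMatrix (fun s => ε s.succ = -1) fun s j => linForm (g s) (coords v j)) *ᵥ (2 • k) =
      reducedRhs (fun s => ε s.succ = -1) fun s j => quadForm (g s) (coords v j) := by
  ext s
  have hs := (hc s.succ).sum_quadForm_eq
  have h0' := (hc 0).sum_quadForm_eq
  rw [h0] at h0'
  rcases Int.units_eq_one_or (ε s.succ) with hε | hε <;> rw [hε] at hs
  · simp only [reducedMatrix, reducedRhs, Matrix.mulVec, dotProduct, hε, units_ne_neg_self,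
      decide_false, Bool.false_eq_true, if_false, Matrix.of_apply, sum_linForm_mul_two_smul, hs,
      Units.val_one]
    ring
  · simp only [reducedMatrix, reducedRhs, Matrix.mulVec, dotProduct, hε, decide_true, if_true,
      Matrix.of_apply, sub_mul, Finset.sum_sub_distrib, sum_linForm_mul_two_smul, hs, h0',
      Units.val_neg, Units.val_one]
    ring

theorem AvoidsResonances.exists_site_of_red (hn : n ≠ 0) (hv : AvoidsResonances v)
    (hI : I.card ≤ 2 * n + 2) (hg : ∀ s, Small n I (g s))
    (hind : LinearIndependent ℚ fun s i => (g s i : ℚ))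
    (hc : ∀ s, Conserved v k (ε s) (g s)) (h0 : ε 0 = -1) : ∃ x, k = v x := by
  let red : Fin n → Bool := fun s => ε s.succ = -1
  have : Nonempty (Fin n) := ⟨⟨0, Nat.pos_of_ne_zero hn⟩⟩
  have hk := reducedMatrix_mulVec_eq_reducedRhs hc h0
  have hsphere : sphereDefect red (fun s j => linForm (g s) (coords v j))
      (fun s j => quadForm (g s) (coords v j)) = 0 := by
    have h0' := (hc 0).sum_quadForm_eq
    rw [h0] at h0'
    have hmom : (k ⬝ᵥ fun j => linForm (g 0) (coords v j)) = k ⬝ᵥ momentum v (g 0) := by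
      simp only [dotProduct, momentum_apply]
    rw [sphereDefect_of_mulVec_eq hk, h0']
    simp only [smul_dotProduct, dotProduct_smul, hmom, Units.val_neg, Units.val_one]
    ring
  obtain ⟨κ, hκ, hκ0⟩ := exists_common_dual_of_cramer
    (linearIndependent_linDual (linearIndependent_reducedForm red hind)) (reducedQuad red g)
    (linDual (g 0)) (quadDual (g 0)) (by
      rintro w M y rfl rfl
      have hgeneric := hv.eval_eq_zero hI (T := Template.sphere red) (Or.inr ⟨red, rfl⟩) hg
        (by rw [Template.eval_sphere, hsphere]) w
      rw [Template.eval_sphere, sphereDefect, reducedMatrix_linForm, reducedRhs_quadForm]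
        at hgeneric
      simpa only [linDual_apply, quadDual_apply] using hgeneric)
  obtain ⟨x, rfl⟩ := exists_eq_proj_of_red (by rw [(hc 0).sum_eq, h0]; rfl) hκ0
  exact ⟨x, hv.eq_site_of_mulVec_eq hI hg hind hk hκ⟩

theorem AvoidsResonances.exists_site_of_black (hn : n ≠ 0) (hv : AvoidsResonances v)
    (hI : I.card ≤ 2 * n + 2) (hg : ∀ s, Small n I (g s))
    (hind : LinearIndependent ℚ fun s i => (g s i : ℚ))
    (hc : ∀ s, Conserved v k 1 (g s)) : ∃ x, k = v x := by
  have hquad : ∀ s, ∑ j, quadForm (g s) (coords v j) =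
      ∑ j, linForm (g s) (coords v j) * (2 • k) j := fun s => by
    rw [sum_linForm_mul_two_smul, (hc s).sum_quadForm_eq, Units.val_one]
    ring
  have hdet : (borderedMatrix (fun s j => linForm (g s) (coords v j))
      fun s => ∑ j, quadForm (g s) (coords v j)).det = 0 := by
    refine Matrix.exists_mulVec_eq_zero_iff.1 ⟨Fin.snoc (2 • k) (-1), fun h => ?_, ?_⟩
    · simpa using congrFun h (Fin.last n)
    · ext s
      simp [borderedMatrix, Matrix.mulVec, dotProduct, Fin.sum_univ_castSucc, hquad]
  obtain ⟨κ, hκ⟩ := exists_common_dual_of_det hn (linearIndependent_linDual hind)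
    (fun s => quadDual (g s)) fun w => by
      have hgeneric := hv.eval_eq_zero hI (T := Template.extended n) (by simp [templates]) hg
        (by rw [Template.eval_extended, hdet]) w
      simpa only [Template.eval_extended, linDual_apply, quadDual_apply] using hgeneric
  have hsum : ∀ s, ∑ i, g s i = 0 := fun s => (hc s).sum_eq
  have hne : ∀ s, g s ≠ 0 := fun s h => hind.ne_zero s (by ext; simp [h])
  have hinj : g 0 ≠ g (Fin.last n) := fun h =>
    hn (Fin.last_eq_zero_iff.1 (hind.injective (by rw [h])).symm)
  obtain ⟨x, rfl⟩ := exists_eq_proj_of_black (hsum 0) (hsum (Fin.last n)) (hne _) (hne _) hinj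
    (hκ 0) (hκ (Fin.last n))
  refine ⟨x, hv.eq_site_of_mulVec_eq hI hg hind (red := fun _ => false) ?_ fun s => hκ s.succ⟩
  ext s
  simp [reducedMatrix, reducedRhs, Matrix.mulVec, dotProduct, hquad]

theorem AvoidsResonances.exists_site (hn : n ≠ 0) (hv : AvoidsResonances v)
    (hI : I.card ≤ 2 * n + 2) (hg : ∀ s, Small n I (g s))
    (hind : LinearIndependent ℚ fun s i => (g s i : ℚ))
    (hc : ∀ s, Conserved v k (ε s) (g s)) : ∃ x, k = v x := by
  by_cases hred : ∃ s, ε s = -1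
  · obtain ⟨s₀, hs₀⟩ := hred
    let e := Equiv.swap 0 s₀
    exact hv.exists_site_of_red hn hI (fun s => hg (e s)) (hind.comp e e.injective)
      (fun s => hc (e s)) (by simpa [e] using hs₀)
  · exact hv.exists_site_of_black hn hI hg hind fun s =>
      (Int.units_eq_one_or (ε s)).resolve_right (fun h => hred ⟨s, h⟩) ▸ hc s

end Rank

section Independence

variable {n m : ℕ} {v : Fin m → Fin n → ℤ} {I : Finset (Fin m)}

/-- An integer vector as a rational vector. -/
def toRat (a : Fin m → ℤ) : Fin m → ℚ := fun i => a i

theorem toRat_injective : Function.Injective (toRat (m := m)) :=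
  (Int.cast_injective (α := ℚ)).comp_left

theorem exists_int_relation {r : ℕ} {g : Fin (r + 1) → Fin m → ℤ}
    (hind : LinearIndependent ℚ fun s : Fin r => toRat (g s.succ))
    (hdep : toRat (g 0) ∈ Submodule.span ℚ (Set.range fun s : Fin r => toRat (g s.succ))) :
    ∃ c : Fin (r + 1) → ℤ, c 0 ≠ 0 ∧ ∑ s, c s • g s = 0 := by
  have hcons : ¬ LinearIndependent ℚ fun s => toRat (g s) := by
    rw [← Fin.cons_self_tail fun s => toRat (g s), linearIndependent_finCons]
    exact fun h => h.2 hdep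
  rw [← LinearIndependent.iff_fractionRing ℤ ℚ] at hind hcons
  obtain ⟨c, hc, s, hs⟩ := Fintype.not_linearIndependent_iff.1 hcons
  refine ⟨c, fun h0 => hs ?_, toRat_injective (Eq.trans ?_ hc)⟩
  · rw [Fin.sum_univ_succ, h0, zero_smul, zero_add] at hc
    exact Fin.cases h0 (Fintype.linearIndependent_iff.1 hind _ hc) s
  · ext i
    simp [toRat]

theorem card_eq_finrank_of_linearIndepOn {K V ι : Type*} [DivisionRing K] [AddCommGroup V]
    [Module K V] {b : ι → V} {A : Finset ι} (h : LinearIndepOn K b (A : Set ι)) :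
    A.card = Set.finrank K (b '' A) := by
  rw [Set.finrank, Set.image_eq_range]
  exact (Fintype.card_coe A).symm.trans (finrank_span_eq_card h).symm

theorem AvoidsResonances.eq_zero_or_mem_of_mem_span (hn : n ≠ 0) (hv : AvoidsResonances v)
    (hI : I.card ≤ 2 * n + 2) {A : Finset (Fin m → ℤ)} {a : Fin m → ℤ}
    (hsmall : ∀ b ∈ insert a A, Small n I b) (hA : LinearIndepOn ℚ toRat (A : Set (Fin m → ℤ)))
    (hcard : A.card ≤ n) (ha : toRat a ∈ Submodule.span ℚ (toRat '' (A : Set (Fin m → ℤ))))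
    {y : Fin m → ℤ} (hy : ∀ b ∈ insert a A, ∑ j, linForm b (coords v j) ^ 2 = linForm b y) :
    a = 0 ∨ a ∈ A := by
  let e := A.equivFin.symm
  let g : Fin (A.card + 1) → Fin m → ℤ := Fin.cons a fun s => e s
  have hg : ∀ s, g s ∈ insert a A :=
    Fin.cases (Finset.mem_insert_self a A) fun s => Finset.mem_insert_of_mem (e s).2
  have hind : LinearIndependent ℚ fun s : Fin A.card => toRat (g s.succ) :=
    LinearIndependent.comp hA e e.injective
  have hrange : toRat '' (A : Set (Fin m → ℤ)) =
      Set.range fun s : Fin A.card => toRat (g s.succ) := by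
    rw [Set.image_eq_range]
    exact (e.surjective.range_comp fun b : A => toRat (b : Fin m → ℤ)).symm
  obtain ⟨c, hc, hlin⟩ := exists_int_relation hind (hrange ▸ ha)
  have hsq : ∑ s, c s * ∑ j, linForm (g s) (coords v j) ^ 2 = 0 := by
    have hzero := linForm_sum_smul c g y
    rw [hlin] at hzero
    simp only [hy _ (hg _)]
    simpa [linForm] using hzero.symm
  exact (hv.eq_zero_or_eq_of_relation hn hI hcard (fun s => hsmall _ (hg s)) hind hc hlin
    hsq).imp_right fun ⟨s, hs⟩ => (show a = e s from hs) ▸ (e s).2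

theorem AvoidsResonances.linearIndepOn_toRat (hn : n ≠ 0) (hv : AvoidsResonances v)
    (hI : I.card ≤ 2 * n + 2) {A : Finset (Fin m → ℤ)} (hsmall : ∀ a ∈ A, Small n I a)
    (h0 : 0 ∉ A) (hrank : Set.finrank ℚ (toRat '' (A : Set (Fin m → ℤ))) ≤ n)
    {y : Fin m → ℤ} (hy : ∀ a ∈ A, ∑ j, linForm a (coords v j) ^ 2 = linForm a y) :
    LinearIndepOn ℚ toRat (A : Set (Fin m → ℤ)) := by
  induction A using Finset.induction_on with
  | empty => simp
  | insert a A ha ih =>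
    have hmono := (Set.finrank_mono (K := ℚ)
      (Set.image_mono (f := toRat) (Finset.coe_subset.2 (Finset.subset_insert a A)))).trans hrank
    have hA := ih (fun b hb => hsmall b (Finset.mem_insert_of_mem hb))
      (fun h => h0 (Finset.mem_insert_of_mem h)) hmono
      fun b hb => hy b (Finset.mem_insert_of_mem hb)
    rw [Finset.coe_insert]
    refine hA.insert fun hmem => ?_
    rcases hv.eq_zero_or_mem_of_mem_span hn hI hsmall hA
      ((card_eq_finrank_of_linearIndepOn hA).trans_le hmono) hmem hy with rfl | h
    · exact h0 (Finset.mem_insert_self 0 A)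
    · exact ha h

theorem Conserved.sum_linForm_sq_eq {k : Fin n → ℤ} {ε : ℤˣ} {a : Fin m → ℤ}
    (h : Conserved v k ε a) :
    ∑ j, linForm a (coords v j) ^ 2 =
      linForm a fun i => v i ⬝ᵥ v i - 2 * ε * (k ⬝ᵥ v i) - k ⬝ᵥ k := by
  have hform : (linForm a fun i => v i ⬝ᵥ v i - 2 * ε * (k ⬝ᵥ v i) - k ⬝ᵥ k) =
      energy v a - 2 * ε * (k ⬝ᵥ momentum v a) - (∑ i, a i) * (k ⬝ᵥ k) := by
    simp only [linForm, energy, momentum, Fintype.linearCombination_apply, dotProduct_sum,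
      Finset.mul_sum, Finset.sum_mul, ← Finset.sum_sub_distrib, dotProduct_smul]
    refine Finset.sum_congr rfl fun i _ => ?_
    simp
    ring
  have hquad := h.sum_quadForm_eq
  rw [sum_quadForm] at hquad
  rw [hform, h.sum_eq, sum_linForm_sq]
  linear_combination -hquad

end Independence

section Clusters

variable {n m : ℕ} {v : Fin m → Fin n → ℤ} {p q q' : Frequency m} {S : Finset (Frequency m)}

/-- The positions of the frequencies in `S` relative to `p`, as rational vectors. -/
def positions (p : Frequency m) (S : Finset (Frequency m)) : Set (Fin m → ℚ) :=
  (fun q => toRat (relative p q)) '' S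

theorem positions_insert (p q : Frequency m) (S : Finset (Frequency m)) :
    positions p (insert q S) = insert (toRat (relative p q)) (positions p S) := by
  rw [positions, Finset.coe_insert, Set.image_insert_eq, positions]

/-- What remains true of a finite set of frequencies which grows from `p` along the edges of the
combinatorial graph, one frequency at a time. -/
structure IsCluster (v : Fin m → Fin n → ℤ) (p : Frequency m) (S : Finset (Frequency m)) :
    Prop where
  mem : p ∈ S
  conserved : ∀ q ∈ S, Conserved v (site v p) (p.2 * q.2) (relative p q)
  abs_lt_card : ∀ q ∈ S, ∀ l, |relative p q l| < S.card
  exists_support : ∃ I : Finset (Fin m), (∀ q ∈ S, Function.support (relative p q) ⊆ I) ∧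
    I.card ≤ 2 * Set.finrank ℚ (positions p S)

theorem finrank_positions_singleton (p : Frequency m) : Set.finrank ℚ (positions p {p}) = 0 := by
  have hzero : toRat (0 : Fin m → ℤ) = 0 := by
    ext
    simp [toRat]
  rw [positions, Finset.coe_singleton, Set.image_singleton, relative_self, hzero, Set.finrank]
  simp

theorem finrank_positions_insert_le (p q : Frequency m) (S : Finset (Frequency m)) :
    Set.finrank ℚ (positions p (insert q S)) ≤ Set.finrank ℚ (positions p S) + 1 := by
  rw [positions_insert, Set.finrank, Submodule.span_insert, add_comm]
  exact (Submodule.finrank_add_le_finrank_add_finrank _ _).trans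
    (Nat.add_le_add_right (by simpa using finrank_span_le_card {toRat (relative p q)}) _)

theorem finrank_positions_lt_insert
    (h : toRat (relative p q) ∉ Submodule.span ℚ (positions p S)) :
    Set.finrank ℚ (positions p S) < Set.finrank ℚ (positions p (insert q S)) := by
  refine Submodule.finrank_lt_finrank_of_lt (lt_of_le_of_ne ?_ fun heq => h ?_)
  · exact Submodule.span_mono (positions_insert p q S ▸ Set.subset_insert _ _)
  · rw [heq, positions_insert]
    exact Submodule.subset_span (Set.mem_insert _ _)

theorem support_relative_subset_of_mem_span {I : Finset (Fin m)}
    (hI : ∀ q ∈ S, Function.support (relative p q) ⊆ I)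
    (h : toRat (relative p q') ∈ Submodule.span ℚ (positions p S)) :
    Function.support (relative p q') ⊆ I := by
  intro l hl
  by_contra hlI
  have hker : Submodule.span ℚ (positions p S) ≤
      LinearMap.ker (LinearMap.proj l : (Fin m → ℚ) →ₗ[ℚ] ℚ) := by
    rw [Submodule.span_le]
    rintro _ ⟨q, hq, rfl⟩
    have hzero : relative p q l = 0 := by
      by_contra hne
      exact hlI (hI q hq hne)
    simp [toRat, hzero]
  exact hl (by simpa [toRat] using hker h)

theorem isCluster_singleton (p : Frequency m) : IsCluster v p {p} where
  mem := Finset.mem_singleton_self p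
  conserved := by simpa using conserved_relative_self p
  abs_lt_card := by simp [relative_self]
  exists_support := ⟨∅, by simp [relative_self]⟩

theorem IsCluster.exists_support_insert (h : IsCluster v p S) (hq : q ∈ S)
    (hadj : (combinatorialGraph v).Adj q q') :
    ∃ I : Finset (Fin m), (∀ q ∈ insert q' S, Function.support (relative p q) ⊆ I) ∧
      I.card ≤ 2 * Set.finrank ℚ (positions p (insert q' S)) := by
  obtain ⟨I, hI, hcard⟩ := h.exists_support
  by_cases hmem : toRat (relative p q') ∈ Submodule.span ℚ (positions p S)
  · refine ⟨I, ?_, hcard.trans (Nat.mul_le_mul_left 2 (Set.finrank_mono ?_))⟩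
    · rw [Finset.forall_mem_insert]
      exact ⟨support_relative_subset_of_mem_span hI hmem, hI⟩
    · exact positions_insert p q' S ▸ Set.subset_insert _ _
  · obtain ⟨i, j, hij⟩ := exists_support_relative_subset_of_adj p hadj
    refine ⟨insert i (insert j I), ?_, ?_⟩
    · rw [Finset.forall_mem_insert, Finset.coe_insert, Finset.coe_insert]
      refine ⟨hij.trans (Set.insert_subset_insert (Set.insert_subset_insert (hI q hq))),
        fun q hq => (hI q hq).trans ?_⟩
      exact (Set.subset_insert j _).trans (Set.subset_insert i _)
    · have hlt := finrank_positions_lt_insert hmem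
      have hi := Finset.card_insert_le i (insert j I)
      have hj := Finset.card_insert_le j I
      omega

theorem IsCluster.insert (h : IsCluster v p S) (hq : q ∈ S)
    (hadj : (combinatorialGraph v).Adj q q') (hq' : q' ∉ S) : IsCluster v p (insert q' S) where
  mem := Finset.mem_insert_of_mem h.mem
  conserved := (Finset.forall_mem_insert _ _ _).2 ⟨(h.conserved q hq).of_adj hadj, h.conserved⟩
  abs_lt_card := by
    rw [Finset.card_insert_of_notMem hq', Nat.cast_add, Nat.cast_one, Finset.forall_mem_insert]
    refine ⟨fun l => ?_, fun q hq l => (h.abs_lt_card q hq l).trans (lt_add_one _)⟩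
    exact (abs_relative_le_of_adj hadj l).trans_lt (add_lt_add_left (h.abs_lt_card q hq l) 1)
  exists_support := h.exists_support_insert hq hadj

theorem IsCluster.exists_small (h : IsCluster v p S) (hcard : S.card ≤ 2 * n + 3)
    (hrank : Set.finrank ℚ (positions p S) ≤ n + 1) :
    ∃ I : Finset (Fin m), I.card ≤ 2 * n + 2 ∧ ∀ q ∈ S, Small n I (relative p q) := by
  obtain ⟨I, hI, hIcard⟩ := h.exists_support
  refine ⟨I, by omega, fun q hq => ⟨fun l => ?_, hI q hq⟩⟩
  have hlt := h.abs_lt_card q hq l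
  omega

theorem IsCluster.finrank_ne (hn : n ≠ 0) (hv : AvoidsResonances v)
    (hp : site v p ∉ Set.range v) (h : IsCluster v p S) (hcard : S.card ≤ 2 * n + 3) :
    Set.finrank ℚ (positions p S) ≠ n + 1 := by
  intro hrank
  obtain ⟨I, hI, hsmall⟩ := h.exists_small hcard hrank.le
  obtain ⟨b, hb, -, hind⟩ := Submodule.exists_fun_fin_finrank_span_eq ℚ (positions p S)
  choose q hqS hq using hb
  let e : Fin (n + 1) ≃ Fin _ := finCongr hrank.symm
  have hrel : (fun s => toRat (relative p (q (e s)))) = b ∘ e := funext fun s => hq (e s)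
  obtain ⟨x, hx⟩ := hv.exists_site hn hI (fun s => hsmall (q (e s)) (hqS (e s)))
    (hrel ▸ hind.comp e e.injective) fun s => h.conserved (q (e s)) (hqS (e s))
  exact hp ⟨x, hx.symm⟩

theorem IsCluster.card_filter_le (hn : n ≠ 0) (hv : AvoidsResonances v) (h : IsCluster v p S)
    (hcard : S.card ≤ 2 * n + 3) (hrank : Set.finrank ℚ (positions p S) ≤ n) (σ : ℤˣ) :
    ((S.erase p).filter fun q => q.2 = σ).card ≤ n := by
  set T := (S.erase p).filter fun q => q.2 = σ with hT
  have hTS : ∀ q ∈ T, q ≠ p ∧ q ∈ S ∧ q.2 = σ := fun q hq => by simpa [hT, and_assoc] using hq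
  obtain ⟨I, hI, hsmall⟩ := h.exists_small hcard (hrank.trans n.le_succ)
  have hinj : Set.InjOn (relative p) T := fun q hq q' hq' =>
    eq_of_relative_eq ((hTS q hq).2.2.trans (hTS q' hq').2.2.symm)
  have hzero : 0 ∉ T.image (relative p) := by
    intro hmem
    obtain ⟨q, hq, hq0⟩ := Finset.mem_image.1 hmem
    obtain ⟨hqp, hqS, -⟩ := hTS q hq
    have hsum := (h.conserved q hqS).sum_eq
    have hcolor : p.2 * q.2 = 1 := by
      simp only [hq0, Pi.zero_apply, Finset.sum_const_zero] at hsum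
      exact Units.ext (sub_eq_zero.1 hsum.symm).symm
    exact hqp (eq_of_relative_eq_zero hcolor hq0)
  have hle : Set.finrank ℚ (toRat '' (T.image (relative p) : Set (Fin m → ℤ))) ≤ n := by
    refine (Set.finrank_mono ?_).trans hrank
    rw [Finset.coe_image, Set.image_image]
    exact Set.image_mono fun q hq => (hTS q hq).2.1
  have hind := hv.linearIndepOn_toRat hn hI (A := T.image (relative p))
    (Finset.forall_mem_image.2 fun q hq => hsmall q (hTS q hq).2.1) hzero hle
    (Finset.forall_mem_image.2 fun q hq => by
      rw [(h.conserved q (hTS q hq).2.1).sum_linForm_sq_eq, (hTS q hq).2.2])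
  rw [← Finset.card_image_of_injOn hinj, card_eq_finrank_of_linearIndepOn hind]
  exact hle

theorem IsCluster.card_le (hn : n ≠ 0) (hv : AvoidsResonances v) (h : IsCluster v p S)
    (hcard : S.card ≤ 2 * n + 3) (hrank : Set.finrank ℚ (positions p S) ≤ n) :
    S.card ≤ 2 * n + 1 := by
  have hcolor := h.card_filter_le hn hv hcard hrank
  have hsplit := Finset.card_filter_add_card_filter_not (s := S.erase p) fun q => q.2 = 1
  have hneg : ((S.erase p).filter fun q => ¬ q.2 = 1) = (S.erase p).filter fun q => q.2 = -1 :=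
    Finset.filter_congr fun q _ => by
      rcases Int.units_eq_one_or q.2 with hq | hq <;> simp [hq]
  rw [hneg, Finset.card_erase_of_mem h.mem] at hsplit
  have h1 := hcolor 1
  have h2 := hcolor (-1)
  omega

theorem AvoidsResonances.exists_isCluster (hn : n ≠ 0) (hv : AvoidsResonances v)
    (hp : site v p ∉ Set.range v) (hpq : (combinatorialGraph v).Reachable p q) :
    ∃ S, q ∈ S ∧ IsCluster v p S ∧ S.card ≤ 2 * n + 1 ∧ Set.finrank ℚ (positions p S) ≤ n := by
  rw [SimpleGraph.reachable_iff_reflTransGen] at hpq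
  induction hpq with
  | refl =>
    refine ⟨{p}, Finset.mem_singleton_self p, isCluster_singleton p, ?_, ?_⟩
    · simp
    · simp [finrank_positions_singleton]
  | @tail q q' _ hadj ih =>
    obtain ⟨S, hq, hS, hcard, hrank⟩ := ih
    by_cases hq' : q' ∈ S
    · exact ⟨S, hq', hS, hcard, hrank⟩
    have hS' := hS.insert hq hadj hq'
    have hcard' : (insert q' S).card ≤ 2 * n + 3 := (Finset.card_insert_le q' S).trans (by omega)
    have hrank' : Set.finrank ℚ (positions p (insert q' S)) ≤ n := by
      have hle := finrank_positions_insert_le p q' S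
      have hne := hS'.finrank_ne hn hv hp hcard'
      omega
    exact ⟨_, Finset.mem_insert_self q' S, hS', hS'.card_le hn hv hcard' hrank', hrank'⟩

end Clusters

section Injectivity

variable {n m : ℕ} {v : Fin m → Fin n → ℤ} {p q : Frequency m}

theorem AvoidsResonances.exists_eq_site_of_momentum_eq (hn : n ≠ 0) (hv : AvoidsResonances v)
    {I : Finset (Fin m)} (hI : I.card ≤ 2 * n + 2) {k : Fin n → ℤ} {a : Fin m → ℤ}
    (ha : Small n I a) (hc : Conserved v k (-1) a) (hmom : momentum v a = 2 • k) :
    ∃ x, k = v x := by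
  have hquad := hc.sum_quadForm_eq
  have hsum := hc.sum_eq
  obtain ⟨x, rfl⟩ := hv.exists_eq_single_two hn hI ha (by rintro rfl; simp at hsum) (by
    rw [Finset.sum_add_distrib, ← Finset.mul_sum, sum_linForm_sq, hquad, hmom]
    simp only [smul_dotProduct, dotProduct_smul, Units.val_neg, Units.val_one]
    ring)
  refine ⟨x, (smul_right_injective _ two_ne_zero (?_ : 2 • v x = 2 • k)).symm⟩
  rw [← hmom, momentum]
  simp [Pi.single_apply]

theorem AvoidsResonances.eq_of_site_eq (hn : n ≠ 0) (hv : AvoidsResonances v)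
    (hp : site v p ∉ Set.range v) (hpq : (combinatorialGraph v).Reachable p q)
    (hsite : site v q = site v p) : q = p := by
  obtain ⟨S, hq, hS, hcard, hrank⟩ := hv.exists_isCluster hn hp hpq
  obtain ⟨I, hI, hsmall⟩ := hS.exists_small (by omega) (hrank.trans n.le_succ)
  have hc := hS.conserved q hq
  have hmom := site_eq_add_momentum_relative (v := v) p q
  rw [hsite] at hmom
  rcases Int.units_eq_one_or (p.2 * q.2) with hε | hε <;> rw [hε] at hc hmom
  · have hzero : momentum v (relative p q) = 0 := by simpa using hmom
    have hrel : relative p q = 0 := by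
      by_contra hne
      refine hv.norm_ne_zero hn hI (hsmall q hq) hne ?_
      rw [sum_linForm_sq, hzero, dotProduct_zero]
    exact eq_of_relative_eq_zero hε hrel
  · obtain ⟨x, hx⟩ := hv.exists_eq_site_of_momentum_eq hn hI (hsmall q hq) hc (by
      rw [two_smul]
      exact (neg_add_eq_iff_eq_add.1 (by simpa using hmom.symm)))
    exact absurd ⟨x, hx.symm⟩ hp

end Injectivity

section Component

variable {n m : ℕ} {v : Fin m → Fin n → ℤ}

/-- The two facts about a generic list of sites on which the comparison of `Λ_S` with `Γ_S` rests:
no triangle of sites has a right angle, and a frequency with normal site is determined, within its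
component of `Λ_S`, by its site. -/
structure IsNonresonant (v : Fin m → Fin n → ℤ) : Prop where
  angle : ∀ x y z, x ≠ y → x ≠ z → (v y - v x) ⬝ᵥ (v z - v x) ≠ 0
  eq_of_site_eq : ∀ p q : Frequency m, site v p ∉ Set.range v →
    (combinatorialGraph v).Reachable p q → site v q = site v p → q = p

namespace IsNonresonant

theorem injective (hv : IsNonresonant v) : Function.Injective v := by
  intro x y hxy
  by_contra hne
  exact hv.angle x y y hne hne (by rw [hxy, sub_self, zero_dotProduct])

theorem mem_range_of_adj (hv : IsNonresonant v) {x : Fin m} {b : EuclideanSpace ℝ (Fin n)}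
    (h : (geometricGraph v).Adj (toEuclid (v x)) b) : b ∈ Set.range fun y => toEuclid (v y) := by
  obtain ⟨i, j, hij, h | h⟩ := (geometricGraph_adj hv.injective).1 h
  · obtain ⟨rfl, hangle⟩ := geoBlack_toEuclid_iff.1 h
    obtain rfl : x = i := by
      by_contra hxi
      exact hv.angle i x j (Ne.symm hxi) hij hangle
    exact ⟨j, by rw [add_sub_cancel_left]⟩
  · obtain ⟨rfl, hangle⟩ := geoRed_toEuclid_iff.1 h
    obtain rfl | rfl : x = i ∨ x = j := by
      by_contra! hx
      refine hv.angle x i j hx.1 hx.2 ?_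
      rwa [← neg_sub, neg_dotProduct, ← neg_sub (v x), dotProduct_neg, neg_neg]
    · exact ⟨j, by rw [add_sub_cancel_left]⟩
    · exact ⟨i, by rw [add_sub_cancel_right]⟩

theorem supp_connectedComponentMk (hv : IsNonresonant v) (i : Fin m) :
    ((geometricGraph v).connectedComponentMk (toEuclid (v i))).supp =
      Set.range fun j => toEuclid (v j) := by
  ext b
  rw [SimpleGraph.ConnectedComponent.mem_supp_iff, SimpleGraph.ConnectedComponent.eq,
    SimpleGraph.reachable_comm]
  constructor
  · rintro ⟨w⟩
    generalize ha : toEuclid (v i) = a at w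
    induction w generalizing i with
    | nil => exact ⟨i, ha⟩
    | cons h _ ih =>
      subst ha
      obtain ⟨j, hj⟩ := hv.mem_range_of_adj h
      exact ih j hj
  · rintro ⟨j, rfl⟩
    rcases eq_or_ne i j with rfl | hij
    · exact SimpleGraph.Reachable.refl _
    · exact ((geometricGraph_adj hv.injective).2 ⟨i, j, hij, Or.inl ⟨rfl, rfl⟩⟩).reachable

theorem site_notMem_range_of_adj (hv : IsNonresonant v) {p q : Frequency m}
    (h : (combinatorialGraph v).Adj p q) (hp : site v p ∉ Set.range v) :
    site v q ∉ Set.range v := by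
  rintro ⟨x, hx⟩
  have hadj := geometricGraph_adj_of_combinatorialGraph_adj hv.injective h.symm
  rw [← hx] at hadj
  obtain ⟨y, hy⟩ := hv.mem_range_of_adj hadj
  exact hp ⟨y, toEuclid_injective hy⟩

theorem site_notMem_range_of_reachable (hv : IsNonresonant v) {p q : Frequency m}
    (h : (combinatorialGraph v).Reachable p q) (hp : site v p ∉ Set.range v) :
    site v q ∉ Set.range v := by
  obtain ⟨w⟩ := h
  induction w with
  | nil => exact hp
  | cons h _ ih => exact ih (hv.site_notMem_range_of_adj h hp)

theorem eq_of_reachable_of_site_eq (hv : IsNonresonant v) {p q : Frequency m}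
    (hp : site v p ∉ Set.range v) (hpq : (combinatorialGraph v).Reachable p q)
    (hsite : toEuclid (site v q) = toEuclid (site v p)) : q = p :=
  hv.eq_of_site_eq p q hp hpq (toEuclid_injective hsite)

theorem combBlack_iff_geoBlack (hv : IsNonresonant v) {p q : Frequency m}
    (hq : site v q ∉ Set.range v) (hpq : (combinatorialGraph v).Reachable p q) {i j : Fin m}
    (hij : i ≠ j) :
    CombBlack v i j p q ↔ GeoBlack v i j (toEuclid (site v p)) (toEuclid (site v q)) := by
  rw [geoBlack_site_iff]
  refine ⟨fun h => ⟨q, h, rfl⟩, fun ⟨q', h, hsite⟩ => ?_⟩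
  have hpq' := (combinatorialGraph_adj.2 ⟨i, j, hij, Or.inl h⟩).reachable
  rwa [hv.eq_of_reachable_of_site_eq hq (hpq.symm.trans hpq') hsite] at h

theorem combRed_iff_geoRed (hv : IsNonresonant v) {p q : Frequency m}
    (hq : site v q ∉ Set.range v) (hpq : (combinatorialGraph v).Reachable p q) {i j : Fin m}
    (hij : i ≠ j) :
    CombRed v i j p q ↔ GeoRed v i j (toEuclid (site v p)) (toEuclid (site v q)) := by
  rw [geoRed_site_iff]
  refine ⟨fun h => ⟨q, h, rfl⟩, fun ⟨q', h, hsite⟩ => ?_⟩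
  have hpq' := (combinatorialGraph_adj.2 ⟨i, j, hij, Or.inr h⟩).reachable
  rwa [hv.eq_of_reachable_of_site_eq hq (hpq.symm.trans hpq') hsite] at h

theorem bijOn_site (hv : IsNonresonant v) {p : Frequency m} (hp : site v p ∉ Set.range v) :
    Set.BijOn (fun q => toEuclid (site v q)) ((combinatorialGraph v).connectedComponentMk p).supp
      ((geometricGraph v).connectedComponentMk (toEuclid (site v p))).supp := by
  simp only [SimpleGraph.ConnectedComponent.supp, SimpleGraph.ConnectedComponent.eq]
  refine ⟨fun q hq => geometricGraph_reachable hv.injective hq, fun q hq q' hq' hsite => ?_,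
    fun b hb => ?_⟩
  · exact hv.eq_of_reachable_of_site_eq (hv.site_notMem_range_of_reachable hq'.symm hp)
      (hq'.trans hq.symm) hsite
  · obtain ⟨q, hpq, hq⟩ :=
      exists_combinatorialGraph_reachable hv.injective (SimpleGraph.Reachable.symm hb)
    exact ⟨q, hpq.symm, hq⟩

theorem exists_iso (hv : IsNonresonant v) {p : Frequency m} (hp : site v p ∉ Set.range v) :
    ∃ φ : (combinatorialGraph v).induce ((combinatorialGraph v).connectedComponentMk p).supp ≃g
        (geometricGraph v).induce
          ((geometricGraph v).connectedComponentMk (toEuclid (site v p))).supp,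
      (∀ q, (φ q : EuclideanSpace ℝ (Fin n)) = toEuclid (site v q.1)) ∧
      ∀ q q', ∀ i j : Fin m, i ≠ j →
        (CombBlack v i j q.1 q'.1 ↔ GeoBlack v i j (φ q).1 (φ q').1) ∧
        (CombRed v i j q.1 q'.1 ↔ GeoRed v i j (φ q).1 (φ q').1) := by
  have hreach (q : ((combinatorialGraph v).connectedComponentMk p).supp) :
      (combinatorialGraph v).Reachable p q :=
    (SimpleGraph.ConnectedComponent.eq.1 q.2).symm
  have hnormal (q : ((combinatorialGraph v).connectedComponentMk p).supp) :
      site v q.1 ∉ Set.range v :=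
    hv.site_notMem_range_of_reachable (hreach q) hp
  have hmarks (q q' : ((combinatorialGraph v).connectedComponentMk p).supp) (i j : Fin m)
      (hij : i ≠ j) :=
    And.intro (hv.combBlack_iff_geoBlack (hnormal q') ((hreach q).symm.trans (hreach q')) hij)
      (hv.combRed_iff_geoRed (hnormal q') ((hreach q).symm.trans (hreach q')) hij)
  refine ⟨⟨(hv.bijOn_site hp).equiv _, fun {q q'} => ?_⟩, fun _ => rfl, hmarks⟩
  change (geometricGraph v).Adj (toEuclid (site v q.1)) (toEuclid (site v q'.1)) ↔
    (combinatorialGraph v).Adj q.1 q'.1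
  rw [geometricGraph_adj hv.injective, combinatorialGraph_adj]
  exact exists₂_congr fun i j => and_congr_right fun hij =>
    (or_congr (hmarks q q' i j hij).1 (hmarks q q' i j hij).2).symm

end IsNonresonant

end Component

section Poisson

variable {n m : ℕ} {v : Fin m → Fin n → ℤ}

theorem isLinearMap_sum_single {A : Type*} (e : A → A) (w : A → ℂ) :
    IsLinearMap ℂ fun F : AddMonoidAlgebra ℂ A =>
      F.coeff.sum fun a c => AddMonoidAlgebra.single (e a) (w a * c) where
  map_add F G := by
    rw [AddMonoidAlgebra.coeff_add, Finsupp.sum_add_index'] <;> simp [mul_add]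
  map_smul c F := by
    rw [AddMonoidAlgebra.coeff_smul, Finsupp.sum_smul_index'] <;>
      simp [Finsupp.smul_sum, mul_left_comm]

theorem isLinearMap_derivX (j : Fin m) :
    IsLinearMap ℂ (derivX j : PoissonAlg v → PoissonAlg v) :=
  isLinearMap_sum_single id _

theorem isLinearMap_derivY (j : Fin m) :
    IsLinearMap ℂ (derivY j : PoissonAlg v → PoissonAlg v) :=
  isLinearMap_sum_single _ _

theorem isLinearMap_derivW (k : NormalSite v) (σ : ℤˣ) : IsLinearMap ℂ (derivW k σ) :=
  isLinearMap_sum_single _ _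

theorem derivX_single (j : Fin m) (a : Exponent v) (c : ℂ) :
    derivX j (AddMonoidAlgebra.single a c : PoissonAlg v) =
      AddMonoidAlgebra.single a (Complex.I * (a.1 j : ℂ) * c) := by
  simp [derivX]

theorem derivY_single (j : Fin m) (a : Exponent v) (c : ℂ) :
    derivY j (AddMonoidAlgebra.single a c : PoissonAlg v) =
      AddMonoidAlgebra.single (a.1, a.2.1 - Finsupp.single j 1, a.2.2) ((a.2.1 j : ℂ) * c) := by
  simp [derivY]

theorem derivW_single (k : NormalSite v) (σ : ℤˣ) (a : Exponent v) (c : ℂ) :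
    derivW k σ (AddMonoidAlgebra.single a c : PoissonAlg v) =
      AddMonoidAlgebra.single (a.1, a.2.1, a.2.2 - Finsupp.single (k, σ) 1)
        ((a.2.2 (k, σ) : ℂ) * c) := by
  simp [derivW]

theorem finite_derivW_ne_zero (σ : ℤˣ) (F : PoissonAlg v) :
    {k : NormalSite v | derivW k σ F ≠ 0}.Finite := by
  refine Set.Finite.subset (F.coeff.support.finite_toSet.biUnion fun a _ =>
    (a.2.2.support.finite_toSet.image Prod.fst)) fun k hk => ?_
  by_contra hcon
  refine hk ?_
  rw [derivW, Finsupp.sum]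
  refine Finset.sum_eq_zero fun a ha => ?_
  have hexponent : a.2.2 (k, σ) = 0 := by
    by_contra h
    exact hcon (Set.mem_biUnion ha ⟨(k, σ), Finsupp.mem_support_iff.2 h, rfl⟩)
  simp [hexponent]

theorem hasFiniteSupport_poisson (F G : PoissonAlg v) :
    (fun k : NormalSite v =>
      derivW k (-1) F * derivW k 1 G - derivW k 1 F * derivW k (-1) G).HasFiniteSupport := by
  refine Set.Finite.subset ((finite_derivW_ne_zero (-1) F).union (finite_derivW_ne_zero 1 F))
    fun k hk => ?_
  by_contra hcon
  simp only [Set.mem_union, Set.mem_ofPred_eq, not_or, not_not] at hcon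
  exact hk (by simp only [hcon.1, hcon.2, zero_mul, sub_self])

theorem isLinearMap_poisson (F : PoissonAlg v) : IsLinearMap ℂ (poisson F) where
  map_add G G' := by
    have hX := fun j => (isLinearMap_derivX (v := v) j).map_add G G'
    have hY := fun j => (isLinearMap_derivY (v := v) j).map_add G G'
    have hW := fun k σ => (isLinearMap_derivW (v := v) k σ).map_add G G'
    simp only [poisson, hX, hY, hW, mul_add, add_mul, add_sub_add_comm]
    rw [finsum_add_distrib (hasFiniteSupport_poisson F G) (hasFiniteSupport_poisson F G'),
      smul_add, Finset.sum_add_distrib]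
    abel
  map_smul c G := by
    have hX := fun j => (isLinearMap_derivX (v := v) j).map_smul c G
    have hY := fun j => (isLinearMap_derivY (v := v) j).map_smul c G
    have hW := fun k σ => (isLinearMap_derivW (v := v) k σ).map_smul c G
    simp only [poisson, hX, hY, hW, mul_smul_comm, smul_mul_assoc, ← smul_sub]
    rw [← smul_finsum' c (hasFiniteSupport_poisson F G), ← Finset.smul_sum, smul_add, smul_comm]

/-- The site of a normal frequency. -/
abbrev nsite (p : NormalFrequency v) : NormalSite v := ⟨site v p.1, p.2⟩

theorem derivY_freqElem (j : Fin m) (p : NormalFrequency v) : derivY j (freqElem p) = 0 := by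
  simp [freqElem, freqExponent, derivY_single]

theorem derivW_freqElem_self (p : NormalFrequency v) :
    derivW (nsite p) p.1.2 (freqElem p) =
      AddMonoidAlgebra.single ((p.1.2 : ℤ) • p.1.1, 0, 0) 1 := by
  simp [freqElem, freqExponent, derivW_single]

theorem derivW_freqElem_of_ne {p : NormalFrequency v} {k : NormalSite v} {s : ℤˣ}
    (h : (k, s) ≠ (nsite p, p.1.2)) : derivW k s (freqElem p) = 0 := by
  simp [freqElem, freqExponent, derivW_single, Finsupp.single_eq_of_ne h]

theorem poisson_single_freqElem (ν : Fin m → ℤ) (γ : NormalSite v × ℤˣ →₀ ℕ) (c : ℂ)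
    (p : NormalFrequency v) :
    poisson (AddMonoidAlgebra.single (ν, 0, γ) c) (freqElem p) =
      AddMonoidAlgebra.single
        (ν + (p.1.2 : ℤ) • p.1.1, 0, γ - Finsupp.single (nsite p, -p.1.2) 1)
        (((p.1.2 : ℤ) : ℂ) * Complex.I * (γ (nsite p, -p.1.2) : ℂ) * c) := by
  have hsites : ∀ k ≠ nsite p, ∀ s, derivW k s (freqElem p) = 0 := fun k hk s =>
    derivW_freqElem_of_ne fun h => hk (Prod.ext_iff.1 h).1
  have hY (j : Fin m) : derivY j (AddMonoidAlgebra.single (ν, 0, γ) c : PoissonAlg v) = 0 := by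
    simp [derivY_single]
  simp only [poisson, derivY_freqElem, hY, zero_mul, sub_self, Finset.sum_const_zero, zero_add]
  rw [finsum_eq_single _ (nsite p) fun k hk => by simp only [hsites k hk, mul_zero, sub_self]]
  have hself := derivW_freqElem_self p
  have hother := derivW_freqElem_of_ne (p := p) (k := nsite p) (s := -p.1.2)
    fun h => units_ne_neg_self _ (Prod.ext_iff.1 h).2.symm
  rcases Int.units_eq_one_or p.1.2 with hσ | hσ <;>
    simp only [hσ, neg_neg] at hself hother ⊢ <;>
    rw [hself, hother, mul_zero, derivW_single, AddMonoidAlgebra.single_mul_single]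
  · simp [AddMonoidAlgebra.smul_single, mul_assoc]
  · simp [AddMonoidAlgebra.smul_single, ← AddMonoidAlgebra.single_neg, mul_assoc]

/-- What the factor `b` contributes to the bracket of `c e^{iν·x} w_a w_b` with the element of the
frequency basis of `p`; here `w_{(k, σ)}` is `z_k` or `z̄_k`. -/
noncomputable def contraction (c : ℂ) (ν : Fin m → ℤ) (a b : NormalSite v × ℤˣ)
    (p : NormalFrequency v) : PoissonAlg v :=
  if b = (nsite p, -p.1.2) then
    AddMonoidAlgebra.single (ν + (p.1.2 : ℤ) • p.1.1, 0, Finsupp.single a 1)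
      (((p.1.2 : ℤ) : ℂ) * Complex.I * c)
  else 0

theorem poisson_expX_mul_varW_mul_varW (c : ℂ) (ν : Fin m → ℤ) (h k : NormalSite v) (s s' : ℤˣ)
    (p : NormalFrequency v) :
    poisson (expX v c ν * varW h s * varW k s') (freqElem p) =
      contraction c ν (h, s) (k, s') p + contraction c ν (k, s') (h, s) p := by
  have hmonomial : expX v c ν * varW h s * varW k s' =
      AddMonoidAlgebra.single (ν, 0, Finsupp.single (h, s) 1 + Finsupp.single (k, s') 1) c := by
    simp [expX, varW, AddMonoidAlgebra.single_mul_single]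
  rw [hmonomial, poisson_single_freqElem, contraction, contraction]
  by_cases hk : (k, s') = (nsite p, -p.1.2) <;> by_cases hh : (h, s) = (nsite p, -p.1.2)
  · rw [if_pos hk, if_pos hh, hk, hh, ← AddMonoidAlgebra.single_add]
    congr 1
    · simp
    · simp only [Finsupp.add_apply, Finsupp.single_eq_same, Nat.cast_add, Nat.cast_one]
      ring
  · rw [if_pos hk, if_neg hh, hk, add_zero]
    congr 1
    · simp
    · simp [Finsupp.single_eq_of_ne' hh]
  · rw [if_neg hk, if_pos hh, hh, zero_add]
    congr 1
    · simp
    · simp [Finsupp.single_eq_of_ne' hk]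
  · rw [if_neg hk, if_neg hh]
    simp [Finsupp.single_eq_of_ne' hk, Finsupp.single_eq_of_ne' hh]

theorem contraction_of_ne {c : ℂ} {ν : Fin m → ℤ} {a b : NormalSite v × ℤˣ}
    {p : NormalFrequency v} (hb : b ≠ (nsite p, -p.1.2)) : contraction c ν a b p = 0 :=
  if_neg hb

theorem contraction_eq_smul_freqElem {c : ℂ} {ν : Fin m → ℤ} {p q : NormalFrequency v}
    (hq : ν + (p.1.2 : ℤ) • p.1.1 = (q.1.2 : ℤ) • q.1.1) :
    contraction c ν (nsite q, q.1.2) (nsite p, -p.1.2) p =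
      (((p.1.2 : ℤ) : ℂ) * Complex.I * c) • freqElem q := by
  rw [contraction, if_pos rfl, freqElem, freqExponent, AddMonoidAlgebra.smul_single, hq,
    smul_eq_mul, mul_one]

end Poisson

section Operators

variable {n m : ℕ} {v : Fin m → Fin n → ℤ}

/-- The markings of the black edges of `Λ_S` which start at `p`. -/
abbrev BlackMark (v : Fin m → Fin n → ℤ) (p : Frequency m) : Type :=
  {x : Fin m × Fin m // x.1 ≠ x.2 ∧ CombBlack v x.1 x.2 p (blackEnd p x.1 x.2)}

/-- The markings of the red edges of `Λ_S` which start at `p`, each unordered pair being taken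
once. -/
abbrev RedMark (v : Fin m → Fin n → ℤ) (p : Frequency m) : Type :=
  {x : Fin m × Fin m // x.1 < x.2 ∧ CombRed v x.1 x.2 p (redEnd p x.1 x.2)}

/-- The markings of the edges of `Λ_S` which start at `p`. -/
abbrev Mark (v : Fin m → Fin n → ℤ) (p : Frequency m) : Type :=
  BlackMark v p ⊕ RedMark v p

noncomputable instance (p : Frequency m) : Fintype (BlackMark v p) := Fintype.ofFinite _

noncomputable instance (p : Frequency m) : Fintype (RedMark v p) := Fintype.ofFinite _

/-- The neighbour of `p` along a black edge. -/
def IsNonresonant.blackNbr (hv : IsNonresonant v) (p : NormalFrequency v) (x : BlackMark v p.1) :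
    NormalFrequency v :=
  ⟨blackEnd p.1 x.1.1 x.1.2, hv.site_notMem_range_of_adj
    (combinatorialGraph_adj.2 ⟨_, _, x.2.1, Or.inl x.2.2⟩) p.2⟩

/-- The neighbour of `p` along a red edge. -/
def IsNonresonant.redNbr (hv : IsNonresonant v) (p : NormalFrequency v) (x : RedMark v p.1) :
    NormalFrequency v :=
  ⟨redEnd p.1 x.1.1 x.1.2, hv.site_notMem_range_of_adj
    (combinatorialGraph_adj.2 ⟨_, _, x.2.1.ne, Or.inr x.2.2⟩) p.2⟩

/-- The monomial of `Q` indexed by a black term, for `s = 1`; for `s = -1` the roles of `(i, h)`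
and `(j, k)` are exchanged. -/
noncomputable def blackMonomial (ξ : Fin m → ℝ) (s : ℤˣ) (t : BlackTerm v) : PoissonAlg v :=
  expX v ((4 * √(ξ t.1.1 * ξ t.1.2.1) : ℝ) : ℂ) ((s : ℤ) • (unitVec t.1.1 - unitVec t.1.2.1)) *
    varW t.1.2.2.1 s * varW t.1.2.2.2 (-s)

/-- The monomials `z_h z_k` (for `s = 1`) and `z̄_h z̄_k` (for `s = -1`) of `Q`. -/
noncomputable def redMonomial (ξ : Fin m → ℝ) (s : ℤˣ) (t : RedTerm v) : PoissonAlg v :=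
  expX v ((2 * √(ξ t.1.1 * ξ t.1.2.1) : ℝ) : ℂ) (-(s : ℤ) • (unitVec t.1.1 + unitVec t.1.2.1)) *
    varW t.1.2.2.1 s * varW t.1.2.2.2 s

/-- The involution `(i, j, h, k) ↦ (j, i, k, h)` of the black terms. -/
def blackTermSwap : BlackTerm v ≃ BlackTerm v where
  toFun t := ⟨(t.1.2.1, t.1.1, t.1.2.2.2, t.1.2.2.1), t.2.1.symm, t.2.2.1.symm, t.2.2.2.symm⟩
  invFun t := ⟨(t.1.2.1, t.1.1, t.1.2.2.2, t.1.2.2.1), t.2.1.symm, t.2.2.1.symm, t.2.2.2.symm⟩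
  left_inv _ := rfl
  right_inv _ := rfl

/-- The involution `(i, j, h, k) ↦ (i, j, k, h)` of the red terms. -/
def redTermSwap : RedTerm v ≃ RedTerm v where
  toFun t := ⟨(t.1.1, t.1.2.1, t.1.2.2.2, t.1.2.2.1), t.2.1,
    (add_comm _ _).trans t.2.2.1, (add_comm _ _).trans t.2.2.2⟩
  invFun t := ⟨(t.1.1, t.1.2.1, t.1.2.2.2, t.1.2.2.1), t.2.1,
    (add_comm _ _).trans t.2.2.1, (add_comm _ _).trans t.2.2.2⟩
  left_inv _ := rfl
  right_inv _ := rfl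

theorem blackMonomial_swap (ξ : Fin m → ℝ) (s : ℤˣ) (t : BlackTerm v) :
    blackMonomial ξ (-s) (blackTermSwap t) = blackMonomial ξ s t := by
  change expX v ((4 * √(ξ t.1.2.1 * ξ t.1.1) : ℝ) : ℂ)
    (((-s : ℤˣ) : ℤ) • (unitVec t.1.2.1 - unitVec t.1.1)) * varW t.1.2.2.2 (-s) *
      varW t.1.2.2.1 (- -s) = _
  rw [neg_neg, Units.val_neg, neg_smul, ← smul_neg, neg_sub, mul_comm (ξ t.1.2.1), mul_right_comm]
  rfl

theorem finsum_blackMonomial_neg (ξ : Fin m → ℝ) (s : ℤˣ) (f : PoissonAlg v) :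
    ∑ᶠ t, poisson (blackMonomial ξ (-s) t) f = ∑ᶠ t, poisson (blackMonomial ξ s t) f := by
  rw [← finsum_comp_equiv blackTermSwap]
  simp only [blackMonomial_swap]

theorem adQ_eq (ξ : Fin m → ℝ) (s : ℤˣ) (f : PoissonAlg v) :
    adQ v ξ f = ∑ᶠ t, poisson (blackMonomial ξ s t) f + ∑ᶠ t, poisson (redMonomial ξ s t) f +
      ∑ᶠ t, poisson (redMonomial ξ (-s) t) f := by
  have hone : adQ v ξ f = ∑ᶠ t, poisson (blackMonomial ξ 1 t) f +
      ∑ᶠ t, poisson (redMonomial ξ 1 t) f + ∑ᶠ t, poisson (redMonomial ξ (-1) t) f := by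
    simp only [adQ, blackMonomial, redMonomial, Units.val_one, Units.val_neg, neg_neg, one_smul,
      neg_smul]
  rcases Int.units_eq_one_or s with rfl | rfl
  · exact hone
  · rw [hone, neg_neg, finsum_blackMonomial_neg]
    exact add_right_comm _ _ _

theorem finsum_eq_sum_of_injective {T X M : Type*} [AddCommMonoid M] [Fintype X] {e : X → T}
    (he : Function.Injective e) {f : T → M} (hf : f.support ⊆ Set.range e) :
    ∑ᶠ t, f t = ∑ x, f (e x) := by
  rw [← finsum_eq_sum_of_fintype, ← finsum_mem_range he, ← finsum_mem_univ f]
  exact finsum_mem_inter_support_eq' f _ _ fun t ht => iff_of_true trivial (hf ht)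

theorem poisson_blackMonomial_eq_contraction (ξ : Fin m → ℝ) (p : NormalFrequency v)
    (t : BlackTerm v) :
    poisson (blackMonomial ξ p.1.2 t) (freqElem p) =
      contraction ((4 * √(ξ t.1.1 * ξ t.1.2.1) : ℝ) : ℂ)
        ((p.1.2 : ℤ) • (unitVec t.1.1 - unitVec t.1.2.1)) (t.1.2.2.1, p.1.2)
        (t.1.2.2.2, -p.1.2) p := by
  rw [blackMonomial, poisson_expX_mul_varW_mul_varW, add_eq_left]
  exact contraction_of_ne fun h => units_ne_neg_self _ (Prod.ext_iff.1 h).2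

theorem poisson_redMonomial_self (ξ : Fin m → ℝ) (p : NormalFrequency v) (t : RedTerm v) :
    poisson (redMonomial ξ p.1.2 t) (freqElem p) = 0 := by
  rw [redMonomial, poisson_expX_mul_varW_mul_varW, contraction_of_ne, contraction_of_ne, add_zero]
  all_goals exact fun h => units_ne_neg_self _ (Prod.ext_iff.1 h).2

/-- What the factor `w_k` of a red term contributes to the bracket of `Q` with the element of the
frequency basis of `p`. -/
noncomputable def redContraction (ξ : Fin m → ℝ) (p : NormalFrequency v) (t : RedTerm v) :
    PoissonAlg v :=
  contraction ((2 * √(ξ t.1.1 * ξ t.1.2.1) : ℝ) : ℂ)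
    ((p.1.2 : ℤ) • (unitVec t.1.1 + unitVec t.1.2.1)) (t.1.2.2.1, -p.1.2) (t.1.2.2.2, -p.1.2) p

theorem poisson_redMonomial_neg (ξ : Fin m → ℝ) (p : NormalFrequency v) (t : RedTerm v) :
    poisson (redMonomial ξ (-p.1.2) t) (freqElem p) =
      redContraction ξ p t + redContraction ξ p (redTermSwap t) := by
  rw [redMonomial, poisson_expX_mul_varW_mul_varW, Units.val_neg, neg_neg]
  rfl

namespace IsNonresonant

/-- The black term `(i, j, h, k)` whose `k` is the site of `p` and whose `h` is the site of the
neighbour of `p` along the edge marked `(i, j)`. -/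
def blackTerm (hv : IsNonresonant v) (p : NormalFrequency v) (x : BlackMark v p.1) :
    BlackTerm v :=
  ⟨(x.1.1, x.1.2, nsite (hv.blackNbr p x), nsite p), x.2.1,
    by simp only [blackNbr, site_blackEnd]; abel,
    by simp only [blackNbr]; linarith [x.2.2.2.2]⟩

/-- The red term `(i, j, h, k)` whose `k` is the site of `p` and whose `h` is the site of the
neighbour of `p` along the edge marked `(i, j)`. -/
def redTerm (hv : IsNonresonant v) (p : NormalFrequency v) (x : RedMark v p.1) : RedTerm v :=
  ⟨(x.1.1, x.1.2, nsite (hv.redNbr p x), nsite p), x.2.1,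
    by simp only [redNbr, site_redEnd]; abel,
    by simp only [redNbr]; linarith [x.2.2.2.2]⟩

theorem blackTerm_injective (hv : IsNonresonant v) (p : NormalFrequency v) :
    Function.Injective (hv.blackTerm p) := fun x y h => by
  have hterm := Prod.ext_iff.1 (congrArg Subtype.val h)
  exact Subtype.ext (Prod.ext hterm.1 (Prod.ext_iff.1 hterm.2).1)

theorem redTerm_injective (hv : IsNonresonant v) (p : NormalFrequency v) :
    Function.Injective (hv.redTerm p) := fun x y h => by
  have hterm := Prod.ext_iff.1 (congrArg Subtype.val h)
  exact Subtype.ext (Prod.ext hterm.1 (Prod.ext_iff.1 hterm.2).1)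

theorem mem_range_blackTerm (hv : IsNonresonant v) (p : NormalFrequency v) {t : BlackTerm v}
    (ht : t.1.2.2.2 = nsite p) : t ∈ Set.range (hv.blackTerm p) := by
  obtain ⟨⟨i, j, h, k⟩, hij, hmom, henergy⟩ := t
  obtain rfl : k = nsite p := ht
  have hh : h.1 = site v (blackEnd p.1 i j) := by
    rw [site_blackEnd, eq_sub_iff_add_eq]
    exact hmom
  refine ⟨⟨(i, j), hij, rfl, rfl, ?_⟩,
    Subtype.ext (Prod.ext rfl (Prod.ext rfl (Prod.ext (Subtype.ext hh.symm) rfl)))⟩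
  simp only at henergy
  rw [← hh]
  linarith

theorem mem_range_redTerm (hv : IsNonresonant v) (p : NormalFrequency v) {t : RedTerm v}
    (ht : t.1.2.2.2 = nsite p) : t ∈ Set.range (hv.redTerm p) := by
  obtain ⟨⟨i, j, h, k⟩, hij, hmom, henergy⟩ := t
  obtain rfl : k = nsite p := ht
  have hh : h.1 = site v (redEnd p.1 i j) := by
    rw [site_redEnd, eq_sub_iff_add_eq]
    exact hmom
  refine ⟨⟨(i, j), hij, (neg_neg _).symm, by simp only [redEnd]; abel, ?_⟩,
    Subtype.ext (Prod.ext rfl (Prod.ext rfl (Prod.ext (Subtype.ext hh.symm) rfl)))⟩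
  simp only at henergy
  rw [← hh]
  linarith

theorem support_blackMonomial_subset (hv : IsNonresonant v) (ξ : Fin m → ℝ)
    (p : NormalFrequency v) :
    (fun t => poisson (blackMonomial ξ p.1.2 t) (freqElem p)).support ⊆
      Set.range (hv.blackTerm p) := by
  intro t ht
  refine hv.mem_range_blackTerm p ?_
  by_contra hk
  refine ht ?_
  simp only [poisson_blackMonomial_eq_contraction]
  exact contraction_of_ne fun h => hk (Prod.ext_iff.1 h).1

theorem support_redContraction_subset (hv : IsNonresonant v) (ξ : Fin m → ℝ)
    (p : NormalFrequency v) : (redContraction ξ p).support ⊆ Set.range (hv.redTerm p) := by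
  intro t ht
  refine hv.mem_range_redTerm p ?_
  by_contra hk
  exact ht (contraction_of_ne fun h => hk (Prod.ext_iff.1 h).1)

theorem hasFiniteSupport_redContraction (hv : IsNonresonant v) (ξ : Fin m → ℝ)
    (p : NormalFrequency v) : (redContraction ξ p).HasFiniteSupport :=
  (Set.finite_range _).subset (hv.support_redContraction_subset ξ p)

theorem hasFiniteSupport_blackMonomial (hv : IsNonresonant v) (ξ : Fin m → ℝ) (s : ℤˣ)
    (p : NormalFrequency v) :
    (fun t => poisson (blackMonomial ξ s t) (freqElem p)).HasFiniteSupport := by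
  have hself : (fun t => poisson (blackMonomial ξ p.1.2 t) (freqElem p)).HasFiniteSupport :=
    (Set.finite_range _).subset (hv.support_blackMonomial_subset ξ p)
  rcases eq_or_ne s p.1.2 with rfl | hs
  · exact hself
  · obtain rfl := Int.units_ne_iff_eq_neg.1 hs
    refine (hself.preimage blackTermSwap.injective.injOn).subset fun t ht => ?_
    rw [Set.mem_preimage, Function.mem_support, ← blackMonomial_swap]
    exact ht

theorem hasFiniteSupport_redMonomial (hv : IsNonresonant v) (ξ : Fin m → ℝ) (s : ℤˣ)
    (p : NormalFrequency v) :
    (fun t => poisson (redMonomial ξ s t) (freqElem p)).HasFiniteSupport := by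
  rcases eq_or_ne s p.1.2 with rfl | hs
  · simp [poisson_redMonomial_self, Function.HasFiniteSupport]
  · obtain rfl := Int.units_ne_iff_eq_neg.1 hs
    simp only [poisson_redMonomial_neg]
    exact (hv.hasFiniteSupport_redContraction ξ p).add
      ((hv.hasFiniteSupport_redContraction ξ p).preimage redTermSwap.injective.injOn)

theorem finsum_blackMonomial (hv : IsNonresonant v) (ξ : Fin m → ℝ) (p : NormalFrequency v) :
    ∑ᶠ t, poisson (blackMonomial ξ p.1.2 t) (freqElem p) =
      (((p.1.2 : ℤ) : ℂ) * Complex.I * 4) •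
        ∑ x : BlackMark v p.1, (√(ξ x.1.1 * ξ x.1.2) : ℂ) • freqElem (hv.blackNbr p x) := by
  rw [finsum_eq_sum_of_injective (hv.blackTerm_injective p) (hv.support_blackMonomial_subset ξ p),
    Finset.smul_sum]
  refine Finset.sum_congr rfl fun x _ => ?_
  have hexponent : (p.1.2 : ℤ) • (unitVec x.1.1 - unitVec x.1.2) + (p.1.2 : ℤ) • p.1.1 =
      ((hv.blackNbr p x).1.2 : ℤ) • (hv.blackNbr p x).1.1 := by
    simp only [blackNbr, blackEnd, ← smul_add]
    congr 1
    abel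
  rw [poisson_blackMonomial_eq_contraction, smul_smul]
  refine (contraction_eq_smul_freqElem hexponent).trans ?_
  push_cast
  rw [mul_assoc _ (4 : ℂ)]
  rfl

theorem finsum_redContraction (hv : IsNonresonant v) (ξ : Fin m → ℝ) (p : NormalFrequency v) :
    ∑ᶠ t, redContraction ξ p t =
      (((p.1.2 : ℤ) : ℂ) * Complex.I * 2) •
        ∑ x : RedMark v p.1, (√(ξ x.1.1 * ξ x.1.2) : ℂ) • freqElem (hv.redNbr p x) := by
  rw [finsum_eq_sum_of_injective (hv.redTerm_injective p) (hv.support_redContraction_subset ξ p),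
    Finset.smul_sum]
  refine Finset.sum_congr rfl fun x _ => ?_
  have hexponent : (p.1.2 : ℤ) • (unitVec x.1.1 + unitVec x.1.2) + (p.1.2 : ℤ) • p.1.1 =
      ((hv.redNbr p x).1.2 : ℤ) • (hv.redNbr p x).1.1 := by
    simp only [redNbr, redEnd, Units.val_neg, neg_smul, ← smul_neg, ← smul_add]
    congr 1
    abel
  rw [smul_smul]
  refine (contraction_eq_smul_freqElem hexponent).trans ?_
  push_cast
  rw [mul_assoc _ (2 : ℂ)]
  rfl

theorem finsum_redMonomial (hv : IsNonresonant v) (ξ : Fin m → ℝ) (p : NormalFrequency v) :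
    ∑ᶠ t, poisson (redMonomial ξ (-p.1.2) t) (freqElem p) =
      (((p.1.2 : ℤ) : ℂ) * Complex.I * 4) •
        ∑ x : RedMark v p.1, (√(ξ x.1.1 * ξ x.1.2) : ℂ) • freqElem (hv.redNbr p x) := by
  have hfinite := hv.hasFiniteSupport_redContraction ξ p
  simp only [poisson_redMonomial_neg]
  rw [finsum_add_distrib hfinite (hfinite.preimage redTermSwap.injective.injOn),
    finsum_comp_equiv redTermSwap, hv.finsum_redContraction, ← add_smul]
  congr 1
  ring

end IsNonresonant

/-- The pair of indices of a marking. -/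
def Mark.idx {p : Frequency m} : Mark v p → Fin m × Fin m :=
  Sum.elim Subtype.val Subtype.val

/-- The neighbour of `p` along an edge. -/
def IsNonresonant.nbr (hv : IsNonresonant v) (p : NormalFrequency v) :
    Mark v p.1 → NormalFrequency v :=
  Sum.elim (hv.blackNbr p) (hv.redNbr p)

theorem IsNonresonant.adQ_freqElem (hv : IsNonresonant v) (ξ : Fin m → ℝ)
    (p : NormalFrequency v) :
    adQ v ξ (freqElem p) = (((p.1.2 : ℤ) : ℂ) * Complex.I * 4) •
      ∑ x : Mark v p.1, (√(ξ x.idx.1 * ξ x.idx.2) : ℂ) • freqElem (hv.nbr p x) := by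
  simp only [adQ_eq ξ p.1.2, poisson_redMonomial_self, finsum_zero, add_zero,
    hv.finsum_blackMonomial, hv.finsum_redMonomial, Fintype.sum_sum_type, smul_add]
  rfl

theorem exists_poisson_omega_freqElem (ξ : Fin m → ℝ) (p : NormalFrequency v) (i : Fin m) :
    ∃ d : ℂ, poisson ((omega v ξ i : ℂ) • varY v i) (freqElem p) = d • freqElem p := by
  have hY : ∀ j, j ≠ i → derivY j ((omega v ξ i : ℂ) • varY v i) = 0 := fun j hj => by
    simp [varY, derivY_single, hj]
  have hW : ∀ k s, derivW k s ((omega v ξ i : ℂ) • varY v i) = 0 := fun k s => by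
    simp [varY, derivW_single]
  refine ⟨omega v ξ i * (Complex.I * (((p.1.2 : ℤ) • p.1.1) i : ℤ)), ?_⟩
  simp only [poisson, hW, derivY_freqElem, zero_mul, sub_zero, finsum_zero, smul_zero, add_zero]
  rw [Finset.sum_eq_single i (fun j _ hj => by rw [hY j hj, zero_mul])
    fun hi => absurd (Finset.mem_univ i) hi]
  simp [varY, derivY_single, freqElem, freqExponent,
    derivX_single, AddMonoidAlgebra.single_mul_single, AddMonoidAlgebra.smul_single]

theorem poisson_Omega_freqElem (ξ : Fin m → ℝ) (p : NormalFrequency v) (k : NormalSite v) :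
    poisson ((Omega ξ k : ℂ) • (varW k 1 * varW k (-1))) (freqElem p) =
      contraction (Omega ξ k : ℂ) 0 (k, p.1.2) (k, -p.1.2) p := by
  have hmonomial : (Omega ξ k : ℂ) • (varW k 1 * varW k (-1) : PoissonAlg v) =
      expX v (Omega ξ k : ℂ) 0 * varW k p.1.2 * varW k (-p.1.2) := by
    rcases Int.units_eq_one_or p.1.2 with hσ | hσ <;>
      simp [hσ, expX, varW, AddMonoidAlgebra.single_mul_single, AddMonoidAlgebra.smul_single,
        add_comm]
  rw [hmonomial, poisson_expX_mul_varW_mul_varW, add_eq_left]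
  exact contraction_of_ne fun h => units_ne_neg_self _ (Prod.ext_iff.1 h).2

theorem support_poisson_Omega_subset (ξ : Fin m → ℝ) (p : NormalFrequency v) :
    (fun k : NormalSite v =>
      poisson ((Omega ξ k : ℂ) • (varW k 1 * varW k (-1))) (freqElem p)).support ⊆ {nsite p} := by
  intro k hk
  by_contra hne
  refine hk ?_
  simp only [poisson_Omega_freqElem]
  exact contraction_of_ne fun h => hne (Prod.ext_iff.1 h).1

theorem exists_finsum_Omega_freqElem (ξ : Fin m → ℝ) (p : NormalFrequency v) :
    ∃ d : ℂ, ∑ᶠ k : NormalSite v,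
      poisson ((Omega ξ k : ℂ) • (varW k 1 * varW k (-1))) (freqElem p) = d • freqElem p := by
  rw [finsum_eq_single _ (nsite p) fun k hk => by
    by_contra h
    exact hk (support_poisson_Omega_subset ξ p h), poisson_Omega_freqElem]
  exact ⟨_, contraction_eq_smul_freqElem (zero_add _)⟩

theorem exists_adN_freqElem (ξ : Fin m → ℝ) (p : NormalFrequency v) :
    ∃ d : ℂ, adN v ξ (freqElem p) = d • freqElem p + adQ v ξ (freqElem p) := by
  choose d hd using exists_poisson_omega_freqElem ξ p
  obtain ⟨d', hd'⟩ := exists_finsum_Omega_freqElem ξ p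
  exact ⟨∑ i, d i + d', by simp only [adN, hd, hd', add_smul, Finset.sum_smul]⟩

end Operators

section Linearity

/-- The maps which are linear on the submodule `W`. The operators `ad(N)` and `ad(Q)` are such:
being given by infinite sums of brackets, they are additive only where these sums are finite. -/
structure IsLinearMapOn {K E F : Type*} [Semiring K] [AddCommMonoid E] [Module K E]
    [AddCommMonoid F] [Module K F] (W : Submodule K E) (T : E → F) : Prop where
  map_add : ∀ {f g}, f ∈ W → g ∈ W → T (f + g) = T f + T g
  map_smul : ∀ (c : K) {f}, f ∈ W → T (c • f) = c • T f

namespace IsLinearMapOn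

section Semiring

variable {K E F : Type*} [Semiring K] [AddCommMonoid E] [Module K E] [AddCommMonoid F] [Module K F]
  {W : Submodule K E}

theorem of_isLinearMap {T : E → F} (hT : IsLinearMap K T) : IsLinearMapOn W T :=
  ⟨fun _ _ => hT.map_add _ _, fun c _ _ => hT.map_smul c _⟩

theorem add {T T' : E → F} (hT : IsLinearMapOn W T) (hT' : IsLinearMapOn W T') :
    IsLinearMapOn W fun f => T f + T' f :=
  ⟨fun hf hg => by rw [hT.map_add hf hg, hT'.map_add hf hg, add_add_add_comm],
    fun c _ hf => by rw [hT.map_smul c hf, hT'.map_smul c hf, smul_add]⟩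

theorem sum {ι : Type*} {s : Finset ι} {T : ι → E → F} (hT : ∀ i, IsLinearMapOn W (T i)) :
    IsLinearMapOn W fun f => ∑ i ∈ s, T i f :=
  ⟨fun hf hg => by simp only [(hT _).map_add hf hg, Finset.sum_add_distrib],
    fun c _ hf => by simp only [(hT _).map_smul c hf, Finset.smul_sum]⟩

theorem apply_mem_of_mem_span {T : E → F} (hT : IsLinearMapOn W T) {s : Set E}
    (hs : Submodule.span K s ≤ W) {U : Submodule K F} (hU : ∀ x ∈ s, T x ∈ U) {f : E}
    (hf : f ∈ Submodule.span K s) : T f ∈ U := by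
  induction hf using Submodule.span_induction with
  | mem x hx => exact hU x hx
  | zero =>
    have hzero := hT.map_smul 0 W.zero_mem
    rw [zero_smul, zero_smul] at hzero
    exact hzero ▸ U.zero_mem
  | add f g hf hg ihf ihg => exact hT.map_add (hs hf) (hs hg) ▸ U.add_mem ihf ihg
  | smul c f hf ihf => exact hT.map_smul c (hs hf) ▸ U.smul_mem c ihf

theorem hasFiniteSupport_of_mem_span {ι : Type*} {T : ι → E → F} (hT : ∀ i, IsLinearMap K (T i))
    {s : Set E} (hs : ∀ x ∈ s, (fun i => T i x).HasFiniteSupport) {f : E}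
    (hf : f ∈ Submodule.span K s) : (fun i => T i f).HasFiniteSupport := by
  induction hf using Submodule.span_induction with
  | mem x hx => exact hs x hx
  | zero => simp [fun i => (hT i).map_zero, Function.HasFiniteSupport]
  | add f g _ _ hf hg =>
    simp only [fun i => (hT i).map_add]
    exact hf.add hg
  | smul c f _ hf =>
    simp only [fun i => (hT i).map_smul]
    exact hf.subset (Function.support_const_smul_subset c _)

end Semiring

theorem finsum {K E F ι : Type*} [DivisionRing K] [AddCommGroup E] [Module K E] [AddCommGroup F]
    [Module K F] {T : ι → E → F} (hT : ∀ i, IsLinearMap K (T i)) {s : Set E}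
    (hs : ∀ x ∈ s, (fun i => T i x).HasFiniteSupport) :
    IsLinearMapOn (Submodule.span K s) fun f => ∑ᶠ i, T i f where
  map_add hf hg := by
    simp only [fun i => (hT i).map_add]
    exact finsum_add_distrib (hasFiniteSupport_of_mem_span hT hs hf)
      (hasFiniteSupport_of_mem_span hT hs hg)
  map_smul c f hf := by
    simp only [fun i => (hT i).map_smul]
    exact (smul_finsum' c (hasFiniteSupport_of_mem_span hT hs hf)).symm

end IsLinearMapOn

variable {n m : ℕ} {v : Fin m → Fin n → ℤ}

/-- The space spanned by the frequency basis. -/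
noncomputable def freqSpan (v : Fin m → Fin n → ℤ) : Submodule ℂ (PoissonAlg v) :=
  Submodule.span ℂ (Set.range freqElem)

theorem isLinearMapOn_finsum_poisson {ι : Type*} {F : ι → PoissonAlg v}
    (hF : ∀ p : NormalFrequency v, (fun t => poisson (F t) (freqElem p)).HasFiniteSupport) :
    IsLinearMapOn (freqSpan v) fun f => ∑ᶠ t, poisson (F t) f :=
  IsLinearMapOn.finsum (fun t => isLinearMap_poisson (F t)) (Set.forall_mem_range.2 hF)

/-- The operators depending on the parameters `ξ` which differ from `ad(Q)` by an operator which
is diagonal on the frequency basis. -/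
structure IsHopping (T : (Fin m → ℝ) → PoissonAlg v → PoissonAlg v) : Prop where
  isLinearMapOn : ∀ ξ, IsLinearMapOn (freqSpan v) (T ξ)
  apply_freqElem : ∀ ξ p, ∃ d : ℂ, T ξ (freqElem p) = d • freqElem p + adQ v ξ (freqElem p)

theorem IsNonresonant.isLinearMapOn_adQ (hv : IsNonresonant v) (ξ : Fin m → ℝ) :
    IsLinearMapOn (freqSpan v) (adQ v ξ) := by
  rw [funext (adQ_eq ξ 1)]
  exact ((isLinearMapOn_finsum_poisson (hv.hasFiniteSupport_blackMonomial ξ 1)).add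
    (isLinearMapOn_finsum_poisson (hv.hasFiniteSupport_redMonomial ξ 1))).add
    (isLinearMapOn_finsum_poisson (hv.hasFiniteSupport_redMonomial ξ (-1)))

theorem IsNonresonant.isHopping_adQ (hv : IsNonresonant v) : IsHopping (adQ v) :=
  ⟨hv.isLinearMapOn_adQ, fun _ _ => ⟨0, by rw [zero_smul, zero_add]⟩⟩

theorem IsNonresonant.isHopping_adN (hv : IsNonresonant v) : IsHopping (adN v) where
  isLinearMapOn ξ := by
    have hOmega := isLinearMapOn_finsum_poisson fun p : NormalFrequency v =>
      (Set.finite_singleton (nsite p)).subset (support_poisson_Omega_subset ξ p)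
    have homega := IsLinearMapOn.sum (W := freqSpan v) (s := Finset.univ) fun i : Fin m =>
      .of_isLinearMap (isLinearMap_poisson ((omega v ξ i : ℂ) • varY v i))
    exact (homega.add hOmega).add (hv.isLinearMapOn_adQ ξ)
  apply_freqElem := exists_adN_freqElem

end Linearity

section Neighbours

variable {n m : ℕ} {v : Fin m → Fin n → ℤ}

theorem Mark.idx_ne {p : Frequency m} : ∀ x : Mark v p, x.idx.1 ≠ x.idx.2
  | Sum.inl x => x.2.1
  | Sum.inr x => x.2.1.ne

theorem CombBlack.not_combRed {i j : Fin m} {p q q' : Frequency m} (hblack : CombBlack v i j p q)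
    (hp : site v p ∉ Set.range v) : ¬CombRed v i j p q' := by
  intro hred
  have hself : (site v p - v i) ⬝ᵥ (site v p - v i) = 0 := by
    rw [← sub_add_sub_cancel (site v p) (v j) (v i), dotProduct_add, sub_add_sub_cancel,
      (combRed_iff.1 hred).2, (combBlack_iff.1 hblack).2, add_zero]
  exact hp ⟨i, (sub_eq_zero.1 (dotProduct_self_eq_zero.1 hself)).symm⟩

namespace IsNonresonant

theorem combBlack_or_combRed_nbr (hv : IsNonresonant v) (p : NormalFrequency v) :
    ∀ x : Mark v p.1, CombBlack v x.idx.1 x.idx.2 p.1 (hv.nbr p x).1 ∨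
      CombRed v x.idx.1 x.idx.2 p.1 (hv.nbr p x).1
  | Sum.inl x => Or.inl x.2.2
  | Sum.inr x => Or.inr x.2.2

theorem adj_iff (hv : IsNonresonant v) {p q : NormalFrequency v} :
    (combinatorialGraph v).Adj p.1 q.1 ↔ ∃ x : Mark v p.1, hv.nbr p x = q := by
  constructor
  · have of_lt {i j : Fin m} (hij : i < j) (h : CombRed v i j p.1 q.1) :
        ∃ x : Mark v p.1, hv.nbr p x = q := by
      have hq := (combRed_iff.1 h).1
      exact ⟨Sum.inr ⟨(i, j), hij, hq ▸ h⟩, Subtype.ext hq.symm⟩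
    intro hadj
    obtain ⟨i, j, hij, h | h⟩ := combinatorialGraph_adj.1 hadj
    · have hq := (combBlack_iff.1 h).1
      exact ⟨Sum.inl ⟨(i, j), hij, hq ▸ h⟩, Subtype.ext hq.symm⟩
    · exact hij.lt_or_gt.elim (of_lt · h) (of_lt · h.swap)
  · rintro ⟨x, rfl⟩
    exact combinatorialGraph_adj.2 ⟨_, _, x.idx_ne, hv.combBlack_or_combRed_nbr p x⟩

theorem not_combBlack_swap (hv : IsNonresonant v) {i j : Fin m} (hij : i ≠ j)
    {p q q' : Frequency m} (h : CombBlack v i j p q) : ¬CombBlack v j i p q' := by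
  intro h'
  have hangle := (combBlack_iff.1 h).2
  have hangle' := (combBlack_iff.1 h').2
  have hself : (v j - v i) ⬝ᵥ (v j - v i) = 0 := by
    rw [← neg_sub (v j) (v i), dotProduct_neg, neg_eq_zero] at hangle'
    rw [← sub_sub_sub_cancel_left (v i) (v j) (site v p), sub_dotProduct,
      sub_sub_sub_cancel_left, hangle, hangle', sub_zero]
  exact hij (hv.injective (sub_eq_zero.1 (dotProduct_self_eq_zero.1 hself)).symm)

theorem nbr_eq_nbr (hv : IsNonresonant v) (p : NormalFrequency v) {x y : Mark v p.1}
    (h : s(x.idx.1, x.idx.2) = s(y.idx.1, y.idx.2)) : hv.nbr p x = hv.nbr p y := by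
  have hne := x.idx_ne
  rcases Sym2.eq_iff.1 h with ⟨hfst, hsnd⟩ | ⟨hfst, hsnd⟩ <;>
    rcases hv.combBlack_or_combRed_nbr p x with hx | hx <;>
    rcases hv.combBlack_or_combRed_nbr p y with hy | hy <;>
    rw [hfst, hsnd] at hx hne
  · exact Subtype.ext ((combBlack_iff.1 hx).1.trans (combBlack_iff.1 hy).1.symm)
  · exact absurd hy (hx.not_combRed p.2)
  · exact absurd hx (hy.not_combRed p.2)
  · exact Subtype.ext ((combRed_iff.1 hx).1.trans (combRed_iff.1 hy).1.symm)
  · exact absurd hy (hv.not_combBlack_swap hne hx)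
  · exact absurd hy.swap (hx.not_combRed p.2)
  · exact absurd hx.swap (hy.not_combRed p.2)
  · exact Subtype.ext ((combRed_iff.1 hx.swap).1.trans (combRed_iff.1 hy).1.symm)

end IsNonresonant

end Neighbours

section FrequencyBasis

variable {n m : ℕ} {v : Fin m → Fin n → ℤ}

theorem freqExponent_injective :
    Function.Injective (freqExponent : NormalFrequency v → Exponent v) := by
  intro p q h
  have hfreq : (p.1.2 : ℤ) • p.1.1 = (q.1.2 : ℤ) • q.1.1 := congrArg Prod.fst h
  have hnormal : (nsite p, p.1.2) = (nsite q, q.1.2) :=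
    Finsupp.single_left_injective one_ne_zero (congrArg (fun a : Exponent v => a.2.2) h)
  have hcolor : p.1.2 = q.1.2 := (Prod.ext_iff.1 hnormal).2
  rw [hcolor] at hfreq
  exact Subtype.ext (Prod.ext (smul_right_injective _ q.1.2.ne_zero hfreq) hcolor)

/-- The coefficient of the element of the frequency basis of `q`. -/
noncomputable def freqCoeff (q : NormalFrequency v) : PoissonAlg v →ₗ[ℂ] ℂ where
  toFun f := f.coeff (freqExponent q)
  map_add' _ _ := rfl
  map_smul' _ _ := rfl

theorem freqCoeff_freqElem (p q : NormalFrequency v) :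
    freqCoeff q (freqElem p) = if p = q then 1 else 0 := by
  change (freqElem p).coeff (freqExponent q) = _
  rw [freqElem, AddMonoidAlgebra.coeff_single, Finsupp.single_apply]
  simp only [freqExponent_injective.eq_iff]

theorem linearIndependent_freqElem :
    LinearIndependent ℂ (freqElem : NormalFrequency v → PoissonAlg v) :=
  LinearIndependent.of_pairwise_dual_eq_zero_one _ freqCoeff
    (fun p q h => (freqCoeff_freqElem q p).trans (if_neg h.symm))
    (fun p => (freqCoeff_freqElem p p).trans (if_pos rfl))

theorem freqCoeff_eq_zero {U : Set (NormalFrequency v)} {q : NormalFrequency v} (hq : q ∉ U)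
    {f : PoissonAlg v} (hf : f ∈ Submodule.span ℂ (freqElem '' U)) : freqCoeff q f = 0 := by
  have hle : Submodule.span ℂ (freqElem '' U) ≤ LinearMap.ker (freqCoeff q) := by
    rw [Submodule.span_le, Set.image_subset_iff]
    intro p hp
    exact (freqCoeff_freqElem p q).trans (if_neg (ne_of_mem_of_not_mem hp hq))
  exact hle hf

namespace IsHopping

variable {T : (Fin m → ℝ) → PoissonAlg v → PoissonAlg v}

theorem freqCoeff_ne_zero_iff (hT : IsHopping T) (hv : IsNonresonant v) {ξ : Fin m → ℝ}
    (hξ : ∀ i, 0 < ξ i) {p q : NormalFrequency v} (hpq : p ≠ q) :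
    freqCoeff q (T ξ (freqElem p)) ≠ 0 ↔ (combinatorialGraph v).Adj p.1 q.1 := by
  have hweight (x : Mark v p.1) : √(ξ x.idx.1 * ξ x.idx.2) ≠ 0 :=
    (Real.sqrt_pos.2 (mul_pos (hξ _) (hξ _))).ne'
  have hcoeff : freqCoeff q (T ξ (freqElem p)) = ((p.1.2 : ℤ) * Complex.I * 4) *
      (∑ x : Mark v p.1, if hv.nbr p x = q then √(ξ x.idx.1 * ξ x.idx.2) else 0 : ℝ) := by
    obtain ⟨d, hd⟩ := hT.apply_freqElem ξ p
    rw [hd, hv.adQ_freqElem]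
    simp only [map_add, map_smul, map_sum, freqCoeff_freqElem, if_neg hpq, smul_eq_mul, mul_zero,
      zero_add, mul_ite, mul_one, Complex.ofReal_sum, apply_ite Complex.ofReal, Complex.ofReal_zero]
  rw [hcoeff, mul_ne_zero_iff, and_iff_right (by simp), Complex.ofReal_ne_zero, Ne,
    Finset.sum_eq_zero_iff_of_nonneg fun x _ => by positivity, hv.adj_iff]
  simp only [Finset.mem_univ, forall_const, not_forall, ite_eq_right_iff, hweight, imp_false,
    not_not]

theorem apply_mem_span (hT : IsHopping T) (hv : IsNonresonant v) {U : Set (NormalFrequency v)}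
    (hU : ∀ p q : NormalFrequency v, p ∈ U → (combinatorialGraph v).Adj p.1 q.1 → q ∈ U)
    (ξ : Fin m → ℝ) {f : PoissonAlg v} (hf : f ∈ Submodule.span ℂ (freqElem '' U)) :
    T ξ f ∈ Submodule.span ℂ (freqElem '' U) := by
  refine (hT.isLinearMapOn ξ).apply_mem_of_mem_span
    (Submodule.span_mono (Set.image_subset_range _ _)) (Set.forall_mem_image.2 fun p hp => ?_) hf
  obtain ⟨d, hd⟩ := hT.apply_freqElem ξ p
  rw [hd, hv.adQ_freqElem]
  exact add_mem (Submodule.smul_mem _ _ (Submodule.subset_span ⟨p, hp, rfl⟩))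
    (Submodule.smul_mem _ _ (Submodule.sum_mem _ fun x _ => Submodule.smul_mem _ _
      (Submodule.subset_span ⟨_, hU p _ hp (hv.adj_iff.2 ⟨x, rfl⟩), rfl⟩)))

end IsHopping

end FrequencyBasis

section Generation

variable {n m : ℕ} {v : Fin m → Fin n → ℤ} {T : (Fin m → ℝ) → PoissonAlg v → PoissonAlg v}

/-- The square roots of the parameters used to separate the markings of the edges: `a` at `i`,
`b` at `j`, and `1` elsewhere. -/
def testParam (i j : Fin m) (a b : ℝ) (l : Fin m) : ℝ :=
  if l = i then a else if l = j then b else 1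

theorem testParam_pos (i j : Fin m) {a b : ℝ} (ha : 0 < a) (hb : 0 < b) (l : Fin m) :
    0 < testParam i j a b l := by
  unfold testParam
  split_ifs <;> first | assumption | exact one_pos

theorem testParam_second_difference {i j l l' : Fin m} (hij : i ≠ j) (hl : l ≠ l') :
    testParam i j 2 2 l * testParam i j 2 2 l' - testParam i j 2 1 l * testParam i j 2 1 l' -
      testParam i j 1 2 l * testParam i j 1 2 l' + testParam i j 1 1 l * testParam i j 1 1 l' =
      if s(l, l') = s(i, j) then 1 else 0 := by
  simp only [testParam, Sym2.eq_iff]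
  by_cases h1 : l = i <;> by_cases h2 : l = j <;> by_cases h3 : l' = i <;>
    by_cases h4 : l' = j <;> simp_all <;> norm_num

theorem IsHopping.sum_smul_freqElem_nbr_mem (hT : IsHopping T) (hv : IsNonresonant v)
    {W : Submodule ℂ (PoissonAlg v)} {p : NormalFrequency v} (hp : freqElem p ∈ W)
    (hW : ∀ ξ : Fin m → ℝ, (∀ i, 0 < ξ i) → T ξ (freqElem p) ∈ W) {s : Fin m → ℝ}
    (hs : ∀ l, 0 < s l) :
    ∑ x : Mark v p.1, ((s x.idx.1 * s x.idx.2 : ℝ) : ℂ) • freqElem (hv.nbr p x) ∈ W := by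
  have hfactor : ((p.1.2 : ℤ) : ℂ) * Complex.I * 4 ≠ 0 := by simp
  have hmem := hW (fun l => s l ^ 2) fun l => pow_pos (hs l) 2
  obtain ⟨d, hd⟩ := hT.apply_freqElem (fun l => s l ^ 2) p
  rw [hd, Submodule.add_mem_iff_right _ (W.smul_mem _ hp), hv.adQ_freqElem,
    W.smul_mem_iff hfactor] at hmem
  simpa only [← mul_pow, fun x y => Real.sqrt_sq (mul_pos (hs x) (hs y)).le] using hmem

theorem IsNonresonant.sum_testParam_second_difference (hv : IsNonresonant v)
    (p : NormalFrequency v) (x₀ : Mark v p.1) :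
    let w (a b : ℝ) (x : Mark v p.1) : ℝ :=
      testParam x₀.idx.1 x₀.idx.2 a b x.idx.1 * testParam x₀.idx.1 x₀.idx.2 a b x.idx.2
    ∑ x : Mark v p.1, ((w 2 2 x - w 2 1 x - w 1 2 x + w 1 1 x : ℝ) : ℂ) • freqElem (hv.nbr p x) =
      ((Finset.univ.filter fun x : Mark v p.1 =>
        s(x.idx.1, x.idx.2) = s(x₀.idx.1, x₀.idx.2)).card : ℂ) • freqElem (hv.nbr p x₀) := by
  intro w
  rw [← Finset.sum_boole, Finset.sum_smul]
  refine Finset.sum_congr rfl fun x _ => ?_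
  rw [testParam_second_difference x₀.idx_ne x.idx_ne]
  split_ifs with h
  · rw [hv.nbr_eq_nbr p h, Complex.ofReal_one]
  · rw [Complex.ofReal_zero, zero_smul, zero_smul]

theorem IsHopping.freqElem_mem_of_adj (hT : IsHopping T) (hv : IsNonresonant v)
    {W : Submodule ℂ (PoissonAlg v)} {p q : NormalFrequency v} (hp : freqElem p ∈ W)
    (hW : ∀ ξ : Fin m → ℝ, (∀ i, 0 < ξ i) → T ξ (freqElem p) ∈ W)
    (hpq : (combinatorialGraph v).Adj p.1 q.1) : freqElem q ∈ W := by
  obtain ⟨x₀, rfl⟩ := hv.adj_iff.1 hpq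
  have hsum {a b : ℝ} (ha : 0 < a) (hb : 0 < b) := hT.sum_smul_freqElem_nbr_mem hv hp hW
    (testParam_pos x₀.idx.1 x₀.idx.2 ha hb)
  have hdiff := add_mem (sub_mem (sub_mem (hsum two_pos two_pos) (hsum two_pos one_pos))
    (hsum one_pos two_pos)) (hsum one_pos one_pos)
  simp only [← Finset.sum_sub_distrib, ← Finset.sum_add_distrib, ← sub_smul, ← add_smul,
    ← Complex.ofReal_sub, ← Complex.ofReal_add] at hdiff
  rw [hv.sum_testParam_second_difference p x₀] at hdiff
  refine (W.smul_mem_iff ?_).1 hdiff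
  rw [Nat.cast_ne_zero, Finset.card_ne_zero]
  exact ⟨x₀, Finset.mem_filter.2 ⟨Finset.mem_univ _, rfl⟩⟩

/-- The frequencies in the connected component of `p` in `Λ_S`. -/
def reachableSet (p : NormalFrequency v) : Set (NormalFrequency v) :=
  {q | (combinatorialGraph v).Reachable p.1 q.1}

theorem IsNonresonant.mem_of_reachable (hv : IsNonresonant v) {U : Set (NormalFrequency v)}
    (hU : ∀ p q : NormalFrequency v, p ∈ U → (combinatorialGraph v).Adj p.1 q.1 → q ∈ U)
    {p q : NormalFrequency v} (hp : p ∈ U) (hq : q ∈ reachableSet p) : q ∈ U := by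
  obtain ⟨p, hpn⟩ := p
  obtain ⟨q, hqn⟩ := q
  obtain ⟨w⟩ : (combinatorialGraph v).Reachable p q := hq
  induction w with
  | nil => exact hp
  | cons h _ ih => exact ih (hv.site_notMem_range_of_adj h hpn) (hU _ _ hp h) hqn

theorem IsHopping.block_le_span (hT : IsHopping T) (hv : IsNonresonant v) {p : NormalFrequency v} :
    block T (freqElem p) ≤ Submodule.span ℂ (freqElem '' reachableSet p) := by
  refine Submodule.span_le.2 fun g hg => ?_
  induction hg with
  | base => exact Submodule.subset_span ⟨p, SimpleGraph.Reachable.refl _, rfl⟩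
  | step ξ g _ _ ih => exact hT.apply_mem_span hv (fun _ _ hq h => hq.trans h.reachable) ξ ih

theorem IsHopping.apply_mem_block (hT : IsHopping T) (hv : IsNonresonant v)
    {p : NormalFrequency v} {ξ : Fin m → ℝ} (hξ : ∀ i, 0 < ξ i) {f : PoissonAlg v}
    (hf : f ∈ block T (freqElem p)) : T ξ f ∈ block T (freqElem p) :=
  (hT.isLinearMapOn ξ).apply_mem_of_mem_span
    ((hT.block_le_span hv).trans (Submodule.span_mono (Set.image_subset_range _ _)))
    (fun g hg => Submodule.subset_span (IsTransform.step ξ g hξ hg)) hf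

theorem IsHopping.block_eq_span (hT : IsHopping T) (hv : IsNonresonant v)
    (p : NormalFrequency v) :
    block T (freqElem p) = Submodule.span ℂ (freqElem '' reachableSet p) := by
  refine (hT.block_le_span hv).antisymm ?_
  refine Submodule.span_le.2 (Set.image_subset_iff.2 fun q hq => ?_)
  exact hv.mem_of_reachable (U := freqElem ⁻¹' block T (freqElem p))
    (fun q q' hq h => hT.freqElem_mem_of_adj hv hq (fun ξ hξ => hT.apply_mem_block hv hξ hq) h)
    (Submodule.subset_span IsTransform.base) hq

theorem IsHopping.block_le_of_apply_mem (hT : IsHopping T) (hv : IsNonresonant v)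
    {p : NormalFrequency v} {ξ : Fin m → ℝ} (hξ : ∀ i, 0 < ξ i) {U : Set (NormalFrequency v)}
    (hp : p ∈ U)
    (hU : ∀ f ∈ Submodule.span ℂ (freqElem '' U), T ξ f ∈ Submodule.span ℂ (freqElem '' U)) :
    block T (freqElem p) ≤ Submodule.span ℂ (freqElem '' U) := by
  rw [hT.block_eq_span hv]
  refine Submodule.span_mono (Set.image_mono fun q hq =>
    hv.mem_of_reachable (fun q q' hq hadj => ?_) hp hq)
  by_contra hq'
  exact (hT.freqCoeff_ne_zero_iff hv hξ (ne_of_mem_of_not_mem hq hq')).2 hadj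
    (freqCoeff_eq_zero hq' (hU _ (Submodule.subset_span ⟨q, hq, rfl⟩)))

theorem IsNonresonant.bijOn_site_reachableSet (hv : IsNonresonant v) (p : NormalFrequency v) :
    Set.BijOn (fun q : NormalFrequency v => toEuclid (site v q.1)) (reachableSet p)
      ((geometricGraph v).connectedComponentMk (toEuclid (site v p.1))).supp := by
  have hbij := hv.bijOn_site p.2
  have hreach {q : Frequency m} : q ∈ ((combinatorialGraph v).connectedComponentMk p.1).supp ↔
      (combinatorialGraph v).Reachable p.1 q :=
    SimpleGraph.ConnectedComponent.eq.trans (SimpleGraph.reachable_comm)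
  refine ⟨fun q hq => hbij.mapsTo (hreach.2 hq), fun q hq q' hq' h =>
    Subtype.ext (hbij.injOn (hreach.2 hq) (hreach.2 hq') h), fun x hx => ?_⟩
  obtain ⟨q, hq, hqx⟩ := hbij.surjOn hx
  exact ⟨⟨q, hv.site_notMem_range_of_reachable (hreach.1 hq) p.2⟩, hreach.1 hq, hqx⟩

theorem IsHopping.exists_basis (hT : IsHopping T) (hv : IsNonresonant v) (p : NormalFrequency v) :
    ∃ b : Module.Basis
        ((geometricGraph v).connectedComponentMk (toEuclid (site v p.1))).supp ℂ
        (block T (freqElem p)),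
      ∀ x, ∃ q : NormalFrequency v, (combinatorialGraph v).Reachable p.1 q.1 ∧
        toEuclid (site v q.1) = x.1 ∧ (b x : PoissonAlg v) = freqElem q := by
  let e := (hv.bijOn_site_reachableSet p).equiv
  have hspan : Submodule.span ℂ (Set.range fun q : reachableSet p => freqElem q.1) =
      block T (freqElem p) := by
    rw [hT.block_eq_span hv, Set.image_eq_range]
  refine ⟨((Module.Basis.span (linearIndependent_freqElem.comp _ Subtype.val_injective)).map
    (LinearEquiv.ofEq _ _ hspan)).reindex e, fun x => ⟨(e.symm x).1, (e.symm x).2,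
      congrArg Subtype.val (e.apply_symm_apply x), ?_⟩⟩
  rw [Module.Basis.reindex_apply, Module.Basis.map_apply, LinearEquiv.coe_ofEq_apply,
    Module.Basis.coe_span_apply]
  rfl

end Generation

section Main

variable {n m : ℕ} {v : Fin m → Fin n → ℤ}

theorem AvoidsResonances.isNonresonant (hn : n ≠ 0) (hv : AvoidsResonances v) :
    IsNonresonant v where
  angle _ _ _ hxy hxz := hv.angle_ne_zero hn hxy hxz
  eq_of_site_eq _ _ hp hpq hsite := hv.eq_of_site_eq hn hp hpq hsite

theorem isNonresonant_of_isEmpty [IsEmpty (Fin m)] : IsNonresonant v where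
  angle x := isEmptyElim x
  eq_of_site_eq p q _ hpq _ := by
    obtain ⟨w⟩ := hpq
    cases w with
    | nil => rfl
    | cons h _ => exact isEmptyElim (combinatorialGraph_adj.1 h).choose

theorem exists_resonances_isNonresonant (n : ℕ) :
    ∃ R : Finset (Σ k : ℕ, MvPolynomial (Fin k × Fin n) ℤ),
      (∀ r ∈ R, r.1 ≤ 2 * n + 2 ∧ r.2 ≠ 0) ∧
      ∀ (m : ℕ) (v : Fin m → Fin n → ℤ), IsGeneric R v →
        IsNonresonant v ∨
          IsEmpty (NormalFrequency v) ∧ Subsingleton (EuclideanSpace ℝ (Fin n)) := by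
  obtain ⟨R, hR, hgen⟩ := exists_resonances n
  refine ⟨R, hR, fun m v hv => ?_⟩
  rcases eq_or_ne n 0 with rfl | hn
  · rcases m.eq_zero_or_pos with rfl | hm
    · exact Or.inl isNonresonant_of_isEmpty
    · exact Or.inr ⟨⟨fun p => p.2 ⟨⟨0, hm⟩, Subsingleton.elim _ _⟩⟩, inferInstance⟩
  · exact Or.inl ((hgen m v hv).isNonresonant hn)

end Main

end NLSGraph

open NLSGraph in
theorem mainTheorem5 (n : ℕ) :
    ∃ R : Finset (Σ k : ℕ, MvPolynomial (Fin k × Fin n) ℤ),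
      (∀ r ∈ R, r.1 ≤ 2 * n + 2 ∧ r.2 ≠ 0) ∧
      ∀ (m : ℕ) (v : Fin m → Fin n → ℤ), IsGeneric R v →
        -- the edges of the combinatorial graph are the non-zero off-diagonal entries of `ad(N)`
        (∀ (ξ : Fin m → ℝ), (∀ i, 0 < ξ i) → ∀ p q : NormalFrequency v, p ≠ q →
          ((adN v ξ (freqElem p)).coeff (freqExponent q) ≠ 0 ↔
            (combinatorialGraph v).Adj p.1 q.1)) ∧
        -- the vectors of `S` form a connected component of the geometric graph
        (∀ i : Fin m, ((geometricGraph v).connectedComponentMk (toEuclid (v i))).supp =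
          Set.range fun j => toEuclid (v j)) ∧
        ∀ p₀ : NormalFrequency v,
          -- `-π` is a graph isomorphism of the components, compatible with colours and markings
          (∃ φ : (combinatorialGraph v).induce
                ((combinatorialGraph v).connectedComponentMk p₀.1).supp ≃g
              (geometricGraph v).induce
                ((geometricGraph v).connectedComponentMk (toEuclid (site v p₀.1))).supp,
            (∀ p, (φ p : EuclideanSpace ℝ (Fin n)) = toEuclid (site v p.1)) ∧
            ∀ p q, ∀ i j : Fin m, i ≠ j →
              (CombBlack v i j p.1 q.1 ↔ GeoBlack v i j (φ p).1 (φ q).1) ∧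
              (CombRed v i j p.1 q.1 ↔ GeoRed v i j (φ p).1 (φ q).1)) ∧
          -- the block generated by the frequency `p₀` has a basis extracted from the frequency
          -- basis, indexed through `-π` by the vertices of the geometric component
          (∃ b : Module.Basis
              ((geometricGraph v).connectedComponentMk (toEuclid (site v p₀.1))).supp ℂ
              (block (adN v) (freqElem p₀)),
            ∀ x, ∃ q : NormalFrequency v,
              (combinatorialGraph v).Reachable p₀.1 q.1 ∧
              toEuclid (site v q.1) = x.1 ∧ (b x : PoissonAlg v) = freqElem q) ∧
          block (adQ v) (freqElem p₀) = block (adN v) (freqElem p₀) ∧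
          -- for every fixed parameter, the block is the smallest invariant space containing
          -- the generator among those spanned by elements of the frequency basis
          ∀ (ξ : Fin m → ℝ), (∀ i, 0 < ξ i) →
            (∀ f ∈ block (adN v) (freqElem p₀), adN v ξ f ∈ block (adN v) (freqElem p₀)) ∧
            ∀ U : Set (NormalFrequency v), p₀ ∈ U →
              (∀ f ∈ Submodule.span ℂ (freqElem '' U),
                adN v ξ f ∈ Submodule.span ℂ (freqElem '' U)) →
              block (adN v) (freqElem p₀) ≤ Submodule.span ℂ (freqElem '' U) := by
  obtain ⟨R, hR, hgen⟩ := exists_resonances_isNonresonant n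
  refine ⟨R, hR, fun m v hv => ?_⟩
  obtain hv | ⟨hempty, hsub⟩ := hgen m v hv
  · have hQ := hv.isHopping_adQ
    have hN := hv.isHopping_adN
    exact ⟨fun ξ hξ p q hpq => hN.freqCoeff_ne_zero_iff hv hξ hpq, hv.supp_connectedComponentMk,
      fun p₀ => ⟨hv.exists_iso p₀.2, hN.exists_basis hv p₀,
        (hQ.block_eq_span hv p₀).trans (hN.block_eq_span hv p₀).symm,
        fun ξ hξ => ⟨fun f hf => hN.apply_mem_block hv hξ hf,
          fun U hp hU => hN.block_le_of_apply_mem hv hξ hp hU⟩⟩⟩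
  · refine ⟨fun _ _ p => hempty.elim p, fun i => ?_, fun p => hempty.elim p⟩
    ext x
    obtain rfl : toEuclid (v i) = x := Subsingleton.elim _ _
    exact iff_of_true rfl ⟨i, rfl⟩
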